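/- **Model.** Let $\mathcal I,\mathcal J$ be finite sets (customer classes and service stations). For each $n\in\mathbb N=\{1,2,\dots\}$ there are arrival rates $\lambda_i^n>0$, service rates $\mu_{ij}^n\ge 0$, numbers of servers $N_j^n\in\mathbb Z_+$ and deterministic initial numbers of customers $X_i^{0,n}\in\mathbb Z_+$ ($i\in\mathcal I$, $j\in\mathcal J$). On a probability space there are random variables $\check U_i(k)$ ($i\in\mathcal I$, $k\in\mathbb N$), independent, identically distributed in $k$ for each $i$, strictly positive, with mean $1$ and finite variance, and $A_i^n(t)=\sup\{l\ge 0:\sum_{k=1}^{l}\check U_i(k)/\lambda_i^n\le t\}$. For each $n$ there are mutually independent Poisson processes $S_{ij}^n$ with rates $\mu_{ij}^n$ (the zero process if $\mu^n_{ij}=0$), independent of the arrival processes $(A_i^n)_i$. A *(preemptive) scheduling control policy (SCP)* for the $n$th system is a $\mathbb Z_+$-valued process $\Psi^n=(\Psi_{ij}^n)$ with right-continuous paths for which there are processes $X_i^n,Y_i^n,Z_j^n$ with values in $\mathbb Z_+$ such that $\Psi^n_{ij}=0$ whenever $\mu^n_{ij}=0$, and for all $t\ge 0$, $i$, $j$,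 almost surely, $$X_i^n(t)=X_i^{0,n}+A_i^n(t)-\sum_{j}S_{ij}^n\Big(\int_0^t\Psi_{ij}^n(s)\,ds\Big),\qquad Y_i^n(t)+\sum_j\Psi_{ij}^n(t)=X_i^n(t),\qquad Z_j^n(t)+\sum_i\Psi_{ij}^n(t)=N_j^n,$$ and such that for every $t$ the variable $\Psi^n(t)$ is measurable with respect to $\sigma\{X^n(s),A^n(s):s\le t\}$. Here $X_i^n$, $Y_i^n$ count the class-$i$ customers in the system and those waiting in the buffer. **Fluid model.** Let $\lambda_i>0$, $\nu_j>0$, $\mu_{ij}\ge 0$ be constants such that $\mu_{ij}^n>0$ if and only if $\mu_{ij}>0$, for all $n,i,j$. Consider the linear program: minimize $\rho\ge 0$ over $(\xi,\rho)$ subject to $\sum_j\mu_{ij}\nu_j\xi_{ij}=\lambda_i$ for all $i$, $\sum_i\xi_{ij}\le\rho$ for all $j$, $\xi_{ij}\ge 0$. **Assumptions.** 1. (Critical load) There is an optimal solution $(\xi^*,\rho^*)$ with $\sum_i\xi^*_{ij}=1$ for all $j$. Fix such a $\xi^*$ and put $x_i^*=\sum_j\xi^*_{ij}\nu_j$. 2.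 The graph with vertex set $\mathcal I\cup\mathcal J$ (disjoint union) and edges $(i,j)$ for all $i,j$ with $\mu_{ij}>0$ and $\xi^*_{ij}>0$ is a tree. 3. There is a constant $c<\infty$ such that for all $i,j,n$ $$|n^{-1}\lambda_i^n-\lambda_i|\vee|\mu_{ij}^n-\mu_{ij}|\vee|n^{-1}N_j^n-\nu_j|\vee|n^{-1}X_i^{0,n}-x_i^*|\le c\,n^{-1/2}.$$ The static fluid model is *throughput suboptimal* if there is a matrix $\xi$ with $\xi_{ij}\ge 0$, $\sum_i\xi_{ij}\le 1$ for all $j$ and $\sum_j\xi_{ij}\nu_j\le x_i^*$ for all $i$, such that $\sum_{i,j}\mu_{ij}\nu_j\xi_{ij}>\sum_i\lambda_i$. **Theorem 1.** Let Assumptions 1–3 hold. If the static fluid model is throughput suboptimal, then there is a sequence of SCPs $\Psi^n$, $n\in\mathbb N$, not depending on $T$ and $\varrho$, under which, for all $0<T<\infty$ and $\varrho>1/2$, as $n\to\infty$, $$\int_0^T 1_{\{\sum_iY_i^n(s)>0\}}\,ds\to 0\quad\text{in probability},\qquad n^{-\varrho}\sup_{0\le t\le T}\sum_i|X_i^n(t)-X_i^{0,n}|\to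 0\quad\text{in probability}.$$ -/

import Mathlib

open MeasureTheory ProbabilityTheory Filter Topology
open scoped NNReal ENNReal

namespace ManyServer

/-! ### The static fluid model -/

/-- Data of the static fluid model: arrival rates `lam i` of the classes, capacities `nu j` of the
stations, and service rates `mu i j` (`mu i j = 0` when station `j` cannot serve class `i`). -/
structure Fluid (I J : Type*) where
  lam : I → ℝ
  nu : J → ℝ
  mu : I → J → ℝ
  lam_pos : ∀ i, 0 < lam i
  nu_pos : ∀ j, 0 < nu j
  mu_nonneg : ∀ i j, 0 ≤ mu i j

section Fluid

variable {I J : Type*} [Fintype I] [Fintype J]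

/-- Feasibility of `(ξ, ρ)` for the linear program "minimize `ρ`". -/
structure Fluid.IsFeasible (F : Fluid I J) (ξ : I → J → ℝ) (ρ : ℝ) : Prop where
  rho_nonneg : 0 ≤ ρ
  balance : ∀ i, ∑ j, F.mu i j * F.nu j * ξ i j = F.lam i
  load : ∀ j, ∑ i, ξ i j ≤ ρ
  nonneg : ∀ i j, 0 ≤ ξ i j

/-- `(ξ, ρ)` is an optimal solution of the linear program. -/
def Fluid.IsOptimal (F : Fluid I J) (ξ : I → J → ℝ) (ρ : ℝ) : Prop :=
  F.IsFeasible ξ ρ ∧ ∀ ξ' ρ', F.IsFeasible ξ' ρ' → ρ ≤ ρ'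

/-- Critical load: `ξ` is part of an optimal solution of the linear program, and all its column
sums are equal to one. -/
def Fluid.IsCritical (F : Fluid I J) (ξ : I → J → ℝ) : Prop :=
  (∃ ρ, F.IsOptimal ξ ρ) ∧ ∀ j, ∑ i, ξ i j = 1

/-- The amount of class-`i` fluid in the system under the allocation `ξ`. -/
def Fluid.mass (F : Fluid I J) (ξ : I → J → ℝ) (i : I) : ℝ := ∑ j, ξ i j * F.nu j

/-- The graph of basic activities: classes and stations are the vertices, and `i`, `j` are joined
when station `j` can serve class `i` and `ξ i j > 0`. -/
def Fluid.basicGraph (F : Fluid I J) (ξ : I → J → ℝ) : SimpleGraph (I ⊕ J) :=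
  SimpleGraph.fromRel fun u v =>
    ∃ i j, u = Sum.inl i ∧ v = Sum.inr j ∧ 0 < F.mu i j ∧ 0 < ξ i j

/-- Allocation matrices. -/
def IsAllocation (ξ : I → J → ℝ) : Prop :=
  (∀ i j, 0 ≤ ξ i j) ∧ ∀ j, ∑ i, ξ i j ≤ 1

/-- Throughput optimality, relative to the critical allocation `ξs`: an allocation that holds no
more fluid of any class than `ξs` does cannot process fluid faster than it arrives in total. -/
def Fluid.ThroughputOptimal (F : Fluid I J) (ξs : I → J → ℝ) : Prop :=
  ∀ ξ : I → J → ℝ, IsAllocation ξ → (∀ i, ∑ j, ξ i j * F.nu j ≤ F.mass ξs i) →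
    ∑ i, ∑ j, F.mu i j * F.nu j * ξ i j ≤ ∑ i, F.lam i

/-- Throughput suboptimality. -/
def Fluid.ThroughputSuboptimal (F : Fluid I J) (ξs : I → J → ℝ) : Prop :=
  ¬ F.ThroughputOptimal ξs

end Fluid

/-! ### The queueing systems -/

/-- Parameters of one queueing system: arrival rates, individual service rates, numbers of servers
at the stations, and initial numbers of customers of the classes. -/
structure System (I J : Type*) where
  lam : I → ℝ
  mu : I → J → ℝ
  servers : J → ℕ
  init : I → ℕ
  lam_pos : ∀ i, 0 < lam i
  mu_nonneg : ∀ i j, 0 ≤ mu i j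

/-- Second-order convergence of the parameters and of the initial condition: all deviations from
the fluid limit are at most `c * n ^ (-1/2)`. -/
def SecondOrder {I J : Type*} [Fintype J] (F : Fluid I J) (ξ : I → J → ℝ)
    (sys : ℕ+ → System I J) : Prop :=
  ∃ c : ℝ, ∀ (i : I) (j : J) (n : ℕ+),
    |(sys n).lam i / (n : ℝ) - F.lam i| ≤ c * (n : ℝ) ^ (-(1 / 2) : ℝ) ∧
    |(sys n).mu i j - F.mu i j| ≤ c * (n : ℝ) ^ (-(1 / 2) : ℝ) ∧
    |((sys n).servers j : ℝ) / (n : ℝ) - F.nu j| ≤ c * (n : ℝ) ^ (-(1 / 2) : ℝ) ∧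
    |((sys n).init i : ℝ) / (n : ℝ) - F.mass ξ i| ≤ c * (n : ℝ) ^ (-(1 / 2) : ℝ)

section Processes

variable {I J Ω : Type*} [MeasurableSpace Ω]

/-- The basic interarrival times: `U i 0, U i 1, …` are the (unscaled) interarrival times of
class `i`; they are independent over all classes and indices, identically distributed within a
class, strictly positive, of mean one and of finite variance. -/
structure IsRenewalInput (U : I → ℕ → Ω → ℝ) (P : Measure Ω) : Prop where
  measurable : ∀ i k, Measurable (U i k)
  indep : iIndepFun (fun p : I × ℕ => U p.1 p.2) P
  identDistrib : ∀ i k, IdentDistrib (U i k) (U i 0) P P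
  pos : ∀ i k, ∀ᵐ ω ∂P, 0 < U i k ω
  sq_integrable : ∀ i, MemLp (U i 0) 2 P
  mean : ∀ i, ∫ ω, U i 0 ω ∂P = 1

/-- The number of class-`i` arrivals up to time `t` when class `i` has arrival rate `lam i`. -/
noncomputable def arrivals (U : I → ℕ → Ω → ℝ) (lam : I → ℝ) (i : I) (t : ℝ≥0) (ω : Ω) : ℕ :=
  sSup {l : ℕ | ∑ k ∈ Finset.range l, U i k ω / lam i ≤ t}

/-- `N` is a Poisson process of rate `r` (for `r = 0` it is almost surely the zero process). -/
structure IsPoissonProcess (N : ℝ≥0 → Ω → ℕ) (r : ℝ≥0) (P : Measure Ω) : Prop where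
  measurable : ∀ t, Measurable (N t)
  paths : ∀ᵐ ω ∂P, N 0 ω = 0 ∧ Monotone (fun t => N t ω) ∧
    ∀ t, ContinuousWithinAt (fun s => N s ω) (Set.Ici t) t
  indep_increments : HasIndepIncrements N P
  law : ∀ s t, s ≤ t → P.map (fun ω => N t ω - N s ω) = poissonMeasure (r * (t - s))

/-- The service processes of one system: independent Poisson processes with rates `mu i j`, which
are jointly independent of the arrival processes `A`. -/
structure IsServiceInput (S : I → J → ℝ≥0 → Ω → ℕ) (mu : I → J → ℝ)
    (A : I → ℝ≥0 → Ω → ℕ) (P : Measure Ω) : Prop where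
  poisson : ∀ i j, IsPoissonProcess (S i j) (mu i j).toNNReal P
  indep : iIndepFun (fun (p : I × J) (ω : Ω) (t : ℝ≥0) => S p.1 p.2 t ω) P
  indep_arrivals : IndepFun (fun (ω : Ω) (p : I × ℝ≥0) => A p.1 p.2 ω)
    (fun (ω : Ω) (p : (I × J) × ℝ≥0) => S p.1.1 p.1.2 p.2 ω) P

/-- The cumulative time `∫₀ᵗ ψ(s) ds`, for a path `ψ` of a process with values in `ℕ`. -/
noncomputable def busyTime (ψ : ℝ≥0 → ℕ) (t : ℝ≥0) : ℝ≥0 :=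
  Real.toNNReal (∫ s in (0 : ℝ)..t, (ψ s.toNNReal : ℝ))

/-- The sigma-algebra generated by `X i s` and `A i s`, for `s ≤ t` and all `i`. -/
@[reducible] def history (X A : I → ℝ≥0 → Ω → ℕ) (t : ℝ≥0) : MeasurableSpace Ω :=
  ⨆ (s : ℝ≥0) (_ : s ≤ t) (i : I),
    MeasurableSpace.comap (X i s) inferInstance ⊔ MeasurableSpace.comap (A i s) inferInstance

/-- `Ψ` is a (preemptive) scheduling control policy for the system `sys` with primitive processes
`A` and `S`, and `X`, `Y`, `Z` are the processes it gives rise to: `Ψ i j` counts the class-`i`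
customers in service at station `j`, `X i` the class-`i` customers in the system, `Y i` those of
them that wait, and `Z j` the idle servers of station `j`. Nonnegativity and integrality are in
the types. The balance equation for `X` holds almost surely, because the primitive processes have
their path properties only almost surely. -/
structure IsSCP [Fintype I] [Fintype J] (sys : System I J) (P : Measure Ω)
    (A : I → ℝ≥0 → Ω → ℕ) (S : I → J → ℝ≥0 → Ω → ℕ)
    (Ψ : I → J → ℝ≥0 → Ω → ℕ) (X Y : I → ℝ≥0 → Ω → ℕ) (Z : J → ℝ≥0 → Ω → ℕ) : Prop where
  right_continuous : ∀ i j ω t, ContinuousWithinAt (fun s => Ψ i j s ω) (Set.Ici t) t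
  measurable_X : ∀ i t, Measurable (X i t)
  measurable_Y : ∀ i t, Measurable (Y i t)
  measurable_Z : ∀ j t, Measurable (Z j t)
  activity : ∀ i j, sys.mu i j = 0 → ∀ t ω, Ψ i j t ω = 0
  balance : ∀ᵐ ω ∂P, ∀ i t, (X i t ω : ℤ) =
    sys.init i + A i t ω - ∑ j, (S i j (busyTime (fun s => Ψ i j s ω) t) ω : ℤ)
  customers : ∀ i t ω, Y i t ω + ∑ j, Ψ i j t ω = X i t ω
  stations : ∀ j t ω, Z j t ω + ∑ i, Ψ i j t ω = sys.servers j
  adapted : ∀ i j t, Measurable[history X A t] (Ψ i j t)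

/-- The Lebesgue measure of the set of times in `[0, T]` at which some customer waits. -/
noncomputable def queueTime [Fintype I] (Y : I → ℝ≥0 → Ω → ℕ) (T : ℝ≥0) (ω : Ω) : ℝ≥0∞ :=
  volume {s : ℝ | s ∈ Set.Icc (0 : ℝ) T ∧ 0 < ∑ i, Y i s.toNNReal ω}

/-- `sup_{t ≤ T} ∑ i, |X i t - x i|`. -/
noncomputable def supDeviation [Fintype I] (X : I → ℝ≥0 → Ω → ℕ) (x : I → ℕ) (T : ℝ≥0)
    (ω : Ω) : ℝ≥0∞ :=
  ⨆ (t : ℝ≥0) (_ : t ≤ T), ENNReal.ofReal (∑ i, |(X i t ω : ℝ) - (x i : ℝ)|)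

/-- Convergence to zero in probability of a sequence with values in `[0, ∞]`. -/
def TendstoZeroInProb (P : Measure Ω) (f : ℕ+ → Ω → ℝ≥0∞) : Prop :=
  ∀ ε : ℝ, 0 < ε → Tendsto (fun n => P {ω | ENNReal.ofReal ε ≤ f n ω}) atTop (𝓝 0)

end Processes

end ManyServer

/-!
The policies are feedbacks: the assignment of customers to servers is a function of the numbers of
customers. As long as there are no more customers than servers, all of them are served, and the
connectedness of the graph of basic activities allows this to be done with an assignment as close to
the critical one as the state is to the critical masses; the drift is then of the order of the
deviation of the state. When customers outnumber servers, an assignment built from a matrix that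
witnesses suboptimality is used, and the total number of customers has drift at most `-δ n`.

Let the primitive processes deviate from their means by at most `a`, with `√n ≪ a ≪ n`. At times of
overload the total number of customers is at least its critical value up to an error of order `a`,
so each unit of time in overload must be paid for by an increase of order `n` elsewhere. Combined
with Grönwall's inequality, this bounds the time in overload by a multiple of `a / n` and the
deviation of the state by a multiple of `a`. For `a = n ^ α` with `1 / 2 < α < 1`, Kolmogorov's
inequality shows that the assumption on the primitive processes holds with high probability.
-/

namespace ManyServer

section Margins

variable {R M V : Type*}

lemma exists_add_smul_mem_of_reachable [Ring R] [AddCommGroup M] [Module R M]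
    {G : SimpleGraph V} {N : Submodule R M} {e : V → M}
    (hG : ∀ u v, G.Adj u v → ∃ c : R, e v + c • e u ∈ N) {r v : V} (h : G.Reachable r v) :
    ∃ α : R, e v + α • e r ∈ N := by
  rw [SimpleGraph.reachable_iff_reflTransGen] at h
  induction h with
  | refl => exact ⟨-1, by simp⟩
  | tail _ hadj ih =>
    obtain ⟨α, hα⟩ := ih
    obtain ⟨c, hc⟩ := hG _ _ hadj
    refine ⟨-(c * α), ?_⟩
    convert N.sub_mem hc (N.smul_mem c hα) using 1
    simp only [smul_add, smul_smul, neg_smul]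
    abel

variable {I J : Type*} [CommRing R]

/-- The matrices that vanish outside the set `E` of activities. -/
def supportedOn (R : Type*) [CommRing R] (E : I → J → Prop) : Submodule R (I → J → R) where
  carrier := {x | ∀ i j, ¬ E i j → x i j = 0}
  zero_mem' _ _ _ := rfl
  add_mem' hx hy i j h := by simp [hx i j h, hy i j h]
  smul_mem' c x hx i j h := by simp [hx i j h]

lemma single_mem_supportedOn [DecidableEq I] [DecidableEq J] {E : I → J → Prop} {i : I} {j : J}
    (h : E i j) (a : R) : Pi.single i (Pi.single j a) ∈ supportedOn R E := by
  intro k l hkl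
  rcases eq_or_ne k i with rfl | hk
  · rw [Pi.single_eq_same, Pi.single_eq_of_ne (by rintro rfl; exact hkl h)]
  · rw [Pi.single_eq_of_ne hk, Pi.zero_apply]

/-- The graph `G` on classes and stations only joins `i` and `j` if `E i j` holds. -/
def JoinsOnly (G : SimpleGraph (I ⊕ J)) (E : I → J → Prop) : Prop :=
  ∀ u v, G.Adj u v → ∃ i j, E i j ∧
    ((u = Sum.inl i ∧ v = Sum.inr j) ∨ (u = Sum.inr j ∧ v = Sum.inl i))

variable [Fintype I] [Fintype J]

/-- The margins of a matrix `x`: its row sums, weighted by `w`, and its unweighted column sums.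
If `x` is an allocation then the former are throughputs of classes, the latter loads of
stations. -/
def margins (w : I → J → R) : (I → J → R) →ₗ[R] (I ⊕ J → R) where
  toFun x := Sum.elim (fun i => ∑ j, w i j * x i j) (fun j => ∑ i, x i j)
  map_add' x y := by ext (i | j) <;> simp [mul_add, Finset.sum_add_distrib]
  map_smul' c x := by ext (i | j) <;> simp [Finset.mul_sum, mul_left_comm]

@[simp] lemma margins_inl (w x : I → J → R) (i : I) :
    margins w x (Sum.inl i) = ∑ j, w i j * x i j := rfl

@[simp] lemma margins_inr (w x : I → J → R) (j : J) : margins w x (Sum.inr j) = ∑ i, x i j := rfl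

variable [DecidableEq I] [DecidableEq J]

lemma margins_single (w : I → J → R) (i : I) (j : J) (a : R) :
    margins w (Pi.single i (Pi.single j a)) =
      (w i j * a) • Pi.single (Sum.inl i) 1 + a • Pi.single (Sum.inr j) 1 := by
  ext (k | l)
  · rcases eq_or_ne k i with rfl | h
    · simp [Pi.single_apply]
    · simp [h]
  · simp [Pi.single_apply, ite_apply, Finset.sum_ite_eq']

lemma exists_linearMap_margins {E : I → J → Prop} {w : I → J → R}
    (hw : ∀ i j, E i j → IsUnit (w i j)) {G : SimpleGraph (I ⊕ J)} (hG : JoinsOnly G E)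
    (hconn : G.Connected) (r : I ⊕ J) :
    ∃ L : (I ⊕ J → R) →ₗ[R] (I → J → R), (∀ t, L t ∈ supportedOn R E) ∧
      ∀ t, ∃ β : R, margins w (L t) = t + β • Pi.single r 1 := by
  have hadj : ∀ u v, G.Adj u v → ∃ c : R, (Pi.single v 1 + c • Pi.single u 1 : I ⊕ J → R) ∈
      (supportedOn R E).map (margins w) := by
    intro u v huv
    obtain ⟨i, j, hE, ⟨rfl, rfl⟩ | ⟨rfl, rfl⟩⟩ := hG u v huv
    · exact ⟨w i j, _, single_mem_supportedOn hE 1, by rw [margins_single]; simp [add_comm]⟩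
    · obtain ⟨z, hz⟩ := (hw i j hE).exists_right_inv
      exact ⟨z, _, single_mem_supportedOn hE z, by rw [margins_single, hz, one_smul]⟩
  choose α x hx hα using fun v => exists_add_smul_mem_of_reachable hadj (hconn r v)
  refine ⟨Fintype.linearCombination R x, fun t => ?_, fun t => ⟨∑ v, t v * α v, ?_⟩⟩
  · exact Submodule.sum_mem _ fun v _ => Submodule.smul_mem _ _ (hx v)
  · simp only [Fintype.linearCombination_apply, map_sum, map_smul, hα, smul_add,
      Finset.sum_add_distrib, smul_smul, Finset.sum_smul]
    congr 1
    exact (pi_eq_sum_univ' t).symm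

end Margins

/-- The error at the root vanishes since the row sums and the column sums have equal totals. -/
lemma exists_linearMap_margins_eq {R I J : Type*} [CommRing R] [Fintype I] [Fintype J]
    {E : I → J → Prop} {G : SimpleGraph (I ⊕ J)} (hG : JoinsOnly G E) (hconn : G.Connected) :
    ∃ L : (I ⊕ J → R) →ₗ[R] (I → J → R), (∀ t, L t ∈ supportedOn R E) ∧
      ∀ t, ∑ i, t (Sum.inl i) = ∑ j, t (Sum.inr j) → margins 1 (L t) = t := by
  classical
  obtain ⟨r⟩ := hconn.nonempty
  obtain ⟨L, hLE, hL⟩ := exists_linearMap_margins (w := (1 : I → J → R)) (by simp) hG hconn r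
  refine ⟨L, hLE, fun t ht => ?_⟩
  obtain ⟨β, hβ⟩ := hL t
  have htotal : ∑ i, margins 1 (L t) (Sum.inl i) = ∑ j, margins 1 (L t) (Sum.inr j) := by
    simpa using Finset.sum_comm
  have hβ0 : β = 0 := by
    rw [hβ] at htotal
    rcases r with i₀ | j₀ <;>
      simpa [ht, Finset.sum_add_distrib, Pi.single_apply] using htotal
  simpa [hβ0] using hβ

section Integer

lemma exists_abs_le_mul_sum_abs {ι I J : Type*} [Fintype ι] [Finite I] [Finite J]
    (L : (ι → ℤ) →ₗ[ℤ] (I → J → ℤ)) :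
    ∃ K : ℕ, ∀ t i j, |(L t i j : ℝ)| ≤ K * ∑ v, |(t v : ℝ)| := by
  classical
  obtain ⟨K, hK⟩ := Finite.exists_le fun p : ι × I × J => (L (Pi.single p.1 1) p.2.1 p.2.2).natAbs
  have hKr : ∀ v i j, |(L (Pi.single v 1) i j : ℝ)| ≤ K := fun v i j => by
    rw [← Int.cast_abs, ← Nat.cast_natAbs]
    exact_mod_cast hK (v, i, j)
  refine ⟨K, fun t i j => ?_⟩
  have hLt : (L t i j : ℝ) = ∑ v, (t v : ℝ) * L (Pi.single v 1) i j := by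
    conv_lhs => rw [pi_eq_sum_univ' t, map_sum]
    simp only [map_smul, Finset.sum_apply, Pi.smul_apply, smul_eq_mul]
    push_cast
    rfl
  rw [hLt, Finset.mul_sum]
  refine (Finset.abs_sum_le_sum_abs _ _).trans (Finset.sum_le_sum fun v _ => ?_)
  rw [abs_mul, mul_comm]
  exact mul_le_mul_of_nonneg_right (hKr v i j) (abs_nonneg _)

lemma sum_abs_cast_sub_sum_floor_le {ι κ : Type*} [Fintype ι] [Fintype κ] (a : ι → ℤ)
    (w : ι → κ → ℝ) :
    ∑ i, |((a i - ∑ k, ⌊w i k⌋ : ℤ) : ℝ)| ≤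
      ∑ i, |a i - ∑ k, w i k| + Fintype.card ι * Fintype.card κ := by
  have hrow : ∀ i, |((a i - ∑ k, ⌊w i k⌋ : ℤ) : ℝ)| ≤ |a i - ∑ k, w i k| + Fintype.card κ := by
    intro i
    have hfract : ((a i - ∑ k, ⌊w i k⌋ : ℤ) : ℝ) = (a i - ∑ k, w i k) + ∑ k, Int.fract (w i k) := by
      simp only [← Int.self_sub_floor, Finset.sum_sub_distrib]
      push_cast
      ring
    have hcard : |∑ k, Int.fract (w i k)| ≤ Fintype.card κ := by
      rw [abs_of_nonneg (Finset.sum_nonneg fun k _ => Int.fract_nonneg _)]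
      simpa using Finset.sum_le_sum fun k (_ : k ∈ Finset.univ) => (Int.fract_lt_one (w i k)).le
    rw [hfract]
    exact (abs_add_le _ _).trans (by gcongr)
  refine (Finset.sum_le_sum fun i _ => hrow i).trans (le_of_eq ?_)
  simp [Finset.sum_add_distrib]

/-- Round `w` down, and correct the margins of the result along the edges of the graph. -/
lemma exists_int_matrix_near {I J : Type*} [Fintype I] [Fintype J] {E : I → J → Prop}
    {G : SimpleGraph (I ⊕ J)} (hG : JoinsOnly G E) (hconn : G.Connected) :
    ∃ q : ℝ, 0 ≤ q ∧ ∀ w ∈ supportedOn ℝ E, ∀ (a : I → ℤ) (b : J → ℤ), ∑ i, a i = ∑ j, b j →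
      ∃ ψ ∈ supportedOn ℤ E, (∀ i, ∑ j, ψ i j = a i) ∧ (∀ j, ∑ i, ψ i j = b j) ∧
        ∀ i j, |(ψ i j : ℝ) - w i j| ≤
          q * (1 + ∑ i, |a i - ∑ j, w i j| + ∑ j, |b j - ∑ i, w i j|) := by
  classical
  obtain ⟨L, hLE, hL⟩ := exists_linearMap_margins_eq (R := ℤ) hG hconn
  obtain ⟨K, hK⟩ := exists_abs_le_mul_sum_abs L
  set m : ℝ := 2 * Fintype.card I * Fintype.card J
  refine ⟨1 + K * (1 + m), by positivity, fun w hw a b hab => ?_⟩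
  let t : I ⊕ J → ℤ := Sum.elim (fun i => a i - ∑ j, ⌊w i j⌋) fun j => b j - ∑ i, ⌊w i j⌋
  have hmargins : margins 1 (L t) = t := hL t <| by
    have hcomm : ∑ i, ∑ j, ⌊w i j⌋ = ∑ j, ∑ i, ⌊w i j⌋ := Finset.sum_comm
    simp [t, Finset.sum_sub_distrib, hab, hcomm]
  have ht : ∑ v, |(t v : ℝ)| ≤
      ∑ i, |a i - ∑ j, w i j| + ∑ j, |b j - ∑ i, w i j| + m := by
    rw [Fintype.sum_sum_type]
    refine (add_le_add (sum_abs_cast_sub_sum_floor_le a w)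
      (sum_abs_cast_sub_sum_floor_le b fun j i => w i j)).trans (le_of_eq ?_)
    ring
  refine ⟨fun i j => ⌊w i j⌋ + L t i j, fun i j hE => ?_, fun i => ?_, fun j => ?_, fun i j => ?_⟩
  · simp [hw i j hE, hLE t i j hE]
  · have hi : ∑ j, L t i j = t (Sum.inl i) := by
      simpa using congrFun hmargins (Sum.inl i)
    rw [Finset.sum_add_distrib, hi]
    simp [t]
  · have hi : ∑ i, L t i j = t (Sum.inr j) := by
      simpa using congrFun hmargins (Sum.inr j)
    rw [Finset.sum_add_distrib, hi]
    simp [t]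
  · have hsplit : ((⌊w i j⌋ + L t i j : ℤ) : ℝ) - w i j = L t i j - Int.fract (w i j) := by
      rw [Int.fract]; push_cast; ring
    have hLt := (hK t i j).trans (mul_le_mul_of_nonneg_left ht K.cast_nonneg)
    have hfract : |Int.fract (w i j)| ≤ 1 := by
      rw [abs_of_nonneg (Int.fract_nonneg _)]; exact (Int.fract_lt_one _).le
    rw [hsplit]
    refine (abs_sub _ _).trans ?_
    set D := ∑ i, |a i - ∑ j, w i j| + ∑ j, |b j - ∑ i, w i j| with hD
    have hD0 : 0 ≤ D := by positivity
    have : K * (D + m) ≤ K * ((1 + m) * (1 + D)) := by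
      gcongr; nlinarith [show 0 ≤ m by positivity]
    rw [add_assoc, ← hD]
    linarith [add_le_add hLt hfract]

end Integer

lemma exists_pos_forall_mul_le {ι : Type*} [Finite ι] (a : ι → ℝ) {b : ι → ℝ}
    (hb : ∀ k, 0 < b k) : ∃ ε, 0 < ε ∧ ∀ k, ε * a k ≤ b k := by
  have hsmall : ∀ᶠ ε in 𝓝[>] (0 : ℝ), ∀ k, ε * a k ≤ b k := by
    refine eventually_all.2 fun k => ?_
    have hlim : Tendsto (fun ε => ε * a k) (𝓝[>] 0) (𝓝 (0 * a k)) :=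
      ((continuous_mul_const (a k)).tendsto 0).mono_left nhdsWithin_le_nhds
    rw [zero_mul] at hlim
    exact hlim.eventually_le_const (hb k)
  exact ((eventually_mem_nhdsWithin (s := Set.Ioi 0)).and hsmall).exists

namespace Fluid

variable {I J : Type*} {F : Fluid I J} {ξ : I → J → ℝ}

/-- The basic activities of an allocation: the pairs joined in `basicGraph`. -/
def IsBasic (F : Fluid I J) (ξ : I → J → ℝ) (i : I) (j : J) : Prop := 0 < F.mu i j ∧ 0 < ξ i j

lemma joinsOnly_basicGraph (F : Fluid I J) (ξ : I → J → ℝ) :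
    JoinsOnly (F.basicGraph ξ) (F.IsBasic ξ) := by
  intro u v h
  rw [basicGraph, SimpleGraph.fromRel_adj] at h
  obtain ⟨_, ⟨i, j, hu, hv, hij⟩ | ⟨i, j, hv, hu, hij⟩⟩ := h
  · exact ⟨i, j, hij, Or.inl ⟨hu, hv⟩⟩
  · exact ⟨i, j, hij, Or.inr ⟨hu, hv⟩⟩

variable [Fintype I] [Fintype J]

/-- A processing activity of zero rate allows one to add load evenly to all stations at constant
throughput. -/
lemma exists_matrix_of_mu_eq_zero (hconn : (F.basicGraph ξ).Connected) {i : I} {j : J}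
    (hξ : 0 < ξ i j) (hmu : F.mu i j = 0) :
    ∃ M ∈ supportedOn ℝ fun i j => 0 < ξ i j,
      (∀ i, ∑ j, F.mu i j * F.nu j * M i j = 0) ∧ ∀ j, ∑ i, M i j = 1 := by
  classical
  obtain ⟨L, hLE, hL⟩ := exists_linearMap_margins (E := F.IsBasic ξ)
    (fun i j h => (mul_pos h.1 (F.nu_pos j)).ne'.isUnit) (F.joinsOnly_basicGraph ξ) hconn
    (Sum.inr j)
  obtain ⟨β, hβ⟩ := hL (Sum.elim 0 1)
  set M : I → J → ℝ := L (Sum.elim 0 1) - Pi.single i (Pi.single j β) with hM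
  have hmargins : margins (fun i j => F.mu i j * F.nu j) M = Sum.elim (0 : I → ℝ) (1 : J → ℝ) := by
    rw [hM, map_sub, hβ, margins_single, hmu]
    simp
  refine ⟨M, Submodule.sub_mem _ (fun k l h => hLE _ k l fun h' => h h'.2) ?_,
    fun k => congrFun hmargins (Sum.inl k), fun l => congrFun hmargins (Sum.inr l)⟩
  exact single_mem_supportedOn (E := fun i j => 0 < ξ i j) hξ β

namespace IsCritical

lemma nonneg (h : F.IsCritical ξ) (i : I) (j : J) : 0 ≤ ξ i j := by
  obtain ⟨⟨ρ, hf, -⟩, -⟩ := h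
  exact hf.nonneg i j

lemma balance (h : F.IsCritical ξ) (i : I) : ∑ j, F.mu i j * (ξ i j * F.nu j) = F.lam i := by
  obtain ⟨⟨ρ, hf, -⟩, -⟩ := h
  rw [← hf.balance i]
  exact Finset.sum_congr rfl fun j _ => by ring

lemma nonempty_stations (h : F.IsCritical ξ) (hconn : (F.basicGraph ξ).Connected) :
    Nonempty J := by
  by_contra hJ
  rw [not_nonempty_iff] at hJ
  obtain ⟨i | j⟩ := hconn.nonempty
  · simpa [(F.lam_pos i).ne] using h.balance i
  · exact hJ.false j

lemma nonempty_classes (h : F.IsCritical ξ) (hconn : (F.basicGraph ξ).Connected) :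
    Nonempty I := by
  obtain ⟨j⟩ := h.nonempty_stations hconn
  by_contra hI
  rw [not_nonempty_iff] at hI
  simpa using h.2 j

lemma sum_mass (h : F.IsCritical ξ) : ∑ i, F.mass ξ i = ∑ j, F.nu j := by
  unfold mass
  rw [Finset.sum_comm]
  simp_rw [← Finset.sum_mul, h.2, one_mul]

lemma mass_pos (h : F.IsCritical ξ) (i : I) : 0 < F.mass ξ i := by
  have h0 : ∀ j ∈ Finset.univ, 0 ≤ ξ i j * F.nu j := fun j _ =>
    mul_nonneg (h.nonneg i j) (F.nu_pos j).le
  refine (Finset.sum_nonneg h0).lt_of_ne' fun hmass => (F.lam_pos i).ne' ?_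
  rw [Finset.sum_eq_zero_iff_of_nonneg h0] at hmass
  rw [← h.balance i]
  exact Finset.sum_eq_zero fun j hj => by rw [hmass j hj, mul_zero]

lemma mu_pos (h : F.IsCritical ξ) (hconn : (F.basicGraph ξ).Connected) {i : I} {j : J}
    (hξ : 0 < ξ i j) : 0 < F.mu i j := by
  refine (F.mu_nonneg i j).lt_of_ne' fun hmu => ?_
  obtain ⟨M, hM, hrow, hcol⟩ := exists_matrix_of_mu_eq_zero hconn hξ hmu
  obtain ⟨ε, hε, hMξ⟩ := exists_pos_forall_mul_le
    (fun p : {p : I × J // 0 < ξ p.1 p.2} => M p.1.1 p.1.2) fun p => p.2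
  have hnonneg : ∀ k l, 0 ≤ ξ k l - ε * M k l := fun k l => by
    by_cases hkl : 0 < ξ k l
    · exact sub_nonneg.2 (hMξ ⟨(k, l), hkl⟩)
    · rw [hM k l hkl, mul_zero, sub_zero]
      exact h.nonneg k l
  have hload : ∀ l, ∑ k, (ξ k l - ε * M k l) = 1 - ε := fun l => by
    rw [Finset.sum_sub_distrib, ← Finset.mul_sum, hcol, h.2, mul_one]
  have hbalance : ∀ k, ∑ l, F.mu k l * F.nu l * (ξ k l - ε * M k l) = F.lam k := fun k => by
    have hsplit : ∀ l, F.mu k l * F.nu l * (ξ k l - ε * M k l) =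
        F.mu k l * (ξ k l * F.nu l) - ε * (F.mu k l * F.nu l * M k l) := fun l => by ring
    simp_rw [hsplit, Finset.sum_sub_distrib, ← Finset.mul_sum, hrow, h.balance, mul_zero, sub_zero]
  have hfeasible : F.IsFeasible (fun k l => ξ k l - ε * M k l) (1 - ε) :=
    { rho_nonneg := hload j ▸ Finset.sum_nonneg fun k _ => hnonneg k j
      balance := hbalance
      load := fun l => (hload l).le
      nonneg := hnonneg }
  obtain ⟨⟨ρ, hf, hopt⟩, hcrit⟩ := h
  linarith [hopt _ _ hfeasible, hf.load j, hcrit j]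

lemma mem_supportedOn (h : F.IsCritical ξ) (hconn : (F.basicGraph ξ).Connected) :
    ξ ∈ supportedOn ℝ (F.IsBasic ξ) := fun i j hij => by
  by_contra hne
  have hξ := (h.nonneg i j).lt_of_ne' hne
  exact hij ⟨h.mu_pos hconn hξ, hξ⟩

end IsCritical

end Fluid

variable {I J : Type*}

/-- In state `x`, the assignment `ψ` of customers to servers is possible and leaves every activity
of rate zero unused. -/
structure System.IsAdmissible [Fintype I] [Fintype J] (s : System I J) (x : I → ℕ)
    (ψ : I → J → ℕ) : Prop where
  activity : ∀ i j, s.mu i j = 0 → ψ i j = 0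
  customers : ∀ i, ∑ j, ψ i j ≤ x i
  stations : ∀ j, ∑ i, ψ i j ≤ s.servers j

variable [Fintype J]

/-- The drift of the numbers of customers, class by class, while the assignment `ψ` is in use. -/
def System.netInflow (s : System I J) (ψ : I → J → ℕ) (i : I) : ℝ :=
  s.lam i - ∑ j, s.mu i j * ψ i j

/-- The drift of the fluid contents while the amounts of fluid `w` are in service. -/
def Fluid.netInflow (F : Fluid I J) (w : I → J → ℝ) (i : I) : ℝ := F.lam i - ∑ j, F.mu i j * w i j

/-- The deviation of the state `x` from the fluid contents under `ξ`. The scale is written `y ^ 2`,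
so that fluctuations are of order `y`. -/
def Fluid.deviation (F : Fluid I J) (ξ : I → J → ℝ) (y : ℝ) (x : I → ℕ) (i : I) : ℝ :=
  x i - y ^ 2 * F.mass ξ i

/-- The parameters of `s` are close to `y ^ 2` times those of the fluid model, up to errors of
relative order `1 / y`. -/
structure IsClose (F : Fluid I J) (ξ : I → J → ℝ) (c y : ℝ) (s : System I J) : Prop where
  lam : ∀ i, |s.lam i - y ^ 2 * F.lam i| ≤ c * y
  mu : ∀ i j, |s.mu i j - F.mu i j| * y ≤ c
  servers : ∀ j, |(s.servers j : ℝ) - y ^ 2 * F.nu j| ≤ c * y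
  init : ∀ i, |(s.init i : ℝ) - y ^ 2 * F.mass ξ i| ≤ c * y

lemma SecondOrder.exists_isClose {F : Fluid I J} {ξ : I → J → ℝ} {sys : ℕ+ → System I J}
    (h : SecondOrder F ξ sys) [Nonempty I] [Nonempty J] :
    ∃ c, 0 ≤ c ∧ ∀ n : ℕ+, IsClose F ξ c (√(n : ℝ)) (sys n) := by
  obtain ⟨c, hc⟩ := h
  have hy : ∀ n : ℕ+, 0 < √(n : ℝ) := fun n => Real.sqrt_pos.2 (Nat.cast_pos.2 n.pos)
  have hrpow : ∀ n : ℕ+, c * (n : ℝ) ^ (-(1 / 2) : ℝ) * √(n : ℝ) = c := fun n => by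
    rw [Real.rpow_neg n.val.cast_nonneg, ← Real.sqrt_eq_rpow, inv_mul_cancel_right₀ (hy n).ne']
  have scale : ∀ (n : ℕ+) (a b : ℝ), |a / (n : ℝ) - b| ≤ c * (n : ℝ) ^ (-(1 / 2) : ℝ) →
      |a - √(n : ℝ) ^ 2 * b| ≤ c * √(n : ℝ) := fun n a b hab => by
    have hn : 0 < (n : ℝ) := Nat.cast_pos.2 n.pos
    have hsplit : a - √(n : ℝ) ^ 2 * b = (a / n - b) * √(n : ℝ) * √(n : ℝ) := by
      rw [mul_assoc, Real.mul_self_sqrt hn.le, Real.sq_sqrt hn.le]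
      field_simp
    rw [hsplit, abs_mul, abs_mul, abs_of_pos (hy n)]
    calc _ ≤ c * (n : ℝ) ^ (-(1 / 2) : ℝ) * √(n : ℝ) * √(n : ℝ) := by gcongr
      _ = c * √(n : ℝ) := by rw [hrpow]
  have hmu : ∀ (n : ℕ+) i j, |(sys n).mu i j - F.mu i j| * √(n : ℝ) ≤ c := fun n i j =>
    (mul_le_mul_of_nonneg_right (hc i j n).2.1 (hy n).le).trans_eq (hrpow n)
  have i₀ := Classical.arbitrary I
  have j₀ := Classical.arbitrary J
  exact ⟨c, le_trans (by positivity) (hmu 1 i₀ j₀), fun n =>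
    ⟨fun i => scale n _ _ (hc i j₀ n).1, hmu n, fun j => scale n _ _ (hc i₀ j n).2.2.1,
      fun i => scale n _ _ (hc i j₀ n).2.2.2⟩⟩

namespace IsClose

variable {F : Fluid I J} {ξ : I → J → ℝ} {c y : ℝ} {s : System I J}

lemma mu_le (h : IsClose F ξ c y s) (hy : 1 ≤ y) (i : I) (j : J) : s.mu i j ≤ F.mu i j + c := by
  have hsub := (le_mul_of_one_le_right (abs_nonneg (s.mu i j - F.mu i j)) hy).trans (h.mu i j)
  linarith [le_abs_self (s.mu i j - F.mu i j)]

lemma abs_netInflow_sub_le (h : IsClose F ξ c y s) (hy : 1 ≤ y) (w : I → J → ℝ)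
    (ψ : I → J → ℕ) (i : I) :
    |s.netInflow ψ i - y ^ 2 * F.netInflow w i| ≤
      c * y + ∑ j, ((F.mu i j + c) * |ψ i j - y ^ 2 * w i j| + c * y * |w i j|) := by
  have hsplit : s.netInflow ψ i - y ^ 2 * F.netInflow w i = (s.lam i - y ^ 2 * F.lam i) -
      ∑ j, (s.mu i j * (ψ i j - y ^ 2 * w i j) + (s.mu i j - F.mu i j) * y * (y * w i j)) := by
    have hterm : ∀ j, s.mu i j * (ψ i j - y ^ 2 * w i j) + (s.mu i j - F.mu i j) * y * (y * w i j) =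
        s.mu i j * ψ i j - y ^ 2 * (F.mu i j * w i j) := fun j => by ring
    simp_rw [hterm, Finset.sum_sub_distrib, ← Finset.mul_sum, System.netInflow, Fluid.netInflow]
    ring
  rw [hsplit]
  refine (abs_sub _ _).trans (add_le_add (h.lam i) ?_)
  refine (Finset.abs_sum_le_sum_abs _ _).trans (Finset.sum_le_sum fun j _ => ?_)
  refine (abs_add_le _ _).trans (add_le_add ?_ ?_)
  · have hmu := h.mu_le hy i j
    rw [abs_mul, abs_of_nonneg (s.mu_nonneg i j)]
    gcongr
  · have hy0 : 0 ≤ y := by linarith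
    rw [abs_mul, abs_mul, abs_mul, abs_of_nonneg hy0, mul_assoc c]
    gcongr
    exact h.mu i j

variable (F ξ) in
lemma exists_norm_netInflow_sub_le [Fintype I] (hc : 0 ≤ c) (w : I → J → ℝ) :
    ∃ C, 0 ≤ C ∧ ∀ y s, 1 ≤ y → IsClose F ξ c y s → ∀ (ψ : I → J → ℕ) (d : ℝ), 0 ≤ d →
      (∀ i j, |ψ i j - y ^ 2 * w i j| ≤ d) →
      ‖s.netInflow ψ - y ^ 2 • F.netInflow w‖ ≤ C * (d + y) := by
  set b : I → ℝ := fun i => c + ∑ j, (F.mu i j + c + c * |w i j|) with hb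
  have hb0 : ∀ i, 0 ≤ b i := fun i => add_nonneg hc <| Finset.sum_nonneg fun j _ => by
    have := F.mu_nonneg i j
    positivity
  refine ⟨∑ i, b i, Finset.sum_nonneg fun i _ => hb0 i, fun y s hy h ψ d hd hψ => ?_⟩
  have hdy : 0 ≤ d + y := by linarith
  refine (pi_norm_le_iff_of_nonneg (mul_nonneg (Finset.sum_nonneg fun i _ => hb0 i) hdy)).2
    fun i => ?_
  calc |s.netInflow ψ i - y ^ 2 * F.netInflow w i|
      ≤ c * y + ∑ j, ((F.mu i j + c) * |ψ i j - y ^ 2 * w i j| + c * y * |w i j|) :=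
        h.abs_netInflow_sub_le hy w ψ i
    _ ≤ c * (d + y) + ∑ j, (F.mu i j + c + c * |w i j|) * (d + y) := by
        gcongr with j
        · linarith
        · have hmu := F.mu_nonneg i j
          calc _ ≤ (F.mu i j + c) * (d + y) + c * (d + y) * |w i j| := by
                gcongr <;> linarith [hψ i j]
            _ = _ := by ring
    _ = b i * (d + y) := by rw [hb, add_mul, Finset.sum_mul]
    _ ≤ (∑ i, b i) * (d + y) := by
        gcongr
        exact Finset.single_le_sum (fun i _ => hb0 i) (Finset.mem_univ i)

variable (F ξ c) in
lemma eventually_mu_pos [Finite I] :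
    ∀ᶠ y in atTop, ∀ s, IsClose F ξ c y s → ∀ i j, 0 < F.mu i j → 0 < s.mu i j := by
  have hlarge : ∀ᶠ y in atTop, ∀ i j, c / F.mu i j < y :=
    eventually_all.2 fun i => eventually_all.2 fun j => eventually_gt_atTop _
  filter_upwards [hlarge] with y hy s h i j hmu
  refine (s.mu_nonneg i j).lt_of_ne' fun hs => ?_
  have hle := h.mu i j
  rw [hs, zero_sub, abs_neg, abs_of_pos hmu] at hle
  linarith [(div_lt_iff₀' hmu).1 (hy i j)]

end IsClose

variable {I J : Type*} [Fintype I] [Fintype J]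

lemma eventually_mul_le_mul_sq (c : ℝ) {b : ℝ} (hb : 0 < b) :
    ∀ᶠ y : ℝ in atTop, c * y ≤ b * y ^ 2 := by
  filter_upwards [eventually_ge_atTop 0, eventually_ge_atTop (c / b)] with y hy0 hy
  rw [div_le_iff₀' hb] at hy
  calc c * y ≤ b * y * y := by gcongr
    _ = b * y ^ 2 := by ring

lemma sum_abs_le_card_mul_norm {ι : Type*} [Fintype ι] (x : ι → ℝ) :
    ∑ i, |x i| ≤ Fintype.card ι * ‖x‖ := by
  simpa using Finset.sum_le_sum fun i (_ : i ∈ Finset.univ) => norm_le_pi_norm x i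

/-- A throughput exceeding the arrivals survives the removal of a small fraction `1 - κ` of the
work, which leaves room for perturbations of the state. -/
lemma Fluid.ThroughputSuboptimal.exists_slack_service {F : Fluid I J} {ξ : I → J → ℝ}
    (hsub : F.ThroughputSuboptimal ξ) :
    ∃ (κ : ℝ) (w : I → J → ℝ), κ < 1 ∧ (∀ i j, 0 ≤ w i j) ∧ (∀ i j, F.mu i j = 0 → w i j = 0) ∧
      (∀ i, ∑ j, w i j ≤ κ * F.mass ξ i) ∧ (∀ j, ∑ i, w i j ≤ κ * F.nu j) ∧
      ∑ i, F.netInflow w i < 0 := by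
  classical
  rw [ThroughputSuboptimal, ThroughputOptimal] at hsub
  push Not at hsub
  obtain ⟨ξ', ⟨hξ0, hξ1⟩, hmass, hgain⟩ := hsub
  set V := ∑ i, ∑ j, F.mu i j * F.nu j * ξ' i j
  have hΛ : 0 ≤ ∑ i, F.lam i := Finset.sum_nonneg fun i _ => (F.lam_pos i).le
  have hV : 0 < V := hΛ.trans_lt hgain
  obtain ⟨κ, hκV, hκ1⟩ := exists_between ((div_lt_one hV).2 hgain)
  have hκ0 : 0 ≤ κ := (div_nonneg hΛ hV.le).trans hκV.le
  have hw0 : ∀ i j, 0 ≤ κ * (ξ' i j * F.nu j) := fun i j =>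
    mul_nonneg hκ0 (mul_nonneg (hξ0 i j) (F.nu_pos j).le)
  have hle : ∀ i j, (if F.mu i j = 0 then 0 else κ * (ξ' i j * F.nu j)) ≤
      κ * (ξ' i j * F.nu j) := fun i j => by
    split_ifs
    exacts [hw0 i j, le_rfl]
  refine ⟨κ, fun i j => if F.mu i j = 0 then 0 else κ * (ξ' i j * F.nu j), hκ1, fun i j => ?_,
    fun i j h => if_pos h, fun i => ?_, fun j => ?_, ?_⟩
  · beta_reduce
    split_ifs
    exacts [le_rfl, hw0 i j]
  · refine (Finset.sum_le_sum fun j _ => hle i j).trans ?_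
    rw [← Finset.mul_sum]
    exact mul_le_mul_of_nonneg_left (hmass i) hκ0
  · refine (Finset.sum_le_sum fun i _ => hle i j).trans ?_
    rw [← Finset.mul_sum, ← Finset.sum_mul]
    exact mul_le_mul_of_nonneg_left (mul_le_of_le_one_left (F.nu_pos j).le (hξ1 j)) hκ0
  · have hthroughput : ∀ i j, F.mu i j * (if F.mu i j = 0 then 0 else κ * (ξ' i j * F.nu j)) =
        κ * (F.mu i j * F.nu j * ξ' i j) := fun i j => by
      split_ifs with h
      · simp [h]
      · ring
    simp only [Fluid.netInflow, hthroughput, Finset.sum_sub_distrib, ← Finset.mul_sum]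
    linarith [(div_lt_iff₀ hV).1 hκV]

lemma System.isAdmissible_floor (s : System I J) {x : I → ℕ} {w : I → J → ℝ}
    (hw : ∀ i j, 0 ≤ w i j) (hmu : ∀ i j, s.mu i j = 0 → w i j = 0)
    (hrow : ∀ i, ∑ j, w i j ≤ x i) (hcol : ∀ j, ∑ i, w i j ≤ s.servers j) :
    s.IsAdmissible x fun i j => ⌊w i j⌋₊ where
  activity i j h := by simp [hmu i j h]
  customers i := by
    have hreal : ∑ j, (⌊w i j⌋₊ : ℝ) ≤ x i :=
      (Finset.sum_le_sum fun j _ => Nat.floor_le (hw i j)).trans (hrow i)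
    exact_mod_cast hreal
  stations j := by
    have hreal : ∑ i, (⌊w i j⌋₊ : ℝ) ≤ s.servers j :=
      (Finset.sum_le_sum fun i _ => Nat.floor_le (hw i j)).trans (hcol j)
    exact_mod_cast hreal

namespace Fluid.IsCritical

variable {F : Fluid I J} {ξ : I → J → ℝ} {c : ℝ}

lemma sum_servers_sub_le (hcrit : F.IsCritical ξ) {y : ℝ} {s : System I J}
    (hs : IsClose F ξ c y s) (x : I → ℕ) :
    ∑ j, (s.servers j : ℝ) - ∑ i, (x i : ℝ) ≤
      Fintype.card J * (c * y) + Fintype.card I * ‖F.deviation ξ y x‖ := by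
  have hsplit : ∑ j, (s.servers j : ℝ) - ∑ i, (x i : ℝ) =
      ∑ j, ((s.servers j : ℝ) - y ^ 2 * F.nu j) + ∑ i, -F.deviation ξ y x i := by
    simp only [Fluid.deviation, Finset.sum_sub_distrib, Finset.sum_neg_distrib, ← Finset.mul_sum,
      hcrit.sum_mass]
    ring
  rw [hsplit]
  refine add_le_add ?_ ?_
  · simpa using Finset.sum_le_sum fun j (_ : j ∈ Finset.univ) =>
      (le_abs_self _).trans (hs.servers j)
  · exact (Finset.sum_le_sum fun i _ => neg_le_abs _).trans (sum_abs_le_card_mul_norm _)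

lemma sum_abs_servers_sub_le (hcrit : F.IsCritical ξ) {y : ℝ} {s : System I J}
    (hs : IsClose F ξ c y s) {idle : J → ℤ} (hidle : 0 ≤ idle) :
    ∑ j, |((s.servers j - idle j : ℤ) : ℝ) - ∑ i, y ^ 2 * (ξ i j * F.nu j)| ≤
      Fintype.card J * (c * y) + ∑ j, (idle j : ℝ) := by
  have hstation : ∀ j, |((s.servers j - idle j : ℤ) : ℝ) -
      ∑ i, y ^ 2 * (ξ i j * F.nu j)| ≤ c * y + idle j := fun j => by
    have hidlej : (0 : ℝ) ≤ idle j := Int.cast_nonneg (hidle j)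
    rw [← Finset.mul_sum, ← Finset.sum_mul, hcrit.2, one_mul, Int.cast_sub, sub_right_comm]
    exact (abs_sub _ _).trans (add_le_add (hs.servers j) (abs_of_nonneg hidlej).le)
  refine (Finset.sum_le_sum fun j _ => hstation j).trans (le_of_eq ?_)
  simp [Finset.sum_add_distrib]

/-- All idle servers are put at one station; the margins then agree, and are close to those of
the critical allocation. -/
lemma exists_int_service (hcrit : F.IsCritical ξ) (hconn : (F.basicGraph ξ).Connected)
    (hc : 0 ≤ c) :
    ∃ Q, 0 < Q ∧ ∀ y s, 1 ≤ y → IsClose F ξ c y s → ∀ x : I → ℕ, ∑ i, x i ≤ ∑ j, s.servers j →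
      ∃ ψ ∈ supportedOn ℤ (F.IsBasic ξ), (∀ i, ∑ j, ψ i j = x i) ∧
        (∀ j, ∑ i, ψ i j ≤ s.servers j) ∧
        ∀ i j, |(ψ i j : ℝ) - y ^ 2 * (ξ i j * F.nu j)| ≤ Q * (‖F.deviation ξ y x‖ + y) := by
  classical
  obtain ⟨j₀⟩ := hcrit.nonempty_stations hconn
  obtain ⟨q, hq, hnear⟩ := exists_int_matrix_near (F.joinsOnly_basicGraph ξ) hconn
  set nI := (Fintype.card I : ℝ)
  set nJ := (Fintype.card J : ℝ)
  refine ⟨q * (1 + 2 * nI + 2 * nJ * c) + 1, by positivity, fun y s hy hs x hx => ?_⟩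
  set h := ‖F.deviation ξ y x‖
  have hh : 0 ≤ h := norm_nonneg _
  set Z : ℤ := ∑ j, (s.servers j : ℤ) - ∑ i, (x i : ℤ) with hZ
  have hZ0 : 0 ≤ Z := sub_nonneg.2 (by exact_mod_cast hx)
  set idle : J → ℤ := Pi.single j₀ Z with hidle
  have hidle0 : 0 ≤ idle := Pi.single_nonneg.2 hZ0
  have hidleZ : ∑ j, idle j = Z := by simp [hidle]
  have hsupp : (fun i j => y ^ 2 * (ξ i j * F.nu j)) ∈ supportedOn ℝ (F.IsBasic ξ) :=
    fun i j hij => by simp [hcrit.mem_supportedOn hconn i j hij]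
  obtain ⟨ψ, hψ, hrow, hcol, hclose⟩ := hnear _ hsupp (fun i => x i)
    (fun j => s.servers j - idle j)
    (by rw [Finset.sum_sub_distrib, hidleZ, hZ, sub_sub_cancel])
  have hrows : ∑ i, |((x i : ℤ) : ℝ) - ∑ j, y ^ 2 * (ξ i j * F.nu j)| ≤ nI * h := by
    simp_rw [← Finset.mul_sum]
    exact sum_abs_le_card_mul_norm (F.deviation ξ y x)
  have hcols : ∑ j, |((s.servers j - idle j : ℤ) : ℝ) -
      ∑ i, y ^ 2 * (ξ i j * F.nu j)| ≤ nJ * (c * y) + Z := by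
    simpa [← hidleZ] using hcrit.sum_abs_servers_sub_le hs hidle0
  have hZle : (Z : ℝ) ≤ nJ * (c * y) + nI * h := by
    simpa [hZ] using hcrit.sum_servers_sub_le hs x
  refine ⟨ψ, hψ, hrow, fun j => ?_, fun i j => (hclose i j).trans ?_⟩
  · rw [hcol, sub_le_self_iff]
    exact hidle0 j
  · calc _ ≤ q * (1 + nI * h + (nJ * (c * y) + (nJ * (c * y) + nI * h))) := by
          gcongr; linarith
      _ ≤ q * ((1 + 2 * nI + 2 * nJ * c) * (h + y)) := by
          have hI : 0 ≤ nI * y := by positivity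
          have hJ : 0 ≤ nJ * c * h := by positivity
          gcongr; linarith
      _ ≤ (q * (1 + 2 * nI + 2 * nJ * c) + 1) * (h + y) := by
          rw [← mul_assoc]; gcongr; linarith

lemma exists_full_service (hcrit : F.IsCritical ξ) (hconn : (F.basicGraph ξ).Connected)
    (hc : 0 ≤ c) :
    ∃ C η, 0 ≤ C ∧ 0 < η ∧ ∀ᶠ y : ℝ in atTop, ∀ s, IsClose F ξ c y s → ∀ x : I → ℕ,
      ‖F.deviation ξ y x‖ ≤ η * y ^ 2 → ∑ i, x i ≤ ∑ j, s.servers j →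
      ∃ ψ : I → J → ℕ, s.IsAdmissible x ψ ∧ (∀ i, ∑ j, ψ i j = x i) ∧
        ‖s.netInflow ψ‖ ≤ C * (‖F.deviation ξ y x‖ + y) := by
  obtain ⟨Q, hQ, hservice⟩ := hcrit.exists_int_service hconn hc
  obtain ⟨κ, hκ, hξκ⟩ := exists_pos_forall_mul_le (fun _ => 1)
    fun p : {p : I × J // F.IsBasic ξ p.1 p.2} => mul_pos p.2.2 (F.nu_pos p.1.2)
  obtain ⟨C, hC, hnet⟩ := IsClose.exists_norm_netInflow_sub_le F ξ hc fun i j => ξ i j * F.nu j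
  refine ⟨C * (Q + 1), κ / (2 * Q), by positivity, by positivity, ?_⟩
  filter_upwards [eventually_ge_atTop 1, eventually_mul_le_mul_sq Q (half_pos hκ),
    IsClose.eventually_mu_pos F ξ c] with y hy hyκ hmu s hs x hx hle
  obtain ⟨ψ, hψ, hrow, hcol, hclose⟩ := hservice y s hy hs x hle
  set h := ‖F.deviation ξ y x‖
  have hh : 0 ≤ h := norm_nonneg _
  have hψ0 : ∀ i j, 0 ≤ ψ i j := fun i j => by
    by_cases hij : F.IsBasic ξ i j
    · have hbasic : κ * y ^ 2 ≤ y ^ 2 * (ξ i j * F.nu j) := by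
        rw [mul_comm]; gcongr; simpa using hξκ ⟨(i, j), hij⟩
      have hQh : Q * h ≤ κ / 2 * y ^ 2 :=
        (mul_le_mul_of_nonneg_left hx hQ.le).trans_eq (by field_simp)
      have hψr : (0 : ℝ) ≤ ψ i j := by linarith [(abs_le.1 (hclose i j)).1]
      exact_mod_cast hψr
    · exact (hψ i j hij).ge
  lift ψ to I → J → ℕ using hψ0
  beta_reduce at hψ hrow hcol hclose
  have hbalance : F.netInflow (fun i j => ξ i j * F.nu j) = 0 := by
    ext i; simp [Fluid.netInflow, hcrit.balance]
  have hadm : s.IsAdmissible x ψ :=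
    { activity := fun i j hs0 => by
        simpa using hψ i j fun hij => (hmu s hs i j hij.1).ne' hs0
      customers := fun i => by exact_mod_cast (hrow i).le
      stations := fun j => by exact_mod_cast hcol j }
  refine ⟨ψ, hadm, fun i => by exact_mod_cast hrow i, ?_⟩
  have hdrift := hnet y s hy hs ψ (Q * (h + y)) (by positivity) (by exact_mod_cast hclose)
  rw [hbalance, smul_zero, sub_zero] at hdrift
  calc ‖s.netInflow ψ‖ ≤ C * (Q * (h + y) + y) := hdrift
    _ ≤ C * (Q * (h + y) + (h + y)) := by gcongr; linarith
    _ = C * (Q + 1) * (h + y) := by ring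

lemma exists_draining (hcrit : F.IsCritical ξ) (hsub : F.ThroughputSuboptimal ξ) (hc : 0 ≤ c) :
    ∃ C δ η, 0 ≤ C ∧ 0 < δ ∧ 0 < η ∧ ∀ᶠ y : ℝ in atTop, ∀ s, IsClose F ξ c y s →
      ∃ ψ : I → J → ℕ, (∀ x, ‖F.deviation ξ y x‖ ≤ η * y ^ 2 → s.IsAdmissible x ψ) ∧
        ‖s.netInflow ψ‖ ≤ C * y ^ 2 ∧ ∑ i, s.netInflow ψ i ≤ -δ * y ^ 2 := by
  obtain ⟨κ, w, hκ, hw0, hwmu, hrow, hcol, hgain⟩ := hsub.exists_slack_service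
  set g := -∑ i, F.netInflow w i with hg
  have hg0 : 0 < g := neg_pos.2 hgain
  obtain ⟨η, hη, hmass⟩ := exists_pos_forall_mul_le (fun _ => 1) fun i =>
    mul_pos (sub_pos.2 hκ) (hcrit.mass_pos i)
  obtain ⟨C, hC, hnet⟩ := IsClose.exists_norm_netInflow_sub_le F ξ hc w
  refine ⟨2 * C + ‖F.netInflow w‖, g / 2, η, by positivity, half_pos hg0, hη, ?_⟩
  filter_upwards [eventually_ge_atTop 1, IsClose.eventually_mu_pos F ξ c,
    eventually_all.2 fun j => eventually_mul_le_mul_sq c (mul_pos (sub_pos.2 hκ) (F.nu_pos j)),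
    eventually_mul_le_mul_sq (Fintype.card I * (2 * C)) (half_pos hg0)]
    with y hy hmu hservers hdrift
  intro s hs
  have hyw : ∀ i j, 0 ≤ y ^ 2 * w i j := fun i j => mul_nonneg (sq_nonneg y) (hw0 i j)
  have herror : ‖s.netInflow (fun i j => ⌊y ^ 2 * w i j⌋₊) - y ^ 2 • F.netInflow w‖ ≤
      2 * C * y := by
    refine (hnet y s hy hs _ 1 zero_le_one fun i j => ?_).trans (by nlinarith)
    rw [abs_sub_comm, abs_of_nonneg (sub_nonneg.2 (Nat.floor_le (hyw i j)))]
    linarith [Nat.lt_floor_add_one (y ^ 2 * w i j)]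
  refine ⟨fun i j => ⌊y ^ 2 * w i j⌋₊, fun x hx => s.isAdmissible_floor hyw (fun i j h => ?_)
    (fun i => ?_) fun j => ?_, ?_, ?_⟩
  · have hmu0 : F.mu i j = 0 :=
      le_antisymm (not_lt.1 fun hpos => (hmu s hs i j hpos).ne' h) (F.mu_nonneg i j)
    rw [hwmu i j hmu0, mul_zero]
  · have hdev : -(η * y ^ 2) ≤ x i - y ^ 2 * F.mass ξ i :=
      (abs_le.1 ((norm_le_pi_norm (F.deviation ξ y x) i).trans hx)).1
    have hrowy := mul_le_mul_of_nonneg_left (hrow i) (sq_nonneg y)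
    have hslack := mul_le_mul_of_nonneg_right (hmass i) (sq_nonneg y)
    rw [← Finset.mul_sum]
    linarith
  · have hcoly := mul_le_mul_of_nonneg_left (hcol j) (sq_nonneg y)
    rw [← Finset.mul_sum]
    linarith [(abs_le.1 (hs.servers j)).1, hservers j]
  · calc ‖s.netInflow _‖ ≤ ‖s.netInflow _ - y ^ 2 • F.netInflow w‖ + ‖y ^ 2 • F.netInflow w‖ :=
          norm_le_norm_sub_add _ _
      _ ≤ 2 * C * y ^ 2 + y ^ 2 * ‖F.netInflow w‖ := by
          rw [norm_smul, Real.norm_of_nonneg (sq_nonneg y)]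
          gcongr
          exact herror.trans (by gcongr; nlinarith)
      _ = _ := by ring
  · have hsum : ∑ i, s.netInflow (fun i j => ⌊y ^ 2 * w i j⌋₊) i + y ^ 2 * g ≤
        Fintype.card I * (2 * C * y) := by
      calc _ = ∑ i, (s.netInflow (fun i j => ⌊y ^ 2 * w i j⌋₊) - y ^ 2 • F.netInflow w) i := by
            simp [hg, Finset.mul_sum, sub_eq_add_neg, Finset.sum_add_distrib]
        _ ≤ _ := (Finset.sum_le_sum fun i _ => le_abs_self _).trans
            ((sum_abs_le_card_mul_norm _).trans (by gcongr))
    linarith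

end Fluid.IsCritical

/-- The assignment `ψ` counteracts the deviation of the state `x` from criticality: as long as this
deviation is small, `ψ` serves everybody with nearly balanced drifts if there are enough servers,
and drains the system at full speed otherwise. -/
structure IsStabilizing (F : Fluid I J) (ξ : I → J → ℝ) (C δ η y : ℝ) (s : System I J)
    (x : I → ℕ) (ψ : I → J → ℕ) : Prop where
  serve : ‖F.deviation ξ y x‖ ≤ η * y ^ 2 → ∑ i, x i ≤ ∑ j, s.servers j →
    (∀ i, ∑ j, ψ i j = x i) ∧ ‖s.netInflow ψ‖ ≤ C * (‖F.deviation ξ y x‖ + y)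
  drain : ‖F.deviation ξ y x‖ ≤ η * y ^ 2 → ∑ j, s.servers j < ∑ i, x i →
    ‖s.netInflow ψ‖ ≤ C * y ^ 2 ∧ ∑ i, s.netInflow ψ i ≤ -δ * y ^ 2

lemma System.isAdmissible_zero (s : System I J) (x : I → ℕ) : s.IsAdmissible x 0 := by
  constructor <;> simp

lemma Fluid.IsCritical.exists_isStabilizing {F : Fluid I J} {ξ : I → J → ℝ}
    (hcrit : F.IsCritical ξ) (hconn : (F.basicGraph ξ).Connected)
    (hsub : F.ThroughputSuboptimal ξ) {c : ℝ} (hc : 0 ≤ c) :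
    ∃ C δ η, 0 ≤ C ∧ 0 < δ ∧ 0 < η ∧ ∀ᶠ y : ℝ in atTop, ∀ s, IsClose F ξ c y s →
      ∀ x, ∃ ψ, s.IsAdmissible x ψ ∧ IsStabilizing F ξ C δ η y s x ψ := by
  obtain ⟨C₁, η₁, hC₁, hη₁, hserve⟩ := hcrit.exists_full_service hconn hc
  obtain ⟨C₂, δ, η₂, -, hδ, hη₂, hdrain⟩ := hcrit.exists_draining hsub hc
  refine ⟨max C₁ C₂, δ, min η₁ η₂, hC₁.trans (le_max_left _ _), hδ, lt_min hη₁ hη₂, ?_⟩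
  filter_upwards [eventually_ge_atTop 0, hserve, hdrain] with y hy hserve hdrain s hs x
  by_cases hx : ‖F.deviation ξ y x‖ ≤ min η₁ η₂ * y ^ 2
  · have hx₁ : ‖F.deviation ξ y x‖ ≤ η₁ * y ^ 2 := hx.trans (by gcongr; exact min_le_left _ _)
    have hx₂ : ‖F.deviation ξ y x‖ ≤ η₂ * y ^ 2 := hx.trans (by gcongr; exact min_le_right _ _)
    rcases le_or_gt (∑ i, x i) (∑ j, s.servers j) with hle | hlt
    · obtain ⟨ψ, hadm, hall, hnet⟩ := hserve s hs x hx₁ hle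
      exact ⟨ψ, hadm, fun _ _ => ⟨hall, hnet.trans (by gcongr; exact le_max_left _ _)⟩,
        fun _ h => absurd h hle.not_gt⟩
    · obtain ⟨ψ, hadm, hnet, hsum⟩ := hdrain s hs
      exact ⟨ψ, hadm x hx₂, fun _ h => absurd hlt h.not_gt,
        fun _ _ => ⟨hnet.trans (by gcongr; exact le_max_right _ _), hsum⟩⟩
  · exact ⟨0, s.isAdmissible_zero x, fun h => absurd h hx, fun h => absurd h hx⟩

lemma tendsto_sqrt_pnat : Tendsto (fun n : ℕ+ => √(n : ℝ)) atTop atTop :=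
  Real.tendsto_sqrt_atTop.comp (tendsto_natCast_atTop_atTop.comp tendsto_PNat_val_atTop_atTop)

lemma Fluid.IsCritical.exists_feedback {F : Fluid I J} {ξ : I → J → ℝ}
    (hcrit : F.IsCritical ξ) (hconn : (F.basicGraph ξ).Connected)
    (hsub : F.ThroughputSuboptimal ξ) {c : ℝ} (hc : 0 ≤ c) {sys : ℕ+ → System I J}
    (hclose : ∀ n : ℕ+, IsClose F ξ c (√(n : ℝ)) (sys n)) :
    ∃ C δ η, 0 ≤ C ∧ 0 < δ ∧ 0 < η ∧ ∃ f : ℕ+ → (I → ℕ) → I → J → ℕ,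
      (∀ n x, (sys n).IsAdmissible x (f n x)) ∧
      ∀ᶠ n : ℕ+ in atTop, ∀ x, IsStabilizing F ξ C δ η (√(n : ℝ)) (sys n) x (f n x) := by
  obtain ⟨C, δ, η, hC, hδ, hη, hev⟩ := hcrit.exists_isStabilizing hconn hsub hc
  have hchoice : ∀ (n : ℕ+) x, ∃ ψ, (sys n).IsAdmissible x ψ ∧
      ((∃ ψ, (sys n).IsAdmissible x ψ ∧ IsStabilizing F ξ C δ η (√(n : ℝ)) (sys n) x ψ) →
        IsStabilizing F ξ C δ η (√(n : ℝ)) (sys n) x ψ) := fun n x => by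
    by_cases h : ∃ ψ, (sys n).IsAdmissible x ψ ∧ IsStabilizing F ξ C δ η (√(n : ℝ)) (sys n) x ψ
    · exact h.imp fun ψ hψ => ⟨hψ.1, fun _ => hψ.2⟩
    · exact ⟨0, (sys n).isAdmissible_zero x, fun h' => absurd h' h⟩
  choose f hadm hstab using hchoice
  exact ⟨C, δ, η, hC, hδ, hη, f, hadm, (tendsto_sqrt_pnat.eventually hev).mono
    fun n hn x => hstab n x (hn _ (hclose n) x)⟩

section ControlledPaths

open Set

lemma forall_lt_of_forall_le_imp_lt {h : ℝ → ℝ} {a b B : ℝ}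
    (hcont : ∀ t ∈ Ico a b, ContinuousWithinAt h (Ici t) t)
    (hstep : ∀ t ∈ Icc a b, (∀ s ∈ Ico a t, h s ≤ B) → h t < B) : ∀ t ∈ Icc a b, h t < B := by
  set S := {t | ∀ s ∈ Ico a t, h s ≤ B} with hS
  have hclosed : IsClosed S := by
    have hSc : Sᶜ = ⋃ s ∈ {s | a ≤ s ∧ B < h s}, Ioi s := by
      ext t
      simp only [hS, mem_compl_iff, mem_ofPred_eq, mem_Ico, not_forall, not_le, mem_iUnion, mem_Ioi]
      grind
    rw [← isOpen_compl_iff, hSc]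
    exact isOpen_biUnion fun s _ => isOpen_Ioi
  have hall : Icc a b ⊆ S := by
    refine IsClosed.Icc_subset_of_forall_mem_nhdsWithin (hclosed.inter isClosed_Icc)
      (fun s hs => absurd hs.1 hs.2.not_ge) fun t ht => ?_
    have hlt := hstep t ⟨ht.2.1, ht.2.2.le⟩ ht.1
    obtain ⟨u, htu, hu⟩ := (mem_nhdsGE_iff_exists_Ico_subset).1
      ((hcont t ht.2).eventually_lt continuousWithinAt_const hlt)
    filter_upwards [Ioo_mem_nhdsGT htu] with v hv s hs
    rcases lt_or_ge s t with hst | hst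
    exacts [ht.1 s ⟨hs.1, hst⟩, (hu ⟨hst, hs.2.trans hv.2⟩).le]
  exact fun t ht => hstep t ht (hall ht)

lemma le_mul_exp_of_le_add_integral {h : ℝ → ℝ} {a b T : ℝ} (hb : 0 ≤ b)
    (hint : IntervalIntegrable h volume 0 T)
    (hcont : ∀ t ∈ Ico 0 T, ContinuousWithinAt h (Ici t) t)
    (hle : ∀ u ∈ Icc 0 T, h u ≤ a + b * ∫ s in (0 : ℝ)..u, h s) :
    ∀ u ∈ Icc 0 T, h u ≤ a * Real.exp (b * u) := by
  have hbound : ∀ u ∈ Icc 0 T, ∫ s in (0 : ℝ)..u, h s ≤ gronwallBound 0 b a (u - 0) := by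
    rcases lt_or_ge T 0 with hT | hT
    · simp [Icc_eq_empty hT.not_ge]
    have hderiv : ∀ u ∈ Ico 0 T, HasDerivWithinAt (fun u => ∫ s in (0 : ℝ)..u, h s) (h u)
        (Ici u) u := fun u hu => by
      have hsub : IntervalIntegrable h volume 0 u := hint.mono_set
        (by rw [uIcc_of_le hu.1, uIcc_of_le hT]; exact Icc_subset_Icc_right hu.2.le)
      refine intervalIntegral.integral_hasDerivWithinAt_right hsub
        ⟨Ioc u T, Ioc_mem_nhdsGT hu.2, ?_⟩ ((hcont u hu).mono Ioi_subset_Ici_self)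
      exact hint.1.aestronglyMeasurable.mono_set (Ioc_subset_Ioc_left hu.1)
    refine le_gronwallBound_of_liminf_deriv_right_le (f' := h) ?_
      (fun u hu r hr => (hderiv u hu).liminf_right_slope_le hr) (by simp)
      fun u hu => by linarith [hle u ⟨hu.1, hu.2.le⟩]
    have hprim := intervalIntegral.continuousOn_primitive_interval' hint left_mem_uIcc
    rwa [uIcc_of_le hT] at hprim
  intro u hu
  calc h u ≤ a + b * ∫ s in (0 : ℝ)..u, h s := hle u hu
    _ ≤ a + b * gronwallBound 0 b a (u - 0) := by gcongr; exact hbound u hu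
    _ = a * Real.exp (b * u) := by
      rcases eq_or_ne b 0 with rfl | hb0
      · simp
      · simp only [gronwallBound_of_K_ne_0 hb0, sub_zero]
        field_simp
        ring

lemma intervalIntegrable_indicator {O : Set ℝ} (hO : MeasurableSet O) (d a b : ℝ) :
    IntervalIntegrable (O.indicator fun _ => d) volume a b :=
  intervalIntegrable_iff.2 <|
    (intervalIntegrable_iff.1 (intervalIntegrable_const (c := d))).indicator hO

lemma volume_inter_Icc_le {O : Set ℝ} {T K : ℝ} (hO : MeasurableSet O) (hT : 0 ≤ T)
    (hK : ∫ s in (0 : ℝ)..T, O.indicator (fun _ => (1 : ℝ)) s ≤ K) :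
    volume (O ∩ Icc 0 T) ≤ ENNReal.ofReal K := by
  have hfin : volume (O ∩ Icc 0 T) ≠ ⊤ :=
    ne_top_of_le_ne_top (by simp) (measure_mono inter_subset_right)
  have hreal : ∫ s in (0 : ℝ)..T, O.indicator (fun _ => (1 : ℝ)) s =
      volume.real (O ∩ Icc 0 T) := by
    rw [intervalIntegral.integral_of_le hT, ← integral_Icc_eq_integral_Ioc,
      integral_indicator_const _ hO, measureReal_restrict_apply hO, smul_eq_mul, mul_one]
  rw [← ENNReal.ofReal_toReal hfin]
  exact ENNReal.ofReal_le_ofReal (hreal.symm.trans_le hK)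

lemma integral_indicator_le_of_forall_mem {O : Set ℝ} (hO : MeasurableSet O) {u G : ℝ}
    (hG : 0 ≤ G)
    (h : ∀ s ∈ O ∩ Icc 0 u, ∫ r in (0 : ℝ)..s, O.indicator (fun _ => (1 : ℝ)) r ≤ G) (hu : 0 ≤ u) :
    ∫ r in (0 : ℝ)..u, O.indicator (fun _ => (1 : ℝ)) r ≤ G := by
  have hvanish : ∀ t ∈ Icc 0 u, (∀ s ∈ O ∩ Icc 0 u, s ≤ t) →
      ∫ r in t..u, O.indicator (fun _ => (1 : ℝ)) r = 0 := fun t ht hle => by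
    refine intervalIntegral.integral_zero_ae (Eventually.of_forall fun r hr => ?_)
    rw [uIoc_of_le ht.2] at hr
    exact indicator_of_notMem
      (fun hrO => (hle r ⟨hrO, ht.1.trans hr.1.le, hr.2⟩).not_gt hr.1) _
  rcases (O ∩ Icc 0 u).eq_empty_or_nonempty with hempty | hne
  · rwa [hvanish 0 ⟨le_rfl, hu⟩ (by simp [hempty])]
  · have hbdd : BddAbove (O ∩ Icc 0 u) := ⟨u, fun r hr => hr.2.2⟩
    have hlast := csSup_mem_closure hne hbdd
    have hlastu : sSup (O ∩ Icc 0 u) ∈ Icc 0 u :=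
      closure_minimal inter_subset_right isClosed_Icc hlast
    have hclosed : IsClosed {s | ∫ r in (0 : ℝ)..s, O.indicator (fun _ => (1 : ℝ)) r ≤ G} :=
      isClosed_le (intervalIntegral.continuous_primitive (intervalIntegrable_indicator hO 1) 0)
        continuous_const
    rw [← intervalIntegral.integral_add_adjacent_intervals
      (intervalIntegrable_indicator hO 1 0 (sSup (O ∩ Icc 0 u)))
      (intervalIntegrable_indicator hO 1 _ _),
      hvanish _ hlastu fun s hs => le_csSup hbdd hs, add_zero]
    exact closure_minimal h hclosed hlast

lemma integral_le_of_le_mul_add_indicator {O : Set ℝ} (hO : MeasurableSet O) {f h : ℝ → ℝ}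
    {c d E u : ℝ} (hu : 0 ≤ u) (hf : IntervalIntegrable f volume 0 u)
    (hh : IntervalIntegrable h volume 0 u)
    (hle : ∀ s ∈ Ioo 0 u, f s ≤ c * (h s + E) + O.indicator (fun _ => d) s) :
    ∫ s in (0 : ℝ)..u, f s ≤ c * ((∫ s in (0 : ℝ)..u, h s) + u * E) +
      d * ∫ s in (0 : ℝ)..u, O.indicator (fun _ => (1 : ℝ)) s := by
  have hmain := (hh.add (intervalIntegrable_const (c := E))).const_mul c
  have hind := intervalIntegrable_indicator hO d 0 u
  have hscale : (O.indicator fun _ => d) = fun s => d * O.indicator (fun _ => (1 : ℝ)) s := by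
    ext s
    by_cases hs : s ∈ O <;> simp [hs]
  refine (intervalIntegral.integral_mono_on_of_le_Ioo hu hf (hmain.add hind) hle).trans_eq ?_
  rw [intervalIntegral.integral_add hmain hind, intervalIntegral.integral_const_mul,
    intervalIntegral.integral_add hh intervalIntegrable_const, intervalIntegral.integral_const,
    hscale, intervalIntegral.integral_const_mul, sub_zero, smul_eq_mul]

variable {V : Type*} [NormedAddCommGroup V] [NormedSpace ℝ V]

/-- A path `z` in a Banach space that is driven by the drift `D` up to an error `E`, on the time
interval `[0, T]`. The drift is of the order of `z` itself outside the set `O` of times; at the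
times in `O`, where the functional `φ` is almost nonnegative, it pushes `φ` down at the large
speed `δ * n`. -/
structure IsControlledPath (φ : V →L[ℝ] ℝ) (C δ E n T : ℝ) (O : Set ℝ) (z D : ℝ → V) : Prop where
  measurableSet : MeasurableSet O
  right_continuous : ∀ t, ContinuousWithinAt z (Ici t) t
  intervalIntegrable : IntervalIntegrable z volume 0 T
  intervalIntegrable_drift : IntervalIntegrable D volume 0 T
  norm_sub_integral_le : ∀ t ∈ Icc 0 T, ‖z t - ∫ s in (0 : ℝ)..t, D s‖ ≤ E
  norm_drift_le : ∀ t ∈ Ico 0 T, t ∉ O → ‖D t‖ ≤ C * (‖z t‖ + E)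
  norm_drift_le_of_mem : ∀ t ∈ Ico 0 T, t ∈ O → ‖D t‖ ≤ C * n
  drift_le : ∀ t ∈ Ico 0 T, t ∈ O → φ (D t) ≤ -δ * n
  neg_le : ∀ t ∈ Icc 0 T, t ∈ O → -E ≤ φ (z t)

namespace IsControlledPath

variable {φ : V →L[ℝ] ℝ} {C δ E n T : ℝ} {O : Set ℝ} {z D : ℝ → V}

lemma mono {t : ℝ} (h : IsControlledPath φ C δ E n T O z D) (ht : t ∈ Icc 0 T) :
    IsControlledPath φ C δ E n t O z D where
  measurableSet := h.measurableSet
  right_continuous := h.right_continuous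
  intervalIntegrable := h.intervalIntegrable.mono_set
    (by rw [uIcc_of_le ht.1, uIcc_of_le (ht.1.trans ht.2)]; exact Icc_subset_Icc_right ht.2)
  intervalIntegrable_drift := h.intervalIntegrable_drift.mono_set
    (by rw [uIcc_of_le ht.1, uIcc_of_le (ht.1.trans ht.2)]; exact Icc_subset_Icc_right ht.2)
  norm_sub_integral_le s hs := h.norm_sub_integral_le s ⟨hs.1, hs.2.trans ht.2⟩
  norm_drift_le s hs := h.norm_drift_le s ⟨hs.1, hs.2.trans_le ht.2⟩
  norm_drift_le_of_mem s hs := h.norm_drift_le_of_mem s ⟨hs.1, hs.2.trans_le ht.2⟩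
  drift_le s hs := h.drift_le s ⟨hs.1, hs.2.trans_le ht.2⟩
  neg_le s hs := h.neg_le s ⟨hs.1, hs.2.trans ht.2⟩

lemma norm_le (h : IsControlledPath φ C δ E n T O z D) (hC : 0 ≤ C) (hE : 0 ≤ E) (hT : 0 ≤ T) :
    ‖z T‖ ≤ E + (C * ((∫ s in (0 : ℝ)..T, ‖z s‖) + T * E) +
      C * n * ∫ s in (0 : ℝ)..T, O.indicator (fun _ => (1 : ℝ)) s) := by
  have hdrift : ‖∫ s in (0 : ℝ)..T, D s‖ ≤ C * ((∫ s in (0 : ℝ)..T, ‖z s‖) + T * E) +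
      C * n * ∫ s in (0 : ℝ)..T, O.indicator (fun _ => (1 : ℝ)) s := by
    refine (intervalIntegral.norm_integral_le_integral_norm hT).trans ?_
    refine integral_le_of_le_mul_add_indicator h.measurableSet hT h.intervalIntegrable_drift.norm
      h.intervalIntegrable.norm fun s hs => ?_
    by_cases hsO : s ∈ O
    · rw [indicator_of_mem hsO]
      exact (h.norm_drift_le_of_mem s ⟨hs.1.le, hs.2⟩ hsO).trans
        (le_add_of_nonneg_left (by positivity))
    · rw [indicator_of_notMem hsO, add_zero]
      exact h.norm_drift_le s ⟨hs.1.le, hs.2⟩ hsO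
  calc ‖z T‖ ≤ ‖z T - ∫ s in (0 : ℝ)..T, D s‖ + ‖∫ s in (0 : ℝ)..T, D s‖ :=
        norm_le_norm_sub_add _ _
    _ ≤ _ := add_le_add (h.norm_sub_integral_le T ⟨hT, le_rfl⟩) hdrift

variable [CompleteSpace V]

lemma apply_le (h : IsControlledPath φ C δ E n T O z D) (hC : 0 ≤ C) (hE : 0 ≤ E) (hT : 0 ≤ T) :
    φ (z T) ≤ ‖φ‖ * E + ‖φ‖ * C * ((∫ s in (0 : ℝ)..T, ‖z s‖) + T * E) +
      -δ * n * ∫ s in (0 : ℝ)..T, O.indicator (fun _ => (1 : ℝ)) s := by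
  have hsplit : φ (z T) = φ (z T - ∫ s in (0 : ℝ)..T, D s) + ∫ s in (0 : ℝ)..T, φ (D s) := by
    rw [φ.intervalIntegral_comp_comm h.intervalIntegrable_drift, map_sub, sub_add_cancel]
  have hnoise : φ (z T - ∫ s in (0 : ℝ)..T, D s) ≤ ‖φ‖ * E :=
    (le_abs_self _).trans <| (φ.le_opNorm _).trans <|
      mul_le_mul_of_nonneg_left (h.norm_sub_integral_le T ⟨hT, le_rfl⟩) (norm_nonneg φ)
  have hdrift : ∫ s in (0 : ℝ)..T, φ (D s) ≤
      ‖φ‖ * C * ((∫ s in (0 : ℝ)..T, ‖z s‖) + T * E) +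
        -δ * n * ∫ s in (0 : ℝ)..T, O.indicator (fun _ => (1 : ℝ)) s := by
    refine integral_le_of_le_mul_add_indicator h.measurableSet hT
      (intervalIntegrable_iff.2 (φ.integrable_comp
        (intervalIntegrable_iff.1 h.intervalIntegrable_drift)))
      h.intervalIntegrable.norm fun s hs => ?_
    by_cases hsO : s ∈ O
    · rw [indicator_of_mem hsO]
      exact (h.drift_le s ⟨hs.1.le, hs.2⟩ hsO).trans (le_add_of_nonneg_left (by positivity))
    · rw [indicator_of_notMem hsO, add_zero, mul_assoc]
      exact (le_abs_self _).trans <| (φ.le_opNorm _).trans <|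
        mul_le_mul_of_nonneg_left (h.norm_drift_le s ⟨hs.1.le, hs.2⟩ hsO) (norm_nonneg φ)
  linarith

/-- At a time of `O` the functional is almost nonnegative, so the strong push spent so far is paid
for by the rest of the drift; the last time of `O` then accounts for all later times. -/
lemma occupation_le (h : IsControlledPath φ C δ E n T O z D) (hC : 0 ≤ C) (hδ : 0 < δ)
    (hE : 0 ≤ E) (hn : 0 < n) (hT : 0 ≤ T) :
    n * ∫ s in (0 : ℝ)..T, O.indicator (fun _ => (1 : ℝ)) s ≤
      ((1 + ‖φ‖ + ‖φ‖ * C * T) * E + ‖φ‖ * C * ∫ s in (0 : ℝ)..T, ‖z s‖) / δ := by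
  have hH : 0 ≤ ∫ s in (0 : ℝ)..T, ‖z s‖ :=
    intervalIntegral.integral_nonneg hT fun s _ => norm_nonneg _
  rw [← le_div_iff₀' hn]
  refine integral_indicator_le_of_forall_mem h.measurableSet (by positivity) (fun s hs => ?_) hT
  have hHs : ∫ r in (0 : ℝ)..s, ‖z r‖ ≤ ∫ r in (0 : ℝ)..T, ‖z r‖ :=
    intervalIntegral.integral_mono_interval le_rfl hs.2.1 hs.2.2
      (Eventually.of_forall fun _ => norm_nonneg _) h.intervalIntegrable.norm
  have hbal := (h.neg_le s hs.2 hs.1).trans ((h.mono hs.2).apply_le hC hE hs.2.1)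
  have hmono : ‖φ‖ * C * ((∫ r in (0 : ℝ)..s, ‖z r‖) + s * E) ≤
      ‖φ‖ * C * ((∫ r in (0 : ℝ)..T, ‖z r‖) + T * E) := by
    gcongr
    exact hs.2.2
  rw [le_div_iff₀ hn, le_div_iff₀ hδ]
  linarith

variable (φ) in
lemma exists_bound (hC : 0 ≤ C) (hδ : 0 < δ) (hT : 0 ≤ T) :
    ∃ K, 0 < K ∧ ∀ (E n : ℝ) (O : Set ℝ) (z D : ℝ → V), 0 ≤ E → 0 < n → ∀ t ∈ Icc 0 T,
      IsControlledPath φ C δ E n t O z D →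
      ‖z t‖ ≤ K * E ∧ n * ∫ s in (0 : ℝ)..t, O.indicator (fun _ => (1 : ℝ)) s ≤ K * E := by
  set p := 1 + ‖φ‖ + ‖φ‖ * C * T with hp
  set a := 1 + C * T + C * p / δ with ha
  set b := C + C * (‖φ‖ * C) / δ with hb
  set K := a * Real.exp (b * T) with hK
  have hK0 : 0 < K := by positivity
  refine ⟨K + (p + ‖φ‖ * C * (T * K)) / δ, by positivity, fun E n O z D hE hn t ht h => ?_⟩
  have hocc : ∀ u ∈ Icc 0 t, n * ∫ s in (0 : ℝ)..u, O.indicator (fun _ => (1 : ℝ)) s ≤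
      (p * E + ‖φ‖ * C * ∫ s in (0 : ℝ)..u, ‖z s‖) / δ := fun u hu => by
    refine ((h.mono hu).occupation_le hC hδ hE hn hu.1).trans ?_
    rw [hp]
    gcongr
    exact hu.2.trans ht.2
  have hgronwall : ∀ u ∈ Icc 0 t, ‖z u‖ ≤ a * E + b * ∫ s in (0 : ℝ)..u, ‖z s‖ := fun u hu => by
    calc ‖z u‖ ≤ E + (C * ((∫ s in (0 : ℝ)..u, ‖z s‖) + u * E) +
          C * (n * ∫ s in (0 : ℝ)..u, O.indicator (fun _ => (1 : ℝ)) s)) := by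
          rw [← mul_assoc]
          exact (h.mono hu).norm_le hC hE hu.1
      _ ≤ E + (C * ((∫ s in (0 : ℝ)..u, ‖z s‖) + T * E) +
          C * ((p * E + ‖φ‖ * C * ∫ s in (0 : ℝ)..u, ‖z s‖) / δ)) := by
          gcongr
          exacts [hu.2.trans ht.2, hocc u hu]
      _ = _ := by rw [ha, hb]; ring
  have hbound : ∀ u ∈ Icc 0 t, ‖z u‖ ≤ K * E := fun u hu => by
    calc ‖z u‖ ≤ a * E * Real.exp (b * u) :=
          le_mul_exp_of_le_add_integral (by positivity) h.intervalIntegrable.norm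
            (fun s _ => (h.right_continuous s).norm) hgronwall u hu
      _ ≤ a * E * Real.exp (b * T) := by gcongr; exact hu.2.trans ht.2
      _ = K * E := by rw [hK]; ring
  have hH : ∫ s in (0 : ℝ)..t, ‖z s‖ ≤ T * K * E := by
    calc ∫ s in (0 : ℝ)..t, ‖z s‖ ≤ ∫ _ in (0 : ℝ)..t, K * E :=
          intervalIntegral.integral_mono_on ht.1 h.intervalIntegrable.norm
            intervalIntegrable_const hbound
      _ = t * K * E := by simp [mul_assoc, mul_left_comm]
      _ ≤ T * K * E := by gcongr; exact ht.2
  refine ⟨(hbound t ⟨ht.1, le_rfl⟩).trans (by gcongr; exact le_add_of_nonneg_right (by positivity)),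
    (hocc t ⟨ht.1, le_rfl⟩).trans ?_⟩
  calc (p * E + ‖φ‖ * C * ∫ s in (0 : ℝ)..t, ‖z s‖) / δ
      ≤ (p * E + ‖φ‖ * C * (T * K * E)) / δ := by gcongr
    _ = (p + ‖φ‖ * C * (T * K)) / δ * E := by ring
    _ ≤ _ := by gcongr; exact le_add_of_nonneg_left hK0.le

variable (φ) in
lemma exists_forall_norm_le (hC : 0 ≤ C) (hδ : 0 < δ) (hT : 0 ≤ T) :
    ∃ K, 0 < K ∧ ∀ (E n B : ℝ) (O : Set ℝ) (z D : ℝ → V), 0 ≤ E → 0 < n → K * E < B →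
      (∀ t ∈ Icc 0 T, (∀ s ∈ Ico 0 t, ‖z s‖ ≤ B) → IsControlledPath φ C δ E n t O z D) →
      (∀ t ∈ Icc 0 T, ‖z t‖ ≤ K * E) ∧ volume (O ∩ Icc 0 T) ≤ ENNReal.ofReal (K * E / n) := by
  obtain ⟨K, hK, hbound⟩ := exists_bound φ hC hδ hT
  refine ⟨K, hK, fun E n B O z D hE hn hB h => ?_⟩
  have hzero := h 0 ⟨le_rfl, hT⟩ fun s hs => absurd hs.1 hs.2.not_ge
  have hlt : ∀ t ∈ Icc 0 T, ‖z t‖ < B :=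
    forall_lt_of_forall_le_imp_lt (fun t _ => (hzero.right_continuous t).norm) fun t ht hs =>
      (hbound E n O z D hE hn t ht (h t ht hs)).1.trans_lt hB
  have hpath : ∀ t ∈ Icc 0 T, IsControlledPath φ C δ E n t O z D := fun t ht =>
    h t ht fun s hs => (hlt s ⟨hs.1, hs.2.le.trans ht.2⟩).le
  refine ⟨fun t ht => (hbound E n O z D hE hn t ht (hpath t ht)).1,
    volume_inter_Icc_le hzero.measurableSet hT ?_⟩
  rw [le_div_iff₀' hn]
  exact (hbound E n O z D hE hn T ⟨hT, le_rfl⟩ (hpath T ⟨hT, le_rfl⟩)).2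

end IsControlledPath

end ControlledPaths

section Clocks

open Set

lemma busyTime_add_of_forall_eq {ψ : ℝ≥0 → ℕ} (hψ : Measurable ψ) {R : ℕ} (hR : ∀ s, ψ s ≤ R)
    {t d : ℝ≥0} {c : ℕ} (hc : ∀ s, t ≤ s → s < t + d → ψ s = c) :
    busyTime ψ (t + d) = busyTime ψ t + c * d := by
  set f : ℝ → ℝ := fun s => ψ s.toNNReal
  have hf : ∀ a b, IntervalIntegrable f volume a b := fun a b => by
    rw [intervalIntegrable_iff]
    refine Measure.integrableOn_of_bounded (M := R) (by simp) ?_ (Eventually.of_forall fun s => ?_)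
    · exact ((measurable_of_countable fun n : ℕ => (n : ℝ)).comp
        (hψ.comp measurable_real_toNNReal)).aestronglyMeasurable
    · rw [Real.norm_natCast]
      exact_mod_cast hR _
  have hconst : ∫ s in (t : ℝ)..↑(t + d), f s = c * d := by
    have hle : (t : ℝ) ≤ ↑(t + d) := NNReal.coe_le_coe.2 le_self_add
    rw [intervalIntegral.integral_congr_Ioo_of_le (g := fun _ => (c : ℝ)) hle fun s hs => ?_]
    · rw [intervalIntegral.integral_const, smul_eq_mul, NNReal.coe_add]
      ring
    · have hs0 : 0 ≤ s := t.2.trans hs.1.le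
      have hsc := hc s.toNNReal (NNReal.le_toNNReal_of_coe_le hs.1.le)
        ((Real.toNNReal_lt_iff_lt_coe hs0).2 hs.2)
      simp only [f, hsc]
  have hpos : 0 ≤ ∫ s in (0 : ℝ)..t, f s :=
    intervalIntegral.integral_nonneg t.2 fun s _ => Nat.cast_nonneg _
  rw [busyTime, busyTime, ← intervalIntegral.integral_add_adjacent_intervals (hf 0 t) (hf t _),
    hconst, Real.toNNReal_add hpos (by positivity), Real.toNNReal_mul (Nat.cast_nonneg c),
    Real.toNNReal_coe, Real.toNNReal_natCast]

/-- A clock that rings at the internal times `σ 0 < σ 1 < …` (after which it may stay silent, as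
expressed by the value `⊤`), `N u` being the number of rings up to the internal time `u`. -/
structure IsClock (σ : ℕ → ℝ≥0∞) (N : ℝ≥0 → ℕ) : Prop where
  le_iff : ∀ m (u : ℝ≥0), σ m ≤ u ↔ m < N u
  pos : 0 < σ 0
  lt_succ : ∀ m, σ m ≠ ⊤ → σ m < σ (m + 1)

/-- The state of a family of clocks: their internal times, the numbers of their rings so far, and
the physical time. -/
structure ClockState (K : Type*) where
  clock : K → ℝ≥0∞
  count : K → ℕ
  time : ℝ≥0∞

namespace ClockState

variable {K : Type*}

/-- The internal time of clock `κ` after a further physical time `d` without rings, when clock `κ`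
runs at speed `r n κ` as long as the numbers of rings are `n`. -/
noncomputable def reading (r : (K → ℕ) → K → ℕ) (s : ClockState K) (d : ℝ≥0∞) (κ : K) : ℝ≥0∞ :=
  s.clock κ + r s.count κ * d

/-- The physical time until the next ring. -/
noncomputable def gap (r : (K → ℕ) → K → ℕ) (σ : K → ℕ → ℝ≥0∞) (s : ClockState K) : ℝ≥0∞ :=
  ⨅ κ, (σ κ (s.count κ) - s.clock κ) / (r s.count κ : ℝ≥0∞)

/-- The state right after the next ring. -/
noncomputable def next (r : (K → ℕ) → K → ℕ) (σ : K → ℕ → ℝ≥0∞) (s : ClockState K) :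
    ClockState K where
  clock := s.reading r (s.gap r σ)
  count κ := if σ κ (s.count κ) ≤ s.reading r (s.gap r σ) κ then s.count κ + 1 else s.count κ
  time := s.time + s.gap r σ

/-- The state after `k` instants of ringing, with all clocks started at zero. -/
noncomputable def after (r : (K → ℕ) → K → ℕ) (σ : K → ℕ → ℝ≥0∞) : ℕ → ClockState K
  | 0 => ⟨0, 0, 0⟩
  | k + 1 => (after r σ k).next r σ

/-- The clocks have recorded exactly the rings up to their internal times. -/
structure IsConsistent (σ : K → ℕ → ℝ≥0∞) (s : ClockState K) : Prop where
  clock_lt : ∀ κ, s.clock κ < σ κ (s.count κ)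
  le_clock : ∀ κ, ∀ m < s.count κ, σ κ m ≤ s.clock κ

variable {r : (K → ℕ) → K → ℕ} {σ : K → ℕ → ℝ≥0∞} {N : K → ℝ≥0 → ℕ} {s : ClockState K}

lemma IsConsistent.count_eq (hs : s.IsConsistent σ) {κ : K} (hσ : IsClock (σ κ) (N κ)) {u : ℝ≥0}
    (hu : s.clock κ ≤ u) (hu' : u < σ κ (s.count κ)) : N κ u = s.count κ := by
  refine le_antisymm (not_lt.1 fun hlt => ?_) (not_lt.1 fun hlt => ?_)
  · exact hu'.not_ge ((hσ.le_iff _ u).2 hlt)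
  · exact lt_irrefl _ ((hσ.le_iff _ u).1 ((hs.le_clock κ _ hlt).trans hu))

lemma IsConsistent.reading_gap_le (hs : s.IsConsistent σ) (κ : K) :
    s.reading r (s.gap r σ) κ ≤ σ κ (s.count κ) := by
  rcases eq_or_ne (r s.count κ) 0 with hr | hr
  · simpa only [reading, hr, Nat.cast_zero, zero_mul, add_zero] using (hs.clock_lt κ).le
  have hgap : s.gap r σ ≤ (σ κ (s.count κ) - s.clock κ) / (r s.count κ : ℝ≥0∞) := iInf_le _ κ
  rw [ENNReal.le_div_iff_mul_le (.inl (Nat.cast_ne_zero.2 hr)) (.inl (ENNReal.natCast_ne_top _)),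
    mul_comm] at hgap
  calc s.reading r (s.gap r σ) κ ≤ s.clock κ + (σ κ (s.count κ) - s.clock κ) := by
        rw [reading]; gcongr
    _ = σ κ (s.count κ) := add_tsub_cancel_of_le (hs.clock_lt κ).le

lemma IsConsistent.reading_lt (hs : s.IsConsistent σ) (κ : K) {d : ℝ≥0∞} (hd : d < s.gap r σ) :
    s.reading r d κ < σ κ (s.count κ) := by
  rcases eq_or_ne (r s.count κ) 0 with hr | hr
  · simpa only [reading, hr, Nat.cast_zero, zero_mul, add_zero] using hs.clock_lt κ
  have hgap : d < (σ κ (s.count κ) - s.clock κ) / (r s.count κ : ℝ≥0∞) := hd.trans_le (iInf_le _ κ)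
  rw [ENNReal.lt_div_iff_mul_lt (.inl (Nat.cast_ne_zero.2 hr)) (.inl (ENNReal.natCast_ne_top _)),
    mul_comm] at hgap
  calc s.reading r d κ < s.clock κ + (σ κ (s.count κ) - s.clock κ) :=
        ENNReal.add_lt_add_left (hs.clock_lt κ).ne_top hgap
    _ = σ κ (s.count κ) := add_tsub_cancel_of_le (hs.clock_lt κ).le

lemma IsConsistent.speed_pos (hs : s.IsConsistent σ) {κ : K} {d : ℝ≥0∞}
    (hκ : σ κ (s.count κ) ≤ s.reading r d κ) : 0 < r s.count κ := by
  refine Nat.pos_of_ne_zero fun hr => (hs.clock_lt κ).not_ge ?_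
  simpa only [reading, hr, Nat.cast_zero, zero_mul, add_zero] using hκ

lemma IsConsistent.exists_ring [Finite K] (hs : s.IsConsistent σ) (hgap : s.gap r σ ≠ ⊤) :
    ∃ κ, σ κ (s.count κ) ≤ s.reading r (s.gap r σ) κ := by
  have : Nonempty K := not_isEmpty_iff.1 fun _ => hgap (iInf_of_empty _)
  obtain ⟨κ, hκ⟩ : ∃ κ, (σ κ (s.count κ) - s.clock κ) / (r s.count κ : ℝ≥0∞) = s.gap r σ :=
    exists_eq_ciInf_of_finite
  have hr : (r s.count κ : ℝ≥0∞) ≠ 0 := fun hr => by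
    rw [hr, ENNReal.div_zero (tsub_pos_of_lt (hs.clock_lt κ)).ne'] at hκ
    exact hgap hκ.symm
  refine ⟨κ, ?_⟩
  rw [reading, ← hκ, ENNReal.mul_div_cancel hr (ENNReal.natCast_ne_top _),
    add_tsub_cancel_of_le (hs.clock_lt κ).le]

lemma IsConsistent.next (hs : s.IsConsistent σ) (hσ : ∀ κ, IsClock (σ κ) (N κ))
    (hgap : s.gap r σ ≠ ⊤) : (s.next r σ).IsConsistent σ := by
  have hfin : ∀ κ, s.reading r (s.gap r σ) κ ≠ ⊤ := fun κ => ENNReal.add_ne_top.2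
    ⟨(hs.clock_lt κ).ne_top, ENNReal.mul_ne_top (ENNReal.natCast_ne_top _) hgap⟩
  refine ⟨fun κ => ?_, fun κ m hm => ?_⟩
  · simp only [ClockState.next]
    split_ifs with hκ
    · have heq : σ κ (s.count κ) = s.reading r (s.gap r σ) κ := hκ.antisymm (hs.reading_gap_le κ)
      exact heq ▸ (hσ κ).lt_succ _ (heq ▸ hfin κ)
    · exact not_le.1 hκ
  · have hold : m < s.count κ → σ κ m ≤ s.reading r (s.gap r σ) κ := fun hm =>
      (hs.le_clock κ m hm).trans le_self_add
    simp only [ClockState.next] at hm ⊢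
    split_ifs at hm with hκ
    · rcases Nat.lt_succ_iff_lt_or_eq.1 hm with hm | rfl
      · exact hold hm
      · exact hκ
    · exact hold hm

lemma isConsistent_after (hσ : ∀ κ, IsClock (σ κ) (N κ)) (k : ℕ) (hk : (after r σ k).time ≠ ⊤) :
    (after r σ k).IsConsistent σ := by
  induction k with
  | zero => exact ⟨fun κ => (hσ κ).pos, fun κ m hm => absurd hm (Nat.not_lt_zero m)⟩
  | succ k ih =>
    obtain ⟨htime, hgap⟩ := ENNReal.add_ne_top.1 hk
    exact (ih htime).next hσ hgap

lemma monotone_time_after : Monotone fun k => (after r σ k).time :=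
  monotone_nat_of_le_succ fun _ => le_self_add

lemma clock_after_le {R : ℕ} (hR : ∀ n κ, r n κ ≤ R) (k : ℕ) (κ : K) :
    (after r σ k).clock κ ≤ R * (after r σ k).time := by
  induction k with
  | zero => simp only [after, Pi.zero_apply, mul_zero, le_refl]
  | succ k ih =>
    simp only [after, next, reading, mul_add]
    gcongr
    exact hR _ κ

lemma le_sum_count_after [Fintype K] (hσ : ∀ κ, IsClock (σ κ) (N κ)) (k : ℕ)
    (hk : (after r σ k).time ≠ ⊤) : k ≤ ∑ κ, (after r σ k).count κ := by
  induction k with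
  | zero => exact Nat.zero_le _
  | succ k ih =>
    obtain ⟨htime, hgap⟩ := ENNReal.add_ne_top.1 hk
    obtain ⟨κ₀, hκ₀⟩ := (isConsistent_after hσ k htime).exists_ring hgap
    refine Nat.succ_le_of_lt ((ih htime).trans_lt (Finset.sum_lt_sum (fun κ _ => ?_)
      ⟨κ₀, Finset.mem_univ _, ?_⟩))
    · simp only [after, next]
      split_ifs <;> lia
    · simp only [after, next, if_pos hκ₀, Nat.lt_succ_self]

/-- The clocks do not ring infinitely often in finite time. -/
def IsNonexplosive (r : (K → ℕ) → K → ℕ) (σ : K → ℕ → ℝ≥0∞) : Prop :=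
  ∀ t : ℝ≥0, ∃ k, t < (after r σ (k + 1)).time

lemma isNonexplosive_of_speed_le [Finite K] (hσ : ∀ κ, IsClock (σ κ) (N κ)) {R : ℕ}
    (hR : ∀ n κ, r n κ ≤ R) : IsNonexplosive r σ := by
  cases nonempty_fintype K
  intro t
  by_contra! htime
  set k := ∑ κ, N κ (R * t)
  have hfin : (after r σ (k + 1)).time ≠ ⊤ := ne_top_of_le_ne_top ENNReal.coe_ne_top (htime k)
  have hclock : ∀ κ, (after r σ (k + 1)).clock κ ≤ ↑(R * t) := fun κ => by
    push_cast
    exact (clock_after_le hR (k + 1) κ).trans (mul_le_mul_right (htime k) _)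
  have hcount : ∀ κ, (after r σ (k + 1)).count κ ≤ N κ (R * t) := fun κ => by
    refine not_lt.1 fun hlt => lt_irrefl _ (((hσ κ).le_iff (N κ (R * t)) (R * t)).1 ?_)
    exact ((isConsistent_after hσ _ hfin).le_clock κ _ hlt).trans (hclock κ)
  have := (le_sum_count_after hσ (k + 1) hfin).trans (Finset.sum_le_sum fun κ _ => hcount κ)
  lia

/-- The number of instants of ringing up to the physical time `t`. -/
noncomputable def index (r : (K → ℕ) → K → ℕ) (σ : K → ℕ → ℝ≥0∞) (t : ℝ≥0) : ℕ :=
  sInf {k | t < (after r σ (k + 1)).time}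

/-- The numbers of rings of the clocks up to the physical time `t`. -/
noncomputable def countAt (r : (K → ℕ) → K → ℕ) (σ : K → ℕ → ℝ≥0∞) (t : ℝ≥0) : K → ℕ :=
  (after r σ (index r σ t)).count

lemma time_index_le (t : ℝ≥0) : (after r σ (index r σ t)).time ≤ t := by
  rcases hk : index r σ t with _ | k
  · exact zero_le
  · exact not_lt.1 (Nat.notMem_of_lt_sInf (hk ▸ k.lt_succ_self : k < index r σ t))

lemma index_eq {t : ℝ≥0} {k : ℕ} (hle : (after r σ k).time ≤ t)
    (hlt : t < (after r σ (k + 1)).time) : index r σ t = k := by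
  refine le_antisymm (Nat.sInf_le hlt) (le_csInf ⟨k, hlt⟩ fun m hm => ?_)
  exact not_lt.1 fun hmk => (hm.trans_le ((monotone_time_after hmk).trans hle)).false

namespace IsNonexplosive

variable (hex : IsNonexplosive r σ)
include hex

lemma lt_time_index (t : ℝ≥0) : t < (after r σ (index r σ t + 1)).time :=
  Nat.sInf_mem (hex t)

lemma index_le_iff {t : ℝ≥0} {k : ℕ} :
    index r σ t ≤ k ↔ t < (after r σ (k + 1)).time :=
  ⟨fun h => (hex.lt_time_index t).trans_le (monotone_time_after (Nat.add_le_add_right h 1)),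
    fun h => Nat.sInf_le h⟩

lemma continuousWithinAt_countAt (t : ℝ≥0) :
    ContinuousWithinAt (countAt r σ) (Ici t) t := by
  have hlt : ∀ᶠ s : ℝ≥0 in 𝓝[≥] t, s < (after r σ (index r σ t + 1)).time :=
    ((ENNReal.continuous_coe.tendsto t).eventually_lt_const (hex.lt_time_index t)).filter_mono
      nhdsWithin_le_nhds
  refine (continuousWithinAt_const (b := countAt r σ t)).congr_of_eventuallyEq ?_ rfl
  filter_upwards [hlt, self_mem_nhdsWithin] with s hs hts
  rw [countAt, index_eq ((time_index_le t).trans (ENNReal.coe_le_coe.2 hts)) hs, countAt]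

lemma measurable_countAt : Measurable (countAt r σ) := by
  have hindex : Monotone (index r σ) := fun t t' htt' =>
    hex.index_le_iff.2 ((ENNReal.coe_le_coe.2 htt').trans_lt (hex.lt_time_index t'))
  exact (measurable_of_countable fun k => (after r σ k).count).comp hindex.measurable

lemma busyTime_time_add [Finite K] {R : ℕ} (hR : ∀ n κ, r n κ ≤ R) (κ : K) {k : ℕ} {τ d : ℝ≥0}
    (hτ : (after r σ k).time = τ) (hd : d ≤ (after r σ k).gap r σ) :
    busyTime (fun s => r (countAt r σ s) κ) (τ + d)
      = busyTime (fun s => r (countAt r σ s) κ) τ + r (after r σ k).count κ * d := by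
  have hmeas : Measurable fun s => r (countAt r σ s) κ :=
    (measurable_of_countable fun n => r n κ).comp hex.measurable_countAt
  refine busyTime_add_of_forall_eq hmeas (fun s => hR _ κ) fun s hs hs' => ?_
  have hnext : (s : ℝ≥0∞) < (after r σ (k + 1)).time :=
    calc (s : ℝ≥0∞) < τ + d := by exact_mod_cast hs'
      _ ≤ τ + (after r σ k).gap r σ := by gcongr
      _ = (after r σ (k + 1)).time := by rw [after, ClockState.next, hτ]
  rw [countAt, index_eq (hτ.trans_le (ENNReal.coe_le_coe.2 hs)) hnext]

lemma coe_busyTime_time [Finite K] {R : ℕ} (hR : ∀ n κ, r n κ ≤ R) (κ : K) (k : ℕ) {τ : ℝ≥0}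
    (hτ : (after r σ k).time = τ) :
    (busyTime (fun s => r (countAt r σ s) κ) τ : ℝ≥0∞) = (after r σ k).clock κ := by
  induction k generalizing τ with
  | zero =>
    obtain rfl : τ = 0 := ENNReal.coe_eq_zero.1 hτ.symm
    simp only [busyTime, NNReal.coe_zero, intervalIntegral.integral_same, Real.toNNReal_zero,
      ENNReal.coe_zero, after, Pi.zero_apply]
  | succ k ih =>
    obtain ⟨htime, hgap⟩ := ENNReal.add_ne_top.1 (hτ.trans_ne ENNReal.coe_ne_top)
    obtain ⟨τ₀, hτ₀⟩ : ∃ τ₀ : ℝ≥0, ↑τ₀ = (after r σ k).time := ⟨_, ENNReal.coe_toNNReal htime⟩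
    obtain ⟨d, hd⟩ : ∃ d : ℝ≥0, ↑d = (after r σ k).gap r σ := ⟨_, ENNReal.coe_toNNReal hgap⟩
    have hτd : τ = τ₀ + d := by
      rw [← ENNReal.coe_inj, ← hτ, ENNReal.coe_add, hτ₀, hd]
      rfl
    rw [hτd, hex.busyTime_time_add hR κ hτ₀.symm hd.le]
    push_cast
    rw [ih hτ₀.symm, hd]
    rfl

lemma count_eq_countAt [Finite K] (hσ : ∀ κ, IsClock (σ κ) (N κ)) {R : ℕ}
    (hR : ∀ n κ, r n κ ≤ R) (κ : K) (t : ℝ≥0) :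
    N κ (busyTime (fun s => r (countAt r σ s) κ) t) = countAt r σ t κ := by
  set k := index r σ t with hk
  have htime : (after r σ k).time ≠ ⊤ := ne_top_of_le_ne_top ENNReal.coe_ne_top (time_index_le t)
  have hcons : (after r σ k).IsConsistent σ := isConsistent_after hσ k htime
  obtain ⟨τ, hτ⟩ : ∃ τ : ℝ≥0, ↑τ = (after r σ k).time := ⟨_, ENNReal.coe_toNNReal htime⟩
  obtain ⟨d, rfl⟩ := exists_add_of_le (ENNReal.coe_le_coe.1 (hτ.trans_le (time_index_le t)))
  have hd : d < (after r σ k).gap r σ := by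
    have hlt := hex.lt_time_index (τ + d)
    rw [← hk, after, ClockState.next, ← hτ, ENNReal.coe_add] at hlt
    exact lt_of_add_lt_add_left hlt
  have hbusy : (busyTime (fun s => r (countAt r σ s) κ) (τ + d) : ℝ≥0∞)
      = (after r σ k).reading r d κ := by
    rw [hex.busyTime_time_add hR κ hτ.symm hd.le]
    push_cast
    rw [hex.coe_busyTime_time hR κ k hτ.symm, reading]
  refine hcons.count_eq (hσ κ) ?_ ?_
  · exact hbusy ▸ le_self_add
  · exact hbusy ▸ hcons.reading_lt κ hd

end IsNonexplosive

lemma countAt_invariant (hσ : ∀ κ, IsClock (σ κ) (N κ)) {p : (K → ℕ) → Prop} (h0 : p 0)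
    (hstep : ∀ n n' : K → ℕ, p n → (∀ κ, n' κ = n κ ∨ n' κ = n κ + 1 ∧ 0 < r n κ) → p n')
    (t : ℝ≥0) : p (countAt r σ t) := by
  have hafter : ∀ k, (after r σ k).time ≠ ⊤ → p (after r σ k).count := by
    intro k
    induction k with
    | zero => exact fun _ => h0
    | succ k ih =>
      intro hk
      have htime := (ENNReal.add_ne_top.1 hk).1
      refine hstep _ _ (ih htime) fun κ => ?_
      simp only [after, next]
      split_ifs with hκ
      · exact .inr ⟨rfl, (isConsistent_after hσ k htime).speed_pos hκ⟩
      · exact .inl rfl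
  exact hafter _ (ne_top_of_le_ne_top ENNReal.coe_ne_top (time_index_le t))

section Measurability

variable {Ω : Type*} [MeasurableSpace Ω] [Countable K] [Countable (K → ℕ)] {σ : K → ℕ → Ω → ℝ≥0∞}

lemma measurable_after (hσ : ∀ κ m, Measurable (σ κ m)) (k : ℕ) :
    (∀ κ, Measurable fun ω => (after r (σ · · ω) k).clock κ) ∧
      (Measurable fun ω => (after r (σ · · ω) k).count) ∧
      Measurable fun ω => (after r (σ · · ω) k).time := by
  induction k with
  | zero => exact ⟨fun _ => measurable_const, measurable_const, measurable_const⟩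
  | succ k ih =>
    obtain ⟨hclock, hcount, htime⟩ := ih
    have hcountκ : ∀ κ, Measurable fun ω => (after r (σ · · ω) k).count κ := fun κ =>
      (measurable_pi_apply κ).comp hcount
    have hspeed : ∀ κ, Measurable fun ω => (r (after r (σ · · ω) k).count κ : ℝ≥0∞) := fun κ =>
      (measurable_of_countable fun n => (r n κ : ℝ≥0∞)).comp hcount
    have hring : ∀ κ, Measurable fun ω => σ κ ((after r (σ · · ω) k).count κ) ω := fun κ =>
      (measurable_from_prod_countable_right (f := fun p : ℕ × Ω => σ κ p.1 p.2)
        fun m => hσ κ m).comp ((hcountκ κ).prodMk measurable_id)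
    have hgap : Measurable fun ω => (after r (σ · · ω) k).gap r (σ · · ω) :=
      Measurable.iInf fun κ => ((hring κ).sub (hclock κ)).div (hspeed κ)
    have hreading : ∀ κ, Measurable fun ω =>
        (after r (σ · · ω) k).reading r ((after r (σ · · ω) k).gap r (σ · · ω)) κ := fun κ =>
      (hclock κ).add ((hspeed κ).mul hgap)
    exact ⟨hreading, measurable_pi_lambda _ fun κ => Measurable.ite
      (measurableSet_le (hring κ) (hreading κ)) ((hcountκ κ).add_const 1) (hcountκ κ),
      htime.add hgap⟩

lemma measurable_countAt_apply (hσ : ∀ κ m, Measurable (σ κ m))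
    (hex : ∀ ω, IsNonexplosive r (σ · · ω)) (t : ℝ≥0) :
    Measurable fun ω => countAt r (σ · · ω) t := by
  have hindex : Measurable fun ω => index r (σ · · ω) t := by
    refine measurable_of_Iic fun k => ?_
    simp only [preimage, mem_Iic, (hex _).index_le_iff]
    exact measurableSet_lt measurable_const (measurable_after hσ (k + 1)).2.2
  exact measurable_from_prod_countable_right
    (f := fun p : ℕ × Ω => (after r (σ · · p.2) p.1).count)
    (fun k => (measurable_after hσ k).2.1) |>.comp (hindex.prodMk measurable_id)

end Measurability

end ClockState

open ClockState in
theorem exists_timeChanged_count {Ω K : Type*} [MeasurableSpace Ω] [Finite K]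
    {r : (K → ℕ) → K → ℕ} {R : ℕ} (hR : ∀ n κ, r n κ ≤ R) {N : K → ℝ≥0 → Ω → ℕ}
    {σ : K → ℕ → Ω → ℝ≥0∞} (hσ : ∀ κ m, Measurable (σ κ m))
    (hN : ∀ ω κ, IsClock (σ κ · ω) (N κ · ω))
    {p : (K → ℕ) → Prop} (h0 : p 0)
    (hstep : ∀ n n' : K → ℕ, p n → (∀ κ, n' κ = n κ ∨ n' κ = n κ + 1 ∧ 0 < r n κ) → p n') :
    ∃ C : ℝ≥0 → Ω → K → ℕ, (∀ t, Measurable (C t)) ∧ (∀ ω, Measurable fun t => C t ω) ∧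
      (∀ ω t, ContinuousWithinAt (fun s => C s ω) (Ici t) t) ∧
      (∀ ω t κ, C t ω κ = N κ (busyTime (fun s => r (C s ω) κ) t) ω) ∧ ∀ ω t, p (C t ω) := by
  have hex : ∀ ω, IsNonexplosive r (σ · · ω) := fun ω => isNonexplosive_of_speed_le (hN ω) hR
  exact ⟨fun t ω => countAt r (σ · · ω) t, measurable_countAt_apply hσ hex,
    fun ω => (hex ω).measurable_countAt, fun ω => (hex ω).continuousWithinAt_countAt,
    fun ω t κ => ((hex ω).count_eq_countAt (hN ω) hR κ t).symm,
    fun ω => countAt_invariant (hN ω) h0 hstep⟩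

end Clocks

section MaximalInequality

open Finset

variable {Ω : Type*} [MeasurableSpace Ω] {P : Measure Ω} [IsProbabilityMeasure P] {X : ℕ → Ω → ℝ}

lemma submartingale_sq_sum (hX : ∀ k, Measurable (X k)) (hindep : iIndepFun X P)
    (hL : ∀ k, MemLp (X k) 2 P) (hmean : ∀ k, P[X k] = 0) :
    Submartingale (fun n ω => (∑ k ∈ range (n + 1), X k ω) ^ 2)
      (Filtration.natural X fun k => (hX k).stronglyMeasurable) P := by
  set 𝒢 := Filtration.natural X fun k => (hX k).stronglyMeasurable
  have hadapted : ∀ n, StronglyMeasurable[𝒢 n] fun ω => ∑ k ∈ range (n + 1), X k ω := fun n =>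
    stronglyMeasurable_fun_sum _ fun k hk =>
      (Filtration.stronglyAdapted_natural (fun k => (hX k).stronglyMeasurable) k).mono
        (𝒢.mono (Nat.lt_succ_iff.1 (mem_range.1 hk)))
  have hSL : ∀ n, MemLp (fun ω => ∑ k ∈ range (n + 1), X k ω) 2 P := fun n =>
    memLp_finsetSum _ fun k _ => hL k
  refine submartingale_of_setIntegral_le_succ (fun n => (hadapted n).pow 2)
    (fun n => (hSL n).integrable_sq) fun n s hs => ?_
  set Z : Ω → ℝ := s.indicator fun ω => ∑ k ∈ range (n + 1), X k ω with hZ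
  have hsm : MeasurableSet s := 𝒢.le n s hs
  have hZL : MemLp Z 2 P := (hSL n).indicator hsm
  have hZX : Integrable (fun ω => 2 * (Z ω * X (n + 1) ω)) P :=
    (hZL.integrable_mul (hL _)).const_mul 2
  have hcross : ∫ ω, 2 * (Z ω * X (n + 1) ω) ∂P = 0 := by
    have hind : IndepFun Z (X (n + 1)) P := by
      rw [IndepFun_iff_Indep]
      exact indep_of_indep_of_le_left (hindep.indep_comap_natural_of_lt
        (fun k => (hX k).stronglyMeasurable) n.lt_succ_self).symm
        ((hadapted n).indicator hs).measurable.comap_le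
    rw [integral_const_mul, hind.integral_fun_mul_eq_mul_integral hZL.aestronglyMeasurable
      (hL _).aestronglyMeasurable, hmean, mul_zero, mul_zero]
  have hsq := (hSL n).integrable_sq.indicator hsm
  rw [← integral_indicator hsm, ← integral_indicator hsm, ← add_zero (integral _ _), ← hcross,
    ← integral_add hsq hZX]
  refine integral_mono (hsq.add hZX) ((hSL (n + 1)).integrable_sq.indicator hsm) fun ω => ?_
  by_cases hω : ω ∈ s
  · simp only [hZ, Set.indicator_of_mem hω, sum_range_succ _ (n + 1)]
    nlinarith [sq_nonneg (X (n + 1) ω)]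
  · simp only [hZ, Set.indicator_of_notMem hω, zero_mul, mul_zero, add_zero, le_refl]

lemma measure_exists_le_abs_sum_le (hX : ∀ k, Measurable (X k)) (hindep : iIndepFun X P)
    (hL : ∀ k, MemLp (X k) 2 P) (hmean : ∀ k, P[X k] = 0) (n : ℕ) {a : ℝ} (ha : 0 < a) :
    P {ω | ∃ k ≤ n, a ≤ |∑ j ∈ range k, X j ω|}
      ≤ ENNReal.ofReal ((∑ k ∈ range n, Var[X k; P]) / a ^ 2) := by
  rcases n with _ | n
  · simp [ha.not_ge]
  set A := {ω | a ^ 2 ≤ (range (n + 1)).sup' nonempty_range_add_one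
    fun k => (∑ j ∈ range (k + 1), X j ω) ^ 2} with hA
  have hsub : {ω | ∃ k ≤ n + 1, a ≤ |∑ j ∈ range k, X j ω|} ⊆ A := by
    rintro ω ⟨_ | k, hk, hka⟩
    · exact absurd hka (by simpa using ha)
    · simp only [hA, Set.mem_ofPred_eq, le_sup'_iff, mem_range]
      exact ⟨k, hk, by rw [← sq_abs (∑ j ∈ range (k + 1), X j ω)]; gcongr⟩
  have hvar : ∫ ω, (∑ k ∈ range (n + 1), X k ω) ^ 2 ∂P = ∑ k ∈ range (n + 1), Var[X k; P] := by
    rw [← IndepFun.variance_sum (fun k _ => hL k) fun i _ j _ hij => hindep.indepFun hij,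
      variance_of_integral_eq_zero (aemeasurable_sum _ fun k _ => (hX k).aemeasurable)]
    · simp only [Finset.sum_apply]
    · simp only [Finset.sum_apply, integral_finsetSum _ fun k _ => (hL k).integrable one_le_two,
        hmean, sum_const_zero]
  have hint : ∫ ω in A, (∑ k ∈ range (n + 1), X k ω) ^ 2 ∂P ≤ ∑ k ∈ range (n + 1), Var[X k; P] :=
    hvar ▸ setIntegral_le_integral (memLp_finsetSum _ fun k _ => hL k).integrable_sq
      (Eventually.of_forall fun ω => sq_nonneg _)
  have hmax := maximal_ineq (submartingale_sq_sum hX hindep hL hmean) (fun _ _ => sq_nonneg _)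
    (ε := (a ^ 2).toNNReal) n
  rw [Real.coe_toNNReal _ (sq_nonneg a), ← hA] at hmax
  rw [ENNReal.ofReal_div_of_pos (by positivity), ENNReal.le_div_iff_mul_le
    (.inl (by simpa using ha.ne')) (.inl ENNReal.ofReal_ne_top), mul_comm]
  calc ENNReal.ofReal (a ^ 2) * P {ω | ∃ k ≤ n + 1, a ≤ |∑ j ∈ range k, X j ω|}
      ≤ ENNReal.ofReal (a ^ 2) * P A := by gcongr
    _ ≤ _ := hmax.trans (ENNReal.ofReal_le_ofReal hint)

lemma measure_exists_le_abs_sum_sub_le (hX : ∀ k, Measurable (X k)) (hindep : iIndepFun X P)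
    (hident : ∀ k, IdentDistrib (X k) (X 0) P P) (hL : MemLp (X 0) 2 P) (n : ℕ) {a : ℝ}
    (ha : 0 < a) :
    P {ω | ∃ k ≤ n, a ≤ |∑ j ∈ range k, X j ω - k * P[X 0]|}
      ≤ ENNReal.ofReal (n * Var[X 0; P] / a ^ 2) := by
  have hLX : ∀ k, MemLp (X k) 2 P := fun k => (hident k).memLp_iff.2 hL
  have hcentred : ∀ k, ∫ ω, (X k ω - P[X 0]) ∂P = 0 := fun k => by
    rw [integral_sub ((hLX k).integrable one_le_two) (integrable_const _), (hident k).integral_eq,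
      integral_const, probReal_univ, one_smul, sub_self]
  have hvar : ∀ k, Var[fun ω => X k ω - P[X 0]; P] = Var[X 0; P] := fun k => by
    rw [variance_sub_const (hX k).aestronglyMeasurable, (hident k).variance_eq]
  have hmax := measure_exists_le_abs_sum_le (X := fun k ω => X k ω - P[X 0])
    (fun k => (hX k).sub_const _)
    (hindep.comp (fun _ x => x - ∫ ω, X 0 ω ∂P) fun _ => measurable_id.sub_const _)
    (fun k => (hLX k).sub (memLp_const _)) hcentred n ha
  simpa only [hvar, sum_sub_distrib, sum_const, card_range, nsmul_eq_mul] using hmax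

end MaximalInequality

section Poisson

lemma hasSum_descFactorial_poisson (r : ℝ≥0) (m : ℕ) :
    HasSum (fun k : ℕ => Real.exp (-r) * r ^ k / k.factorial * k.descFactorial m) (r ^ m) := by
  have hzero : ∑ k ∈ Finset.range m,
      Real.exp (-r) * (r : ℝ) ^ k / k.factorial * k.descFactorial m = 0 :=
    Finset.sum_eq_zero fun k hk => by
      rw [Nat.descFactorial_eq_zero_iff_lt.2 (Finset.mem_range.1 hk), Nat.cast_zero, mul_zero]
  rw [← hasSum_nat_add_iff' m, hzero, sub_zero, ← mul_one ((r : ℝ) ^ m)]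
  refine ((hasSum_one_poissonMeasure r).mul_left ((r : ℝ) ^ m)).congr_fun fun k => ?_
  rw [← Nat.factorial_mul_descFactorial (Nat.le_add_left m k), Nat.add_sub_cancel]
  have hk : ((k + m).descFactorial m : ℝ) ≠ 0 :=
    Nat.cast_ne_zero.2 fun h => by rw [Nat.descFactorial_eq_zero_iff_lt] at h; lia
  push_cast
  field_simp
  ring

lemma integrable_descFactorial_poissonMeasure (r : ℝ≥0) (m : ℕ) :
    Integrable (fun k : ℕ => (k.descFactorial m : ℝ)) (poissonMeasure r) := by
  rw [integrable_poissonMeasure_iff]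
  simpa only [Real.norm_natCast] using (hasSum_descFactorial_poisson r m).summable

lemma integral_descFactorial_poissonMeasure (r : ℝ≥0) (m : ℕ) :
    ∫ k, (k.descFactorial m : ℝ) ∂poissonMeasure r = r ^ m := by
  simpa only [integral_poissonMeasure, smul_eq_mul] using
    (hasSum_descFactorial_poisson r m).tsum_eq

lemma poissonMeasure_setOf_le_le (r : ℝ≥0) (m : ℕ) :
    poissonMeasure r {k | m ≤ k} ≤ ENNReal.ofReal (r ^ m) := by
  have hsub : {k : ℕ | m ≤ k} = {k : ℕ | (1 : ℝ) ≤ k.descFactorial m} := by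
    ext k
    simp only [Set.mem_ofPred_eq, Nat.one_le_cast, Nat.one_le_iff_ne_zero, ne_eq,
      Nat.descFactorial_eq_zero_iff_lt, not_lt]
  have hmarkov := mul_meas_ge_le_integral_of_nonneg
    (Eventually.of_forall fun _ => Nat.cast_nonneg _)
    (integrable_descFactorial_poissonMeasure r m) 1
  rw [one_mul, integral_descFactorial_poissonMeasure, ← hsub] at hmarkov
  exact (ENNReal.le_ofReal_iff_toReal_le (measure_ne_top _ _) (by positivity)).2 hmarkov

lemma sq_eq_descFactorial_add (k : ℕ) : (k : ℝ) ^ 2 = k.descFactorial 2 + k.descFactorial 1 := by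
  rcases k with _ | k
  · simp
  · simp only [Nat.descFactorial_succ, Nat.descFactorial_zero, Nat.add_sub_cancel, Nat.sub_zero]
    push_cast
    ring

lemma memLp_natCast_poissonMeasure (r : ℝ≥0) :
    MemLp (fun k : ℕ => (k : ℝ)) 2 (poissonMeasure r) := by
  rw [memLp_two_iff_integrable_sq (by fun_prop)]
  simp only [sq_eq_descFactorial_add]
  exact (integrable_descFactorial_poissonMeasure r 2).add
    (integrable_descFactorial_poissonMeasure r 1)

lemma integral_natCast_poissonMeasure (r : ℝ≥0) : ∫ k, (k : ℝ) ∂poissonMeasure r = r := by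
  simpa only [Nat.descFactorial_one, pow_one] using integral_descFactorial_poissonMeasure r 1

lemma variance_natCast_poissonMeasure (r : ℝ≥0) :
    Var[fun k : ℕ => (k : ℝ); poissonMeasure r] = r := by
  rw [variance_eq_sub (memLp_natCast_poissonMeasure r)]
  simp only [Pi.pow_apply, sq_eq_descFactorial_add]
  rw [integral_add (integrable_descFactorial_poissonMeasure r 2)
    (integrable_descFactorial_poissonMeasure r 1), integral_descFactorial_poissonMeasure,
    integral_descFactorial_poissonMeasure, integral_natCast_poissonMeasure]
  ring

end Poisson

section Poisson

variable {Ω : Type*} [MeasurableSpace Ω] {P : Measure Ω} {N : ℝ≥0 → Ω → ℕ} {r : ℝ≥0}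

lemma abs_sub_mul_le_of_forall_nat {N : ℝ≥0 → ℕ} (hN : Monotone N) {r : ℝ≥0} {a : ℝ} {L : ℕ}
    (h : ∀ k ≤ L, |(N k : ℝ) - k * r| ≤ a) {u : ℝ≥0} (hu : (u : ℝ) + 1 ≤ L) :
    |(N u : ℝ) - r * u| ≤ a + r := by
  have hfloor : (⌊u⌋₊ : ℝ) ≤ u := NNReal.coe_le_coe.2 (Nat.floor_le zero_le)
  have hlt : (u : ℝ) ≤ ⌊u⌋₊ + 1 := NNReal.coe_le_coe.2 (Nat.lt_floor_add_one u).le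
  have hL : ⌊u⌋₊ + 1 ≤ L := by
    have : (⌊u⌋₊ : ℝ) + 1 ≤ L := by linarith
    exact_mod_cast this
  have hlow := (abs_le.1 (h ⌊u⌋₊ (by lia))).1
  have hupp := (abs_le.1 (h (⌊u⌋₊ + 1) hL)).2
  have hmono_low : (N ⌊u⌋₊ : ℝ) ≤ N u := Nat.cast_le.2 (hN (Nat.floor_le zero_le))
  have hmono_upp : (N u : ℝ) ≤ N (⌊u⌋₊ + 1 : ℕ) :=
    Nat.cast_le.2 (hN (by exact_mod_cast (Nat.lt_floor_add_one u).le))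
  push_cast at hupp hmono_upp
  rw [abs_le]
  constructor <;> nlinarith [r.2]

lemma IsPoissonProcess.hasLaw_sub (h : IsPoissonProcess N r P) {s t : ℝ≥0} (hst : s ≤ t) :
    HasLaw (fun ω => N t ω - N s ω) (poissonMeasure (r * (t - s))) P where
  aemeasurable := (measurable_of_countable (fun p : ℕ × ℕ => p.1 - p.2)).comp_aemeasurable
    ((h.measurable t).prodMk (h.measurable s)).aemeasurable
  map_eq := h.law s t hst

lemma IsPoissonProcess.fluctuation_le [IsProbabilityMeasure P] (h : IsPoissonProcess N r P)
    (L : ℕ) {a : ℝ} (ha : 0 < a) :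
    P {ω | ¬ ∀ u : ℝ≥0, (u : ℝ) + 1 ≤ L → |(N u ω : ℝ) - r * u| ≤ a + r}
      ≤ ENNReal.ofReal (L * r / a ^ 2) := by
  set D : ℕ → Ω → ℕ := fun k ω => N ((k + 1 : ℕ) : ℝ≥0) ω - N (k : ℝ≥0) ω with hD
  have hcast : Measurable (Nat.cast : ℕ → ℝ) := .of_discrete
  have hD_meas : ∀ k, Measurable (D k) := fun k =>
    (Measurable.of_discrete (f := fun p : ℕ × ℕ => p.1 - p.2)).comp
      ((h.measurable _).prodMk (h.measurable _))
  have hlaw : ∀ k, HasLaw (D k) (poissonMeasure r) P := fun k => by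
    simpa [hD] using h.hasLaw_sub (Nat.cast_le (α := ℝ≥0).2 k.le_succ)
  have hmean : ∫ ω, (D 0 ω : ℝ) ∂P = r :=
    ((hlaw 0).integral_comp hcast.aestronglyMeasurable).trans (integral_natCast_poissonMeasure r)
  have hvar : Var[fun ω => (D 0 ω : ℝ); P] = r := by
    rw [← variance_natCast_poissonMeasure r, ← (hlaw 0).map_eq,
      variance_map hcast.aemeasurable (hlaw 0).aemeasurable]
    rfl
  have hmax := measure_exists_le_abs_sum_sub_le (P := P) (X := fun k ω => (D k ω : ℝ))
    (fun k => hcast.comp (hD_meas k))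
    ((h.indep_increments.nat (t := fun k : ℕ => (k : ℝ≥0)) Nat.mono_cast).comp
      (fun _ m => (m : ℝ)) fun _ => hcast)
    (fun k => ((hlaw k).identDistrib (hlaw 0)).comp hcast)
    ((memLp_map_measure_iff hcast.aestronglyMeasurable (hlaw 0).aemeasurable).1
      ((hlaw 0).map_eq ▸ memLp_natCast_poissonMeasure r)) L ha
  rw [hmean, hvar] at hmax
  refine (measure_mono_ae ?_).trans hmax
  filter_upwards [h.paths] with ω ⟨h0, hmono, _⟩ hω
  by_contra hnear
  refine hω fun u hu => abs_sub_mul_le_of_forall_nat hmono (fun k hk => ?_) hu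
  have hsum : ∑ j ∈ Finset.range k, D j ω = N k ω := by
    rw [Finset.sum_range_tsub (f := fun k : ℕ => N k ω) fun _ _ hij => hmono (Nat.mono_cast hij)]
    simp only [Nat.cast_zero, h0, Nat.sub_zero]
  rw [← hsum, Nat.cast_sum]
  exact (not_le.1 fun hle => hnear ⟨k, hk, hle⟩).le

lemma exists_eq_of_forall_succ_le {g : ℕ → ℕ} (h0 : g 0 = 0) {n : ℕ}
    (h : ∀ k < n, g (k + 1) ≤ g k + 1) {m : ℕ} (hm : m ≤ g n) : ∃ k ≤ n, g k = m := by
  induction n with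
  | zero => exact ⟨0, le_rfl, by lia⟩
  | succ n ih =>
    by_cases hle : m ≤ g n
    · obtain ⟨k, hk, hkm⟩ := ih (fun k hk => h k (by lia)) hle
      exact ⟨k, by lia, hkm⟩
    · exact ⟨n + 1, le_rfl, by have := h n n.lt_succ_self; lia⟩

lemma IsPoissonProcess.measure_exists_two_le_sub_le (h : IsPoissonProcess N r P) (M n : ℕ) :
    P {ω | ∃ k < M * (n + 1), 2 ≤ N ((k + 1 : ℕ) / (n + 1)) ω - N (k / (n + 1)) ω}
      ≤ ENNReal.ofReal (M * r ^ 2 / (n + 1)) := by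
  have hincrement : ∀ k : ℕ, P {ω | 2 ≤ N ((k + 1 : ℕ) / (n + 1)) ω - N (k / (n + 1)) ω}
      ≤ ENNReal.ofReal ((r / (n + 1)) ^ 2) := fun k => by
    have hlaw := h.hasLaw_sub (s := k / (n + 1)) (t := (k + 1 : ℕ) / (n + 1))
      (by gcongr; exact k.le_succ)
    rw [← NNReal.sub_div, Nat.cast_succ, add_tsub_cancel_left, mul_one_div] at hlaw
    rw [Nat.cast_succ]
    refine (hlaw.measure_eq (.of_discrete (s := {d : ℕ | 2 ≤ d}))).trans_le ?_
    simpa using poissonMeasure_setOf_le_le (r / (n + 1)) 2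
  have hunion : {ω | ∃ k < M * (n + 1), 2 ≤ N ((k + 1 : ℕ) / (n + 1)) ω - N (k / (n + 1)) ω}
      = ⋃ k ∈ Finset.range (M * (n + 1)),
        {ω | 2 ≤ N ((k + 1 : ℕ) / (n + 1)) ω - N (k / (n + 1)) ω} := by
    ext ω
    simp
  calc _ ≤ ∑ k ∈ Finset.range (M * (n + 1)), ENNReal.ofReal ((r / (n + 1)) ^ 2) := by
        rw [hunion]
        exact (measure_biUnion_finset_le _ _).trans (Finset.sum_le_sum fun k _ => hincrement k)
    _ = ENNReal.ofReal (M * r ^ 2 / (n + 1)) := by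
        rw [Finset.sum_const, Finset.card_range, nsmul_eq_mul, ← ENNReal.ofReal_natCast,
          ← ENNReal.ofReal_mul (by positivity)]
        congr 1
        push_cast
        field_simp

lemma IsPoissonProcess.ae_attains (h : IsPoissonProcess N r P) :
    ∀ᵐ ω ∂P, ∀ u m, m ≤ N u ω → ∃ v, N v ω = m := by
  have hunit : ∀ M : ℕ, ∀ᵐ ω ∂P, ∃ n : ℕ, ∀ k < M * (n + 1),
      N ((k + 1 : ℕ) / (n + 1)) ω - N (k / (n + 1)) ω < 2 := fun M => by
    have hlim : Tendsto (fun n : ℕ => ENNReal.ofReal (M * r ^ 2 / (n + 1))) atTop (𝓝 0) := by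
      rw [← ENNReal.ofReal_zero]
      exact ENNReal.tendsto_ofReal (tendsto_const_nhds.div_atTop
        (tendsto_atTop_add_const_right _ _ tendsto_natCast_atTop_atTop))
    rw [ae_iff]
    refine le_antisymm (ge_of_tendsto' hlim fun n => ?_) zero_le
    refine (measure_mono fun ω hω => ?_).trans (h.measure_exists_two_le_sub_le M n)
    simp only [Set.mem_ofPred_eq] at hω
    push Not at hω
    exact hω n
  filter_upwards [ae_all_iff.2 hunit, h.paths] with ω hω ⟨h0, hmono, _⟩ u m hm
  obtain ⟨M, hM⟩ := exists_nat_ge u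
  obtain ⟨n, hn⟩ := hω M
  have hend : ((M * (n + 1) : ℕ) : ℝ≥0) / (n + 1) = M := by
    push_cast
    field_simp
  obtain ⟨k, -, hk⟩ := exists_eq_of_forall_succ_le (g := fun k => N (k / (n + 1)) ω)
    (n := M * (n + 1)) (by simpa using h0) (fun k hk => by have := hn k hk; lia)
    (hm.trans (by rw [hend]; exact hmono hM))
  exact ⟨_, hk⟩

end Poisson

section Clocks

/-- The ringing times of a clock, read off from the numbers `N u` of its rings. -/
noncomputable def ringTime (N : ℝ≥0 → ℕ) (m : ℕ) : ℝ≥0∞ := ⨅ (u : ℝ≥0) (_ : m < N u), (u : ℝ≥0∞)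

lemma ringTime_le_iff {N : ℝ≥0 → ℕ} (hmono : Monotone N)
    (hcont : ∀ t, ContinuousWithinAt N (Set.Ici t) t) (m : ℕ) (u : ℝ≥0) :
    ringTime N m ≤ u ↔ m < N u := by
  refine ⟨fun hle => ?_, fun hlt => iInf₂_le u hlt⟩
  by_contra! hNu
  have hev : ∀ᶠ s in 𝓝[≥] u, N s = N u := (hcont u).eventually (p := (· = N u)) (by simp)
  obtain ⟨v, huv, hv⟩ := (mem_nhdsGE_iff_exists_Ico_subset).1 hev
  have hvm : (v : ℝ≥0∞) ≤ ringTime N m := le_iInf₂ fun w hw => by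
    by_contra! hwv
    rw [ENNReal.coe_lt_coe] at hwv
    rcases lt_or_ge w u with hwu | hwu
    · exact (hw.trans_le ((hmono hwu.le).trans hNu)).false
    · have : N w = N u := hv ⟨hwu, hwv⟩
      lia
  exact (hvm.trans hle).not_gt (ENNReal.coe_lt_coe.2 huv)

lemma isClock_ringTime {N : ℝ≥0 → ℕ} (h0 : N 0 = 0) (hmono : Monotone N)
    (hcont : ∀ t, ContinuousWithinAt N (Set.Ici t) t) (hatt : ∀ u m, m ≤ N u → ∃ v, N v = m) :
    IsClock (ringTime N) N where
  le_iff := ringTime_le_iff hmono hcont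
  pos := not_le.1 fun hle => by
    have := (ringTime_le_iff hmono hcont 0 0).1 (by simpa using hle)
    lia
  lt_succ m hm := by
    lift ringTime N m to ℝ≥0 using hm with u hu
    refine not_le.1 fun hle => ?_
    rw [ringTime_le_iff hmono hcont] at hle
    obtain ⟨v, hv⟩ := hatt u (m + 1) hle.le
    have huv : ringTime N m ≤ v := (ringTime_le_iff hmono hcont m v).2 (by lia)
    rw [← hu, ENNReal.coe_le_coe] at huv
    have := hmono huv
    lia

lemma isClock_top_zero : IsClock (fun _ => ⊤) fun _ => 0 where
  le_iff := by simp
  pos := ENNReal.zero_lt_top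
  lt_succ _ h := absurd rfl h

variable {Ω : Type*} [MeasurableSpace Ω] {P : Measure Ω}

lemma IsClock.aemeasurable {σ : ℕ → Ω → ℝ≥0∞} {N : ℝ≥0 → Ω → ℕ} (hN : ∀ u, Measurable (N u))
    (h : ∀ᵐ ω ∂P, IsClock (σ · ω) (N · ω)) (m : ℕ) : AEMeasurable (σ m) P := by
  refine NullMeasurable.aemeasurable (measurable_of_Iic (δ := NullMeasurableSpace Ω P) fun a => ?_)
  rcases eq_or_ne a ⊤ with rfl | ha
  · rw [Set.Iic_top]
    exact MeasurableSet.univ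
  · lift a to ℝ≥0 using ha
    have hset : MeasurableSet {ω | m < N a ω} := measurableSet_lt measurable_const (hN a)
    refine hset.nullMeasurableSet.congr (eventuallyEq_set.2 ?_)
    filter_upwards [h] with ω hω
    exact (hω.le_iff m a).symm

lemma IsPoissonProcess.ae_isClock_ringTime {N : ℝ≥0 → Ω → ℕ} {r : ℝ≥0}
    (h : IsPoissonProcess N r P) : ∀ᵐ ω ∂P, IsClock (ringTime (N · ω)) (N · ω) := by
  filter_upwards [h.paths, h.ae_attains] with ω ⟨h0, hmono, hcont⟩ hatt
  exact isClock_ringTime h0 hmono hcont hatt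

end Clocks

section Arrivals

/-- The properties of a sequence of interarrival times which make the number of arrivals a counting
path. -/
structure IsRenewalPath (u : ℕ → ℝ) : Prop where
  pos : ∀ k, 0 < u k
  tendsto_sum : Tendsto (fun l => ∑ k ∈ Finset.range l, u k) atTop atTop

lemma IsRenewalPath.strictMono {u : ℕ → ℝ} (h : IsRenewalPath u) :
    StrictMono fun l => ∑ k ∈ Finset.range l, u k :=
  strictMono_nat_of_lt_succ fun l => by
    rw [Finset.sum_range_succ]
    exact lt_add_of_pos_right _ (h.pos l)

variable {I Ω : Type*} {U : I → ℕ → Ω → ℝ} {lam : I → ℝ} {i : I} {ω : Ω}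

lemma IsRenewalPath.le_arrivals_iff (h : IsRenewalPath (U i · ω)) (hlam : 0 < lam i) (t : ℝ≥0)
    (m : ℕ) : m ≤ arrivals U lam i t ω ↔ ∑ k ∈ Finset.range m, U i k ω ≤ lam i * t := by
  have hset : {l : ℕ | ∑ k ∈ Finset.range l, U i k ω / lam i ≤ t}
      = {l : ℕ | ∑ k ∈ Finset.range l, U i k ω ≤ lam i * t} := by
    ext l
    rw [Set.mem_ofPred_eq, Set.mem_ofPred_eq, ← Finset.sum_div, div_le_iff₀' hlam]
  have hbdd : BddAbove {l : ℕ | ∑ k ∈ Finset.range l, U i k ω ≤ lam i * t} := by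
    obtain ⟨L, hL⟩ := (h.tendsto_sum.eventually_gt_atTop (lam i * t)).exists
    exact ⟨L, fun l hl => not_lt.1 fun hlt => (hL.trans (h.strictMono hlt)).not_ge hl⟩
  have hne : {l : ℕ | ∑ k ∈ Finset.range l, U i k ω ≤ lam i * t}.Nonempty :=
    ⟨0, by simp only [Set.mem_ofPred_eq, Finset.range_zero, Finset.sum_empty]; positivity⟩
  rw [arrivals, hset]
  exact ⟨fun hm => (h.strictMono.monotone hm).trans (Nat.sSup_mem hne hbdd),
    fun hm => le_csSup hbdd hm⟩

lemma IsRenewalPath.isClock (h : IsRenewalPath (U i · ω)) (hlam : 0 < lam i) :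
    IsClock (fun m => ENNReal.ofReal ((∑ k ∈ Finset.range (m + 1), U i k ω) / lam i))
      fun t => arrivals U lam i t ω where
  le_iff m t := by
    rw [← Nat.succ_le_iff, h.le_arrivals_iff hlam, ENNReal.ofReal, ENNReal.coe_le_coe,
      Real.toNNReal_le_iff_le_coe, div_le_iff₀' hlam]
  pos := ENNReal.ofReal_pos.2 (div_pos (by simpa using h.pos 0) hlam)
  lt_succ m _ := by
    have hsum := h.strictMono (Nat.lt_succ_self (m + 1))
    refine (ENNReal.ofReal_lt_ofReal_iff (div_pos ?_ hlam)).2 (by gcongr)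
    exact Finset.sum_pos (fun k _ => h.pos k) Finset.nonempty_range_add_one

lemma IsRenewalPath.abs_arrivals_sub_le (h : IsRenewalPath (U i · ω)) (hlam : 0 < lam i) {L : ℕ}
    {a : ℝ} (hnear : ∀ k ≤ L, |∑ j ∈ Finset.range k, U i j ω - k| < a) {t : ℝ≥0}
    (ht : lam i * t + a ≤ L) : |(arrivals U lam i t ω : ℝ) - lam i * t| ≤ a + 1 := by
  set A := arrivals U lam i t ω
  have hle := (h.le_arrivals_iff hlam t A).1 le_rfl
  have hgt : lam i * t < ∑ k ∈ Finset.range (A + 1), U i k ω := by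
    rw [← not_le, ← h.le_arrivals_iff hlam]
    exact A.lt_succ_self.not_ge
  have hAL : A < L := by
    by_contra! hLA
    linarith [h.strictMono.monotone hLA, (abs_lt.1 (hnear L le_rfl)).1]
  have hlow := (abs_lt.1 (hnear A hAL.le)).1
  have hupp := (abs_lt.1 (hnear (A + 1) hAL)).2
  push_cast at hupp
  rw [abs_le]
  constructor <;> linarith

variable [MeasurableSpace Ω] {P : Measure Ω}

/-- The interarrival times of a single class: a sequence of independent identically distributed
random variables, almost surely positive, of mean one and of finite variance. -/
structure IsRenewalSequence (u : ℕ → Ω → ℝ) (P : Measure Ω) : Prop where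
  measurable : ∀ k, Measurable (u k)
  indep : iIndepFun u P
  identDistrib : ∀ k, IdentDistrib (u k) (u 0) P P
  pos : ∀ k, ∀ᵐ ω ∂P, 0 < u k ω
  memLp : MemLp (u 0) 2 P
  mean : ∫ ω, u 0 ω ∂P = 1

lemma IsRenewalInput.isRenewalSequence (hU : IsRenewalInput U P) (i : I) :
    IsRenewalSequence (U i) P where
  measurable := hU.measurable i
  indep := hU.indep.precomp (g := fun k : ℕ => (i, k)) fun _ _ h => (Prod.mk.inj h).2
  identDistrib := hU.identDistrib i
  pos := hU.pos i
  memLp := hU.sq_integrable i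
  mean := hU.mean i

variable [IsProbabilityMeasure P]

lemma IsRenewalSequence.ae_isRenewalPath {u : ℕ → Ω → ℝ} (hu : IsRenewalSequence u P) :
    ∀ᵐ ω ∂P, IsRenewalPath (u · ω) := by
  filter_upwards [ae_all_iff.2 hu.pos, strong_law_ae_real u (hu.memLp.integrable one_le_two)
    (fun k l hkl => hu.indep.indepFun hkl) hu.identDistrib] with ω hpos hlim
  rw [hu.mean] at hlim
  refine ⟨hpos, (hlim.pos_mul_atTop one_pos (tendsto_natCast_atTop_atTop (R := ℝ))).congr' ?_⟩
  filter_upwards [eventually_gt_atTop 0] with l hl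
  field_simp

lemma IsRenewalSequence.fluctuation_le (hu : IsRenewalSequence (U i) P) (hlam : 0 < lam i) (L : ℕ)
    {a : ℝ} (ha : 0 < a) :
    P {ω | ¬ ∀ t : ℝ≥0, lam i * t + a ≤ L → |(arrivals U lam i t ω : ℝ) - lam i * t| ≤ a + 1}
      ≤ ENNReal.ofReal (L * Var[U i 0; P] / a ^ 2) := by
  have hmax := measure_exists_le_abs_sum_sub_le hu.measurable hu.indep hu.identDistrib hu.memLp L ha
  simp only [hu.mean, mul_one] at hmax
  refine (measure_mono_ae ?_).trans hmax
  filter_upwards [hu.ae_isRenewalPath] with ω hpath hω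
  by_contra hnear
  exact hω fun t ht => hpath.abs_arrivals_sub_le hlam
    (fun k hk => not_le.1 fun hle => hnear ⟨k, hk, hle⟩) ht

end Arrivals

section Existence

variable {Ω : Type*} [MeasurableSpace Ω] {P : Measure Ω}

open Classical in
lemma exists_isClock_modification {K : Type*} [Countable K] {N : K → ℝ≥0 → Ω → ℕ}
    {σ : K → ℕ → Ω → ℝ≥0∞} (hσ : ∀ κ m, AEMeasurable (σ κ m) P)
    (hN : ∀ᵐ ω ∂P, ∀ κ, IsClock (σ κ · ω) (N κ · ω)) :
    ∃ (σ' : K → ℕ → Ω → ℝ≥0∞) (N' : K → ℝ≥0 → Ω → ℕ), (∀ κ m, Measurable (σ' κ m)) ∧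
      (∀ ω κ, IsClock (σ' κ · ω) (N' κ · ω)) ∧ ∀ᵐ ω ∂P, ∀ κ t, N' κ t ω = N κ t ω := by
  have hae : ∀ᵐ ω ∂P, ∀ κ, IsClock (fun m => (hσ κ m).mk _ ω) (N κ · ω) := by
    filter_upwards [hN, ae_all_iff.2 fun κ => ae_all_iff.2 fun m => (hσ κ m).ae_eq_mk] with ω hω hmk
    intro κ
    simpa only [hmk] using hω κ
  obtain ⟨G, hG, hGm, hGP⟩ := hae.exists_measurable_mem
  refine ⟨fun κ m => G.piecewise ((hσ κ m).mk _) fun _ => ⊤,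
    fun κ t => G.piecewise (N κ t) fun _ => 0,
    fun κ m => (hσ κ m).measurable_mk.piecewise hGm measurable_const, fun ω κ => ?_, ?_⟩
  · by_cases hω : ω ∈ G
    · simpa only [Set.piecewise_eq_of_mem _ _ _ hω] using hGP ω hω κ
    · simpa only [Set.piecewise_eq_of_notMem _ _ _ hω] using isClock_top_zero
  · filter_upwards [hG] with ω hω κ t using Set.piecewise_eq_of_mem _ _ _ hω

variable {I J : Type*} [Fintype J]

lemma busyTime_one (t : ℝ≥0) : busyTime (fun _ => 1) t = t := by
  simp only [busyTime, Nat.cast_one, intervalIntegral.integral_const, smul_eq_mul, mul_one,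
    sub_zero, Real.toNNReal_coe]

/-- The numbers of customers in the system, as a function of the numbers of arrivals (left summand)
and of service completions (right summand). Natural subtraction is harmless as long as no class has
had more completions than customers. -/
def population (init : I → ℕ) (n : I ⊕ I × J → ℕ) (i : I) : ℕ :=
  init i + n (.inl i) - ∑ j, n (.inr (i, j))

/-- The speeds of the arrival clocks and of the service clocks under the feedback `f`. -/
def clockSpeed (init : I → ℕ) (f : (I → ℕ) → I → J → ℕ) (n : I ⊕ I × J → ℕ) : I ⊕ I × J → ℕ
  | .inl _ => 1
  | .inr (i, j) => f (population init n) i j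

lemma sum_completions_le_of_step {init : I → ℕ} {f : (I → ℕ) → I → J → ℕ}
    (hf : ∀ x i, ∑ j, f x i j ≤ x i) {n n' : I ⊕ I × J → ℕ} {i : I}
    (hn : ∑ j, n (.inr (i, j)) ≤ init i + n (.inl i))
    (hstep : ∀ κ, n' κ = n κ ∨ n' κ = n κ + 1 ∧ 0 < clockSpeed init f n κ) :
    ∑ j, n' (.inr (i, j)) ≤ init i + n' (.inl i) := by
  have hcompletions : ∑ j, n' (.inr (i, j))
      ≤ ∑ j, (n (.inr (i, j)) + f (population init n) i j) :=
    Finset.sum_le_sum fun j _ => by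
      have := hstep (.inr (i, j))
      simp only [clockSpeed] at this
      lia
  have harrivals : n (.inl i) ≤ n' (.inl i) := by
    rcases hstep (.inl i) with h | ⟨h, -⟩ <;> lia
  have hserved := hf (population init n) i
  rw [Finset.sum_add_distrib] at hcompletions
  simp only [population] at hserved hcompletions
  lia

variable [Fintype I]

lemma System.clockSpeed_le {s : System I J} {f : (I → ℕ) → I → J → ℕ}
    (hf : ∀ x, s.IsAdmissible x (f x)) (n : I ⊕ I × J → ℕ) (κ : I ⊕ I × J) :
    clockSpeed s.init f n κ ≤ 1 + ∑ j, s.servers j := by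
  rcases κ with i | ⟨i, j⟩
  · exact Nat.le_add_right _ _
  · calc f (population s.init n) i j ≤ ∑ i, f (population s.init n) i j :=
          Finset.single_le_sum (f := fun i => f (population s.init n) i j)
            (fun _ _ => Nat.zero_le _) (Finset.mem_univ i)
      _ ≤ s.servers j := (hf _).stations j
      _ ≤ ∑ j, s.servers j := Finset.single_le_sum (fun _ _ => Nat.zero_le _) (Finset.mem_univ j)
      _ ≤ 1 + ∑ j, s.servers j := Nat.le_add_left _ _

/-- A state process `X` of the system `s` with primitive processes `A` and `S` when the allocation
of the servers is the function `f` of the state. -/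
structure IsFeedbackState (s : System I J) (P : Measure Ω) (A : I → ℝ≥0 → Ω → ℕ)
    (S : I → J → ℝ≥0 → Ω → ℕ) (f : (I → ℕ) → I → J → ℕ) (X : ℝ≥0 → Ω → I → ℕ) : Prop where
  measurable : ∀ t, Measurable (X t)
  measurable_path : ∀ ω, Measurable fun t => X t ω
  right_continuous : ∀ ω t, ContinuousWithinAt (fun u => X u ω) (Set.Ici t) t
  balance : ∀ᵐ ω ∂P, ∀ i t, (X t ω i : ℤ) =
    s.init i + A i t ω - ∑ j, (S i j (busyTime (fun u => f (X u ω) i j) t) ω : ℤ)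

theorem System.exists_isFeedbackState [IsProbabilityMeasure P] (s : System I J)
    {U : I → ℕ → Ω → ℝ} (hU : ∀ i, IsRenewalSequence (U i) P) {S : I → J → ℝ≥0 → Ω → ℕ}
    {rate : I → J → ℝ≥0} (hS : ∀ i j, IsPoissonProcess (S i j) (rate i j) P)
    {f : (I → ℕ) → I → J → ℕ} (hf : ∀ x, s.IsAdmissible x (f x)) :
    ∃ X, IsFeedbackState s P (arrivals U s.lam) S f X := by
  set σ : I ⊕ I × J → ℕ → Ω → ℝ≥0∞ := fun κ m ω => κ.elim
    (fun i => ENNReal.ofReal ((∑ k ∈ Finset.range (m + 1), U i k ω) / s.lam i))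
    fun p => ringTime (S p.1 p.2 · ω) m
  set N : I ⊕ I × J → ℝ≥0 → Ω → ℕ := fun κ t ω => κ.elim
    (fun i => arrivals U s.lam i t ω) fun p => S p.1 p.2 t ω
  have hclock : ∀ κ, ∀ᵐ ω ∂P, IsClock (σ κ · ω) (N κ · ω) := by
    rintro (i | ⟨i, j⟩)
    · filter_upwards [(hU i).ae_isRenewalPath] with ω hω using hω.isClock (s.lam_pos i)
    · exact (hS i j).ae_isClock_ringTime
  have hσ : ∀ κ m, AEMeasurable (σ κ m) P := by
    rintro (i | ⟨i, j⟩) m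
    · exact ((Finset.measurable_fun_sum _ fun k _ => (hU i).measurable k).div_const
        _).ennreal_ofReal.aemeasurable
    · exact IsClock.aemeasurable (hS i j).measurable (hclock (.inr (i, j))) m
  obtain ⟨σ', N', hσ', hN', hNN'⟩ := exists_isClock_modification hσ (ae_all_iff.2 hclock)
  obtain ⟨C, hC, hCpath, hCcont, hCeq, hCle⟩ := exists_timeChanged_count
    (s.clockSpeed_le hf) hσ' hN' (p := fun n => ∀ i, ∑ j, n (.inr (i, j)) ≤ s.init i + n (.inl i))
    (by simp)
    fun n n' hn hstep i => sum_completions_le_of_step (fun x => (hf x).customers) (hn i) hstep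
  refine ⟨fun t ω => population s.init (C t ω),
    fun t => (Measurable.of_discrete (f := population s.init)).comp (hC t),
    fun ω => (Measurable.of_discrete (f := population s.init)).comp (hCpath ω),
    fun ω t => (continuous_of_discreteTopology
      (f := population s.init)).continuousAt.comp_continuousWithinAt (hCcont ω t), ?_⟩
  filter_upwards [hNN'] with ω hω i t
  have harrivals : C t ω (.inl i) = arrivals U s.lam i t ω := by
    rw [hCeq, hω]
    exact congrArg (arrivals U s.lam i · ω) (busyTime_one t)
  have hcompletions : ∀ j, C t ω (.inr (i, j))
      = S i j (busyTime (fun u => f (population s.init (C u ω)) i j) t) ω := fun j => by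
    rw [hCeq, hω]
    rfl
  change ((s.init i + C t ω (.inl i) - ∑ j, C t ω (.inr (i, j)) : ℕ) : ℤ) = _
  rw [Nat.cast_sub (hCle ω t i), Nat.cast_add, Nat.cast_sum, harrivals]
  simp only [hcompletions]

lemma IsFeedbackState.isSCP {s : System I J} {A : I → ℝ≥0 → Ω → ℕ} {S : I → J → ℝ≥0 → Ω → ℕ}
    {f : (I → ℕ) → I → J → ℕ} {X : ℝ≥0 → Ω → I → ℕ} (hX : IsFeedbackState s P A S f X)
    (hf : ∀ x, s.IsAdmissible x (f x)) :
    IsSCP s P A S (fun i j t ω => f (X t ω) i j) (fun i t ω => X t ω i)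
      (fun i t ω => X t ω i - ∑ j, f (X t ω) i j)
      fun j t ω => s.servers j - ∑ i, f (X t ω) i j where
  right_continuous i j ω t := (continuous_of_discreteTopology
    (f := fun x => f x i j)).continuousAt.comp_continuousWithinAt (hX.right_continuous ω t)
  measurable_X i t := (measurable_pi_apply i).comp (hX.measurable t)
  measurable_Y i t := (Measurable.of_discrete (f := fun x => x i - ∑ j, f x i j)).comp
    (hX.measurable t)
  measurable_Z j t := (Measurable.of_discrete (f := fun x => s.servers j - ∑ i, f x i j)).comp
    (hX.measurable t)
  activity i j hmu _ _ := (hf _).activity i j hmu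
  balance := hX.balance
  customers i _ _ := Nat.sub_add_cancel ((hf _).customers i)
  stations j _ _ := Nat.sub_add_cancel ((hf _).stations j)
  adapted i j t := (Measurable.of_discrete (f := fun x => f x i j)).comp
    (@measurable_pi_lambda _ _ _ (history _ _ t) _ _ fun i => Measurable.of_comap_le
      (le_iSup_of_le t (le_iSup_of_le le_rfl (le_iSup_of_le i le_sup_left))))

end Existence

section Fluctuations

open Asymptotics

variable {I J Ω : Type*}

/-- The primitive processes stay within a distance of about `a` from their means: the arrivals up to
time `T`, and the services up to the amount of work that the servers can do until time `T`. -/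
def IsRegularPath (s : System I J) (A : I → ℝ≥0 → ℕ) (S : I → J → ℝ≥0 → ℕ) (T : ℝ≥0)
    (a : ℝ) : Prop :=
  (∀ i, ∀ t ≤ T, |(A i t : ℝ) - s.lam i * t| ≤ a + 1) ∧
  ∀ i j, ∀ u : ℝ≥0, (u : ℝ) ≤ s.servers j * T → |(S i j u : ℝ) - s.mu i j * u| ≤ a + s.mu i j

variable {α : Type*} {l : Filter α} {a b : α → ℝ}

lemma isBigO_natCeil {x : α → ℝ} (hx : x =O[l] b) (hb : (fun _ => (1 : ℝ)) =O[l] b) :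
    (fun n => (⌈x n⌉₊ : ℝ)) =O[l] b := by
  refine IsBigO.trans (.of_norm_le fun n => ?_) (hx.norm_left.add hb)
  rw [Real.norm_natCast]
  rcases le_total (x n) 0 with h | h
  · rw [Nat.ceil_eq_zero.2 h, Nat.cast_zero]
    positivity
  · exact (Nat.ceil_lt_add_one h).le.trans (by gcongr; exact le_abs_self _)

lemma tendsto_ofReal_natCeil_mul_div_sq {x r : α → ℝ} (hx : x =O[l] b)
    (hb : (fun _ => (1 : ℝ)) =O[l] b) (hr : r =O[l] fun _ => (1 : ℝ))
    (ha : b =o[l] fun n => a n ^ 2) :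
    Tendsto (fun n => ENNReal.ofReal (⌈x n⌉₊ * r n / a n ^ 2)) l (𝓝 0) := by
  have hmul : (fun n => ⌈x n⌉₊ * r n) =O[l] b := by simpa using (isBigO_natCeil hx hb).mul hr
  simpa using ENNReal.tendsto_ofReal (hmul.trans_isLittleO ha).tendsto_div_nhds_zero

variable [MeasurableSpace Ω] {P : Measure Ω}

lemma tendsto_measure_not_forall {ι : Type*} [Finite ι] {p : ι → α → Ω → Prop}
    (h : ∀ i, Tendsto (fun n => P {ω | ¬ p i n ω}) l (𝓝 0)) :
    Tendsto (fun n => P {ω | ¬ ∀ i, p i n ω}) l (𝓝 0) := by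
  have := Fintype.ofFinite ι
  refine tendsto_of_tendsto_of_tendsto_of_le_of_le tendsto_const_nhds
    (by simpa using tendsto_finsetSum Finset.univ fun i _ => h i) (fun _ => zero_le) fun n => ?_
  refine (measure_mono fun ω hω => ?_).trans (measure_iUnion_fintype_le P fun i => {ω | ¬ p i n ω})
  simpa using hω

lemma tendsto_measure_not_and {p q : α → Ω → Prop}
    (hp : Tendsto (fun n => P {ω | ¬ p n ω}) l (𝓝 0))
    (hq : Tendsto (fun n => P {ω | ¬ q n ω}) l (𝓝 0)) :
    Tendsto (fun n => P {ω | ¬ (p n ω ∧ q n ω)}) l (𝓝 0) := by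
  refine tendsto_of_tendsto_of_tendsto_of_le_of_le tendsto_const_nhds
    (by simpa using hp.add hq) (fun _ => zero_le) fun n => ?_
  exact (measure_mono fun ω hω => not_and_or.1 hω).trans (measure_union_le _ _)

lemma tendsto_measure_not_arrivals_near [IsProbabilityMeasure P] {U : I → ℕ → Ω → ℝ} {i : I}
    (hU : IsRenewalSequence (U i) P) {lam : α → I → ℝ} (hlam : ∀ n, 0 < lam n i)
    (hlamO : (fun n => lam n i) =O[l] b) (hb : (fun _ => (1 : ℝ)) =O[l] b) (ha0 : ∀ n, 0 < a n)
    (hab : a =O[l] b) (hba : b =o[l] fun n => a n ^ 2) (T : ℝ≥0) :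
    Tendsto (fun n => P {ω | ¬ ∀ t ≤ T, |(arrivals U (lam n) i t ω : ℝ) - lam n i * t| ≤ a n + 1})
      l (𝓝 0) := by
  have hx : (fun n => lam n i * T + a n) =O[l] b :=
    IsBigO.add (by simpa only [mul_comm] using hlamO.const_mul_left (T : ℝ)) hab
  refine tendsto_of_tendsto_of_tendsto_of_le_of_le tendsto_const_nhds
    (tendsto_ofReal_natCeil_mul_div_sq (r := fun _ => Var[U i 0; P]) hx hb
      (isBigO_const_const _ one_ne_zero _) hba) (fun _ => zero_le) fun n => ?_
  refine (measure_mono ?_).trans (hU.fluctuation_le (hlam n) ⌈lam n i * T + a n⌉₊ (ha0 n))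
  refine Set.compl_subset_compl.2 fun ω hω t ht => hω t ((Nat.le_ceil _).trans' ?_)
  have := (hlam n).le
  gcongr

lemma tendsto_measure_not_services_near [IsProbabilityMeasure P] {N : α → ℝ≥0 → Ω → ℕ}
    {r : α → ℝ≥0} (hN : ∀ n, IsPoissonProcess (N n) (r n) P)
    (hr : (fun n => (r n : ℝ)) =O[l] fun _ => (1 : ℝ)) {m : α → ℝ} (hm : m =O[l] b)
    (hb : (fun _ => (1 : ℝ)) =O[l] b) (ha0 : ∀ n, 0 < a n) (hba : b =o[l] fun n => a n ^ 2) :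
    Tendsto (fun n => P {ω | ¬ ∀ u : ℝ≥0, (u : ℝ) ≤ m n → |(N n u ω : ℝ) - r n * u| ≤ a n + r n})
      l (𝓝 0) := by
  refine tendsto_of_tendsto_of_tendsto_of_le_of_le tendsto_const_nhds
    (tendsto_ofReal_natCeil_mul_div_sq (hm.add hb) hb hr hba) (fun _ => zero_le) fun n => ?_
  refine (measure_mono ?_).trans ((hN n).fluctuation_le ⌈m n + 1⌉₊ (ha0 n))
  exact Set.compl_subset_compl.2 fun ω hω u hu => hω u ((Nat.le_ceil _).trans' (by gcongr))

variable {y : α → ℝ}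

lemma isBigO_sq_of_abs_sub_le {x : α → ℝ} {c v : ℝ} (hy : ∀ n, 1 ≤ y n)
    (hx : ∀ n, |x n - y n ^ 2 * v| ≤ c * y n) : x =O[l] fun n => y n ^ 2 := by
  have hself : y =O[l] fun n => y n ^ 2 := .of_norm_le fun n => by
    rw [Real.norm_of_nonneg (by linarith [hy n])]
    exact le_self_pow₀ (hy n) two_ne_zero
  have hdiff : (fun n => x n - y n ^ 2 * v) =O[l] fun n => y n ^ 2 :=
    (IsBigO.of_norm_le hx).trans (hself.const_mul_left c)
  simpa [mul_comm] using hdiff.add ((isBigO_refl (fun n => y n ^ 2) l).const_mul_left v)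

theorem tendsto_measure_not_isRegularPath [IsProbabilityMeasure P] [Finite I] [Fintype J]
    {U : I → ℕ → Ω → ℝ} (hU : ∀ i, IsRenewalSequence (U i) P) {F : Fluid I J} {ξ : I → J → ℝ}
    {c : ℝ} {sys : α → System I J} {S : α → I → J → ℝ≥0 → Ω → ℕ}
    (hS : ∀ n i j, IsPoissonProcess (S n i j) ((sys n).mu i j).toNNReal P) (hy : ∀ n, 1 ≤ y n)
    (hclose : ∀ n, IsClose F ξ c (y n) (sys n)) (ha0 : ∀ n, 0 < a n) (hya : y =o[l] a)
    (hay : a =O[l] fun n => y n ^ 2) (T : ℝ≥0) :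
    Tendsto (fun n => P {ω | ¬ IsRegularPath (sys n) (arrivals U (sys n).lam · · ω)
      (S n · · · ω) T (a n)}) l (𝓝 0) := by
  have hba : (fun n => y n ^ 2) =o[l] fun n => a n ^ 2 := hya.pow two_pos
  have hone : (fun _ => (1 : ℝ)) =O[l] fun n => y n ^ 2 := .of_norm_le fun n => by
    simpa using one_le_pow₀ (hy n) (n := 2)
  refine tendsto_measure_not_and (tendsto_measure_not_forall fun i => ?_)
    (tendsto_measure_not_forall fun i => tendsto_measure_not_forall fun j => ?_)
  · exact tendsto_measure_not_arrivals_near (hU i) (fun n => (sys n).lam_pos i)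
      (isBigO_sq_of_abs_sub_le hy fun n => (hclose n).lam i) hone ha0 hay hba T
  · have hmu : (fun n => (((sys n).mu i j).toNNReal : ℝ)) =O[l] fun _ => (1 : ℝ) :=
      .of_bound (F.mu i j + c) <| .of_forall fun n => by
        simpa [abs_of_nonneg, (sys n).mu_nonneg i j] using (hclose n).mu_le (hy n) i j
    have hservers : (fun n => ((sys n).servers j : ℝ) * T) =O[l] fun n => y n ^ 2 := by
      simpa [mul_comm] using (isBigO_sq_of_abs_sub_le hy
        fun n => (hclose n).servers j).const_mul_left (T : ℝ)
    simpa [(sys _).mu_nonneg i j] using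
      tendsto_measure_not_services_near (fun n => hS n i j) hmu hservers hone ha0 hba

end Fluctuations

section FeedbackPaths

open Set

variable {I J : Type*} [Fintype J]

/-- A path `X` of the state of the system `s` under the feedback `f`, for the paths `A` and `S` of
the primitive processes. -/
structure IsFeedbackPath (s : System I J) (A : I → ℝ≥0 → ℕ) (S : I → J → ℝ≥0 → ℕ)
    (f : (I → ℕ) → I → J → ℕ) (X : ℝ≥0 → I → ℕ) : Prop where
  measurable : Measurable X
  right_continuous : ∀ t, ContinuousWithinAt X (Ici t) t
  balance : ∀ i t, (X t i : ℤ) =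
    s.init i + A i t - ∑ j, (S i j (busyTime (fun u => f (X u) i j) t) : ℤ)

/-- The level `a` of the random fluctuations dominates the deterministic errors in the system `s`:
the scale `y`, the errors `c * y` of the parameters, and the contribution of single events. -/
structure IsNoiseLevel (s : System I J) (c y a : ℝ) : Prop where
  le : y ≤ a
  mul_le : c * y ≤ a
  rate_le : ∀ i, 1 + ∑ j, s.mu i j ≤ a

lemma busyTime_coe (ψ : ℝ≥0 → ℕ) (t : ℝ≥0) :
    (busyTime ψ t : ℝ) = ∫ u in (0 : ℝ)..t, (ψ u.toNNReal : ℝ) :=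
  Real.coe_toNNReal _ (intervalIntegral.integral_nonneg t.2 fun _ _ => Nat.cast_nonneg _)

lemma intervalIntegrable_comp_of_norm_le [Finite I] {V : Type*} [NormedAddCommGroup V]
    {X : ℝ≥0 → I → ℕ} (hX : Measurable X) (g : (I → ℕ) → V) {T B : ℝ} (hT : 0 ≤ T)
    (hB : ∀ t ∈ Ico 0 T, ‖g (X t.toNNReal)‖ ≤ B) :
    IntervalIntegrable (fun t => g (X t.toNNReal)) volume 0 T := by
  rw [intervalIntegrable_iff_integrableOn_Ico_of_le hT]
  exact Measure.integrableOn_of_bounded (by simp) (StronglyMeasurable.of_discrete.comp_measurable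
    (hX.comp measurable_real_toNNReal)).aestronglyMeasurable
    ((ae_restrict_iff' measurableSet_Ico).2 (.of_forall hB))

variable [Fintype I]

variable (I) in
/-- The sum of the coordinates, as a continuous linear functional; it reads off the total number of
customers from the deviations of the single classes. -/
noncomputable def coordSum : (I → ℝ) →L[ℝ] ℝ := ∑ i, ContinuousLinearMap.proj i

lemma coordSum_apply (x : I → ℝ) : coordSum I x = ∑ i, x i := by simp [coordSum]

lemma Fluid.IsCritical.neg_le_sum_deviation {F : Fluid I J} {ξ : I → J → ℝ} {c y : ℝ}
    {s : System I J} {x : I → ℕ} (hcrit : F.IsCritical ξ) (hclose : IsClose F ξ c y s)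
    (hx : ∑ j, s.servers j ≤ ∑ i, x i) :
    -(Fintype.card J * (c * y)) ≤ ∑ i, F.deviation ξ y x i := by
  have hservers : ∑ j, (y ^ 2 * F.nu j - s.servers j) ≤ ∑ _j : J, c * y :=
    Finset.sum_le_sum fun j _ => by linarith [(abs_le.1 (hclose.servers j)).1]
  have hx' : ∑ j, (s.servers j : ℝ) ≤ ∑ i, (x i : ℝ) := by exact_mod_cast hx
  simp only [Fluid.deviation, Finset.sum_sub_distrib, ← Finset.mul_sum, hcrit.sum_mass,
    Finset.sum_const, Finset.card_univ, nsmul_eq_mul] at hservers ⊢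
  linarith

lemma System.IsAdmissible.le_servers {s : System I J} {x : I → ℕ} {ψ : I → J → ℕ}
    (h : s.IsAdmissible x ψ) (i : I) (j : J) : ψ i j ≤ s.servers j :=
  (Finset.single_le_sum (f := fun i => ψ i j) (fun _ _ => Nat.zero_le _)
    (Finset.mem_univ i)).trans (h.stations j)

namespace IsFeedbackPath

variable {s : System I J} {A : I → ℝ≥0 → ℕ} {S : I → J → ℝ≥0 → ℕ} {f : (I → ℕ) → I → J → ℕ}
  {X : ℝ≥0 → I → ℕ} {F : Fluid I J} {ξ : I → J → ℝ} {C δ η c y a : ℝ} {T : ℝ≥0}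

lemma intervalIntegrable_allocation (h : IsFeedbackPath s A S f X)
    (hf : ∀ x, s.IsAdmissible x (f x)) (i : I) (j : J) (t : ℝ≥0) :
    IntervalIntegrable (fun u => (f (X u.toNNReal) i j : ℝ)) volume 0 t :=
  intervalIntegrable_comp_of_norm_le h.measurable (fun x => (f x i j : ℝ)) t.2 fun u _ => by
    rw [Real.norm_natCast]
    exact Nat.cast_le.2 ((hf (X u.toNNReal)).le_servers i j)

lemma busyTime_le (h : IsFeedbackPath s A S f X) (hf : ∀ x, s.IsAdmissible x (f x)) (i : I) (j : J)
    {t : ℝ≥0} (ht : t ≤ T) :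
    (busyTime (fun u => f (X u) i j) t : ℝ) ≤ s.servers j * T := by
  calc (busyTime (fun u => f (X u) i j) t : ℝ)
      ≤ ∫ _ in (0 : ℝ)..t, (s.servers j : ℝ) := by
        rw [busyTime_coe]
        exact intervalIntegral.integral_mono_on t.2 (h.intervalIntegrable_allocation hf i j t)
          intervalIntegrable_const fun u _ => Nat.cast_le.2 ((hf _).le_servers i j)
    _ = s.servers j * t := by simp [mul_comm]
    _ ≤ s.servers j * T := by gcongr

lemma intervalIntegrable_serviceRate (h : IsFeedbackPath s A S f X)
    (hf : ∀ x, s.IsAdmissible x (f x)) (i : I) (t : ℝ≥0) :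
    IntervalIntegrable (fun u => ∑ j, s.mu i j * (f (X u.toNNReal) i j : ℝ)) volume 0 t := by
  simpa only [Finset.sum_fn] using IntervalIntegrable.sum Finset.univ fun j _ =>
    (h.intervalIntegrable_allocation hf i j t).const_mul (s.mu i j)

lemma intervalIntegrable_netInflow (h : IsFeedbackPath s A S f X)
    (hf : ∀ x, s.IsAdmissible x (f x)) (t : ℝ≥0) :
    IntervalIntegrable (fun u => s.netInflow (f (X u.toNNReal))) volume 0 t := by
  rw [intervalIntegrable_iff, IntegrableOn, integrable_pi_iff]
  exact fun i => intervalIntegrable_iff.1 <|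
    intervalIntegrable_const.sub (h.intervalIntegrable_serviceRate hf i t)

lemma integral_netInflow (h : IsFeedbackPath s A S f X) (hf : ∀ x, s.IsAdmissible x (f x)) (i : I)
    (t : ℝ≥0) :
    (∫ u in (0 : ℝ)..t, s.netInflow (f (X u.toNNReal))) i =
      s.lam i * t - ∑ j, s.mu i j * busyTime (fun u => f (X u) i j) t := by
  calc (∫ u in (0 : ℝ)..t, s.netInflow (f (X u.toNNReal))) i
      = ∫ u in (0 : ℝ)..t, (s.lam i - ∑ j, s.mu i j * (f (X u.toNNReal) i j : ℝ)) :=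
        ((ContinuousLinearMap.proj (R := ℝ) (φ := fun _ : I => ℝ) i).intervalIntegral_comp_comm
          (h.intervalIntegrable_netInflow hf t)).symm
    _ = s.lam i * t - ∑ j, s.mu i j * busyTime (fun u => f (X u) i j) t := by
        rw [intervalIntegral.integral_sub intervalIntegrable_const
            (h.intervalIntegrable_serviceRate hf i t),
          intervalIntegral.integral_finsetSum fun j _ =>
            (h.intervalIntegrable_allocation hf i j t).const_mul (s.mu i j)]
        simp [busyTime_coe, mul_comm]

lemma deviation_sub_integral (h : IsFeedbackPath s A S f X) (hf : ∀ x, s.IsAdmissible x (f x))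
    (i : I) (t : ℝ≥0) :
    F.deviation ξ y (X t) i - (∫ u in (0 : ℝ)..t, s.netInflow (f (X u.toNNReal))) i =
      (s.init i - y ^ 2 * F.mass ξ i) + (A i t - s.lam i * t) -
        ∑ j, ((S i j (busyTime (fun u => f (X u) i j) t) : ℝ) -
          s.mu i j * busyTime (fun u => f (X u) i j) t) := by
  have hbal : (X t i : ℝ) = s.init i + A i t -
      ∑ j, (S i j (busyTime (fun u => f (X u) i j) t) : ℝ) := by
    exact_mod_cast congrArg (Int.cast : ℤ → ℝ) (h.balance i t)
  rw [h.integral_netInflow hf, Fluid.deviation, hbal, Finset.sum_sub_distrib]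
  ring

lemma norm_deviation_sub_integral_le (h : IsFeedbackPath s A S f X)
    (hf : ∀ x, s.IsAdmissible x (f x)) (hclose : IsClose F ξ c y s)
    (hreg : IsRegularPath s A S T a) (ha : 0 ≤ a) (hnoise : IsNoiseLevel s c y a) {t : ℝ≥0}
    (ht : t ≤ T) :
    ‖F.deviation ξ y (X t) - ∫ u in (0 : ℝ)..t, s.netInflow (f (X u.toNNReal))‖ ≤
      (Fintype.card J + 3) * a := by
  refine (pi_norm_le_iff_of_nonneg (by positivity)).2 fun i => ?_
  have hservices : |∑ j, ((S i j (busyTime (fun u => f (X u) i j) t) : ℝ) -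
      s.mu i j * busyTime (fun u => f (X u) i j) t)| ≤ ∑ j, (a + s.mu i j) :=
    (Finset.abs_sum_le_sum_abs _ _).trans
      (Finset.sum_le_sum fun j _ => hreg.2 i j _ (h.busyTime_le hf i j ht))
  rw [Finset.sum_add_distrib, Finset.sum_const, Finset.card_univ, nsmul_eq_mul] at hservices
  rw [Pi.sub_apply, h.deviation_sub_integral hf, Real.norm_eq_abs]
  calc _ ≤ |s.init i - y ^ 2 * F.mass ξ i| + |A i t - s.lam i * t| + |∑ j, _| :=
        (abs_sub _ _).trans (by gcongr; exact abs_add_le _ _)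
    _ ≤ a + (a + 1) + (Fintype.card J * a + ∑ j, s.mu i j) := by
        gcongr
        · exact (hclose.init i).trans hnoise.mul_le
        · exact hreg.1 i t ht
    _ ≤ (Fintype.card J + 3) * a := by linarith [hnoise.rate_le i]

/-- The times at which the customers outnumber the servers. -/
def overload (s : System I J) (X : ℝ≥0 → I → ℕ) : Set ℝ :=
  {u | ∑ j, s.servers j < ∑ i, X u.toNNReal i}

lemma isControlledPath (h : IsFeedbackPath s A S f X) (hf : ∀ x, s.IsAdmissible x (f x))
    (hcrit : F.IsCritical ξ) (hclose : IsClose F ξ c y s)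
    (hstab : ∀ x, IsStabilizing F ξ C δ η y s x (f x)) (hC : 0 ≤ C) (hreg : IsRegularPath s A S T a)
    (hy : 0 ≤ y) (hnoise : IsNoiseLevel s c y a) {t : ℝ≥0} (ht : t ≤ T)
    (hdev : ∀ u ∈ Ico (0 : ℝ) t, ‖F.deviation ξ y (X u.toNNReal)‖ ≤ η * y ^ 2) :
    IsControlledPath (coordSum I) C δ ((Fintype.card J + 3) * a) (y ^ 2) t (overload s X)
      (fun u => F.deviation ξ y (X u.toNNReal)) fun u => s.netInflow (f (X u.toNNReal)) := by
  have ha : 0 ≤ a := hy.trans hnoise.le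
  have hcard : 0 ≤ Fintype.card J * a := by positivity
  refine
    { measurableSet := (h.measurable.comp measurable_real_toNNReal)
        (DiscreteMeasurableSpace.forall_measurableSet {x : I → ℕ | ∑ j, s.servers j < ∑ i, x i})
      right_continuous := fun u => (continuous_of_discreteTopology
        (f := F.deviation ξ y)).continuousAt.comp_continuousWithinAt
          ((h.right_continuous u.toNNReal).comp continuous_real_toNNReal.continuousWithinAt
            fun _ hv => Real.toNNReal_le_toNNReal hv)
      intervalIntegrable := intervalIntegrable_comp_of_norm_le h.measurable _ t.2 hdev
      intervalIntegrable_drift := h.intervalIntegrable_netInflow hf t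
      norm_sub_integral_le := fun u hu => ?_
      norm_drift_le := fun u hu huO => ?_
      norm_drift_le_of_mem := fun u hu huO => ((hstab _).drain (hdev u hu) huO).1
      drift_le := fun u hu huO => ?_
      neg_le := fun u _ huO => ?_ }
  · have hut : u.toNNReal ≤ t := Real.toNNReal_le_iff_le_coe.2 hu.2
    simpa only [Real.coe_toNNReal u hu.1] using
      h.norm_deviation_sub_integral_le hf hclose hreg ha hnoise (hut.trans ht)
  · refine ((hstab _).serve (hdev u hu) (not_lt.1 huO)).2.trans ?_
    gcongr
    linarith [hnoise.le, hcard]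
  · simpa only [coordSum_apply] using ((hstab _).drain (hdev u hu) huO).2
  · rw [coordSum_apply]
    refine le_trans ?_ (hcrit.neg_le_sum_deviation hclose (le_of_lt huO))
    have := mul_le_mul_of_nonneg_left hnoise.mul_le (Nat.cast_nonneg (α := ℝ) (Fintype.card J))
    linarith

variable (F ξ) in
lemma exists_norm_deviation_le (hC : 0 ≤ C) (hδ : 0 < δ) (T : ℝ≥0) (hcrit : F.IsCritical ξ) :
    ∃ K, 0 < K ∧ ∀ (c η y a : ℝ) (s : System I J) (A : I → ℝ≥0 → ℕ) (S : I → J → ℝ≥0 → ℕ)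
      (f : (I → ℕ) → I → J → ℕ) (X : ℝ≥0 → I → ℕ), (∀ x, s.IsAdmissible x (f x)) →
      IsClose F ξ c y s → (∀ x, IsStabilizing F ξ C δ η y s x (f x)) → 0 < y →
      IsNoiseLevel s c y a → K * a < η * y ^ 2 → IsRegularPath s A S T a →
      IsFeedbackPath s A S f X → (∀ t ≤ T, ‖F.deviation ξ y (X t)‖ ≤ K * a) ∧
        volume (overload s X ∩ Icc 0 T) ≤ ENNReal.ofReal (K * a / y ^ 2) := by
  obtain ⟨K, hK, hbound⟩ := IsControlledPath.exists_forall_norm_le (coordSum I) hC hδ T.2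
  refine ⟨K * (Fintype.card J + 3), by positivity,
    fun c η y a s A S f X hf hclose hstab hy hnoise hKa hreg h => ?_⟩
  rw [mul_assoc] at hKa ⊢
  have ha : 0 ≤ a := hy.le.trans hnoise.le
  obtain ⟨hdev, hover⟩ := hbound _ (y ^ 2) (η * y ^ 2) (overload s X) _ _ (by positivity)
    (by positivity) hKa fun t ht hdev => by
      lift t to ℝ≥0 using ht.1
      exact h.isControlledPath hf hcrit hclose hstab hC hreg hy.le hnoise
        (NNReal.coe_le_coe.1 ht.2) hdev
  exact ⟨fun t ht => by simpa using hdev t ⟨t.2, ht⟩, hover⟩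

lemma queueing_subset_overload (hstab : ∀ x, IsStabilizing F ξ C δ η y s x (f x))
    (hdev : ∀ t ≤ T, ‖F.deviation ξ y (X t)‖ ≤ η * y ^ 2) :
    {u : ℝ | u ∈ Icc (0 : ℝ) T ∧ 0 < ∑ i, (X u.toNNReal i - ∑ j, f (X u.toNNReal) i j)} ⊆
      overload s X ∩ Icc 0 T := by
  refine fun u ⟨hu, hqueue⟩ => ⟨?_, hu⟩
  by_contra hover
  obtain ⟨hserve, -⟩ :=
    (hstab _).serve (hdev _ (Real.toNNReal_le_iff_le_coe.2 hu.2)) (not_lt.1 hover)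
  refine hqueue.ne' ?_
  simp only [hserve, tsub_self, Finset.sum_const_zero]

end IsFeedbackPath

end FeedbackPaths

section Limit

open Asymptotics

lemma isLittleO_rpow_rpow_pnat {p q : ℝ} (h : p < q) :
    (fun n : ℕ+ => (n : ℝ) ^ p) =o[atTop] fun n : ℕ+ => (n : ℝ) ^ q := by
  have hlim : Tendsto (fun n : ℕ+ => (n : ℝ) ^ (-(q - p))) atTop (𝓝 0) :=
    (tendsto_rpow_neg_atTop (sub_pos.2 h)).comp
      (tendsto_natCast_atTop_atTop.comp tendsto_PNat_val_atTop_atTop)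
  have hpos : ∀ n : ℕ+, 0 < (n : ℝ) := fun n => Nat.cast_pos.2 n.pos
  refine (isLittleO_iff_tendsto fun n hn => absurd hn (Real.rpow_pos_of_pos (hpos n) q).ne').2
    (hlim.congr fun n => ?_)
  rw [← Real.rpow_sub (hpos n), neg_sub]

variable {I J Ω : Type*} [Fintype J]

lemma supDeviation_le [Fintype I] {F : Fluid I J} {ξ : I → J → ℝ} {c y b : ℝ} {s : System I J}
    (hclose : IsClose F ξ c y s) {X : ℝ≥0 → Ω → I → ℕ} {T : ℝ≥0} {ω : Ω}
    (hX : ∀ t ≤ T, ‖F.deviation ξ y (X t ω)‖ ≤ b) :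
    supDeviation (fun i t ω => X t ω i) s.init T ω ≤
      ENNReal.ofReal (Fintype.card I * (b + c * y)) := by
  refine iSup₂_le fun t ht => ENNReal.ofReal_le_ofReal ?_
  have hcoord : ∀ i, |(X t ω i : ℝ) - s.init i| ≤ b + c * y := fun i => by
    have hdev : |F.deviation ξ y (X t ω) i| ≤ b := (norm_le_pi_norm _ i).trans (hX t ht)
    have hsplit : (X t ω i : ℝ) - s.init i =
        F.deviation ξ y (X t ω) i - (s.init i - y ^ 2 * F.mass ξ i) := by
      rw [Fluid.deviation]
      ring
    rw [hsplit]
    exact (abs_sub _ _).trans (add_le_add hdev (hclose.init i))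
  simpa [mul_add] using Finset.sum_le_sum fun i (_ : i ∈ Finset.univ) => hcoord i

variable [MeasurableSpace Ω] {P : Measure Ω}

lemma tendstoZeroInProb_of_forall_le {f : ℕ+ → Ω → ℝ≥0∞} {b : ℕ+ → ℝ} {good : ℕ+ → Ω → Prop}
    (hgood : Tendsto (fun n => P {ω | ¬ good n ω}) atTop (𝓝 0)) (hb : Tendsto b atTop (𝓝 0))
    (hf : ∀ n ω, good n ω → f n ω ≤ ENNReal.ofReal (b n)) : TendstoZeroInProb P f := fun ε hε => by
  refine tendsto_of_tendsto_of_tendsto_of_le_of_le' tendsto_const_nhds hgood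
    (.of_forall fun _ => zero_le) ?_
  filter_upwards [hb.eventually_lt_const hε] with n hn
  exact measure_mono fun ω hω hgood =>
    (((ENNReal.ofReal_lt_ofReal_iff hε).2 hn).trans_le hω).not_ge (hf n ω hgood)

lemma IsFeedbackState.ae_isFeedbackPath {s : System I J} {A : I → ℝ≥0 → Ω → ℕ}
    {S : I → J → ℝ≥0 → Ω → ℕ} {f : (I → ℕ) → I → J → ℕ} {X : ℝ≥0 → Ω → I → ℕ}
    (hX : IsFeedbackState s P A S f X) :
    ∀ᵐ ω ∂P, IsFeedbackPath s (A · · ω) (S · · · ω) f (X · ω) := by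
  filter_upwards [hX.balance] with ω hω
  exact ⟨hX.measurable_path ω, hX.right_continuous ω, hω⟩

variable {ι : Type*} {l : Filter ι} {F : Fluid I J} {ξ : I → J → ℝ} {c C δ η : ℝ} {y a : ι → ℝ}
  {sys : ι → System I J}

lemma eventually_isNoiseLevel [Finite I] (hclose : ∀ n, IsClose F ξ c (y n) (sys n))
    (hy : ∀ n, 1 ≤ y n) (ha : ∀ n, 0 < a n) (hya : y =o[l] a) :
    ∀ᶠ n in l, IsNoiseLevel (sys n) c (y n) (a n) := by
  have hle : ∀ {b : ι → ℝ}, b =o[l] a → ∀ᶠ n in l, b n ≤ a n := fun hb => by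
    filter_upwards [hb.def one_pos] with n hn
    rw [one_mul, Real.norm_of_nonneg (ha n).le] at hn
    exact (le_abs_self _).trans hn
  have hone : (fun _ => (1 : ℝ)) =O[l] y := .of_norm_le fun n => by simpa using hy n
  filter_upwards [hle hya, hle (hya.const_mul_left c), eventually_all.2 fun i =>
    hle (((isBigO_const_const (1 + ∑ j, (F.mu i j + c)) one_ne_zero l).trans
      hone).trans_isLittleO hya)] with n hle hmul hrate
  refine ⟨hle, hmul, fun i => le_trans ?_ (hrate i)⟩
  gcongr with j
  exact (hclose n).mu_le (hy n) i j

variable [Fintype I]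

theorem exists_tendsto_measure_not_queueTime_supDeviation_le [IsProbabilityMeasure P]
    {U : I → ℕ → Ω → ℝ} (hU : ∀ i, IsRenewalSequence (U i) P) {S : ι → I → J → ℝ≥0 → Ω → ℕ}
    (hS : ∀ n i j, IsPoissonProcess (S n i j) ((sys n).mu i j).toNNReal P)
    (hcrit : F.IsCritical ξ) (hy : ∀ n, 1 ≤ y n) (hclose : ∀ n, IsClose F ξ c (y n) (sys n))
    {f : ι → (I → ℕ) → I → J → ℕ} (hf : ∀ n x, (sys n).IsAdmissible x (f n x))
    (hC : 0 ≤ C) (hδ : 0 < δ) (hη : 0 < η)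
    (hstab : ∀ᶠ n in l, ∀ x, IsStabilizing F ξ C δ η (y n) (sys n) x (f n x))
    {X : ι → ℝ≥0 → Ω → I → ℕ}
    (hX : ∀ n, IsFeedbackState (sys n) P (arrivals U (sys n).lam) (S n) (f n) (X n))
    (ha : ∀ n, 0 < a n) (hya : y =o[l] a) (hay : a =o[l] fun n => y n ^ 2) (T : ℝ≥0) :
    ∃ K, Tendsto (fun n => P {ω | ¬ (
      queueTime (fun i t ω => X n t ω i - ∑ j, f n (X n t ω) i j) T ω ≤
        ENNReal.ofReal (K * (a n / y n ^ 2)) ∧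
      supDeviation (fun i t ω => X n t ω i) (sys n).init T ω ≤
        ENNReal.ofReal (Fintype.card I * ((K + 1) * a n)))}) l (𝓝 0) := by
  obtain ⟨K, hK, hbound⟩ := IsFeedbackPath.exists_norm_deviation_le F ξ hC hδ T hcrit
  have hsmall : ∀ᶠ n in l, K * a n < η * y n ^ 2 := by
    filter_upwards [(hay.const_mul_left K).def (half_pos hη)] with n hn
    have hy2 : 0 < y n ^ 2 := by have := hy n; positivity
    rw [Real.norm_of_nonneg (mul_pos hK (ha n)).le, Real.norm_of_nonneg hy2.le] at hn
    nlinarith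
  refine ⟨K, tendsto_of_tendsto_of_tendsto_of_le_of_le' tendsto_const_nhds
    (tendsto_measure_not_isRegularPath hU hS hy hclose ha hya hay.isBigO T)
    (.of_forall fun _ => zero_le) ?_⟩
  filter_upwards [hstab, hsmall, eventually_isNoiseLevel hclose hy ha hya] with n hn hKa hnoise
  refine measure_mono_ae ?_
  filter_upwards [(hX n).ae_isFeedbackPath] with ω hpath
  refine mt fun hreg => ?_
  have hy0 : 0 < y n := one_pos.trans_le (hy n)
  obtain ⟨hdev, hover⟩ :=
    hbound c η (y n) (a n) (sys n) _ _ (f n) _ (hf n) (hclose n) hn hy0 hnoise hKa hreg hpath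
  constructor
  · rw [← mul_div_assoc]
    exact (measure_mono (IsFeedbackPath.queueing_subset_overload hn
      fun t ht => (hdev t ht).trans hKa.le)).trans hover
  · refine (supDeviation_le (hclose n) hdev).trans (ENNReal.ofReal_le_ofReal ?_)
    rw [add_one_mul]
    gcongr
    exact hnoise.mul_le

theorem exists_isSCP_tendsto_measure [IsProbabilityMeasure P] {sys : ℕ+ → System I J}
    {U : I → ℕ → Ω → ℝ} (hU : ∀ i, IsRenewalSequence (U i) P) {S : ℕ+ → I → J → ℝ≥0 → Ω → ℕ}
    (hS : ∀ n i j, IsPoissonProcess (S n i j) ((sys n).mu i j).toNNReal P)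
    (hcrit : F.IsCritical ξ) (hconn : (F.basicGraph ξ).Connected) (hsecond : SecondOrder F ξ sys)
    (hsub : F.ThroughputSuboptimal ξ) :
    ∃ (Ψ : ℕ+ → I → J → ℝ≥0 → Ω → ℕ) (X Y : ℕ+ → I → ℝ≥0 → Ω → ℕ) (Z : ℕ+ → J → ℝ≥0 → Ω → ℕ),
      (∀ n, IsSCP (sys n) P (arrivals U (sys n).lam) (S n) (Ψ n) (X n) (Y n) (Z n)) ∧
      ∀ T : ℝ≥0, ∀ α : ℝ, 1 / 2 < α → α < 1 → ∃ K L, Tendsto (fun n : ℕ+ => P {ω | ¬ (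
        queueTime (Y n) T ω ≤ ENNReal.ofReal (K * ((n : ℝ) ^ α / n)) ∧
        supDeviation (X n) (sys n).init T ω ≤ ENNReal.ofReal (L * (n : ℝ) ^ α))}) atTop (𝓝 0) := by
  have := hcrit.nonempty_classes hconn
  have := hcrit.nonempty_stations hconn
  obtain ⟨c, hc, hclose⟩ := hsecond.exists_isClose
  obtain ⟨C, δ, η, hC, hδ, hη, f, hf, hstab⟩ := hcrit.exists_feedback hconn hsub hc hclose
  choose X hX using fun n => (sys n).exists_isFeedbackState hU (hS n) (hf n)
  refine ⟨_, _, _, _, fun n => (hX n).isSCP (hf n), fun T α hα hα1 => ?_⟩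
  have hsqrt : ∀ n : ℕ+, 1 ≤ √(n : ℝ) := fun n => Real.one_le_sqrt.2 (Nat.one_le_cast.2 n.pos)
  have hsq : ∀ n : ℕ+, √(n : ℝ) ^ 2 = n := fun n => Real.sq_sqrt n.val.cast_nonneg
  obtain ⟨K, hK⟩ := exists_tendsto_measure_not_queueTime_supDeviation_le hU hS hcrit hsqrt hclose
    hf hC hδ hη hstab hX (a := fun n : ℕ+ => (n : ℝ) ^ α)
    (fun n => Real.rpow_pos_of_pos (Nat.cast_pos.2 n.pos) α)
    (by simpa only [Real.sqrt_eq_rpow] using isLittleO_rpow_rpow_pnat hα)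
    (by simpa only [hsq, Real.rpow_one] using isLittleO_rpow_rpow_pnat hα1) T
  refine ⟨K, Fintype.card I * (K + 1), ?_⟩
  simpa only [hsq, mul_assoc] using hK

end Limit

end ManyServer

open ManyServer in
theorem theorem1_general {I J Ω : Type*} [Fintype I] [Fintype J] [MeasurableSpace Ω]
    (P : Measure Ω) [IsProbabilityMeasure P] (F : Fluid I J) (sys : ℕ+ → System I J)
    (U : I → ℕ → Ω → ℝ) (hU : ∀ i, IsRenewalSequence (U i) P) (S : ℕ+ → I → J → ℝ≥0 → Ω → ℕ)
    (hS : ∀ n i j, IsPoissonProcess (S n i j) ((sys n).mu i j).toNNReal P)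
    (ξ : I → J → ℝ) (hcrit : F.IsCritical ξ) (hconn : (F.basicGraph ξ).Connected)
    (hsecond : SecondOrder F ξ sys) (hsub : F.ThroughputSuboptimal ξ) :
    ∃ (Ψ : ℕ+ → I → J → ℝ≥0 → Ω → ℕ) (X Y : ℕ+ → I → ℝ≥0 → Ω → ℕ) (Z : ℕ+ → J → ℝ≥0 → Ω → ℕ),
      (∀ n, IsSCP (sys n) P (arrivals U (sys n).lam) (S n) (Ψ n) (X n) (Y n) (Z n)) ∧
      ∀ T : ℝ≥0, TendstoZeroInProb P (fun n => queueTime (Y n) T) ∧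
        ∀ ϱ : ℝ, 1 / 2 < ϱ → TendstoZeroInProb P (fun n ω =>
          ENNReal.ofReal ((n : ℝ) ^ (-ϱ)) * supDeviation (X n) (sys n).init T ω) := by
  obtain ⟨Ψ, X, Y, Z, hSCP, h⟩ := exists_isSCP_tendsto_measure hU hS hcrit hconn hsecond hsub
  refine ⟨Ψ, X, Y, Z, hSCP, fun T => ⟨?_, fun ϱ hϱ => ?_⟩⟩
  · obtain ⟨K, L, hKL⟩ := h T (3 / 4) (by norm_num) (by norm_num)
    have hlim : Tendsto (fun n : ℕ+ => K * ((n : ℝ) ^ (3 / 4 : ℝ) / n)) atTop (𝓝 0) := by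
      simpa using (isLittleO_rpow_rpow_pnat
        (show (3 / 4 : ℝ) < 1 by norm_num)).tendsto_div_nhds_zero.const_mul K
    exact tendstoZeroInProb_of_forall_le hKL hlim fun n ω hω => hω.1
  · obtain ⟨α, hα, hαϱ⟩ := exists_between (lt_min hϱ one_half_lt_one)
    obtain ⟨K, L, hKL⟩ := h T α hα (hαϱ.trans_le (min_le_right _ _))
    have hlim : Tendsto (fun n : ℕ+ => (n : ℝ) ^ (-ϱ) * (L * (n : ℝ) ^ α)) atTop (𝓝 0) := by
      have hdiv := (isLittleO_rpow_rpow_pnat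
        (hαϱ.trans_le (min_le_left _ _))).tendsto_div_nhds_zero.const_mul L
      rw [mul_zero] at hdiv
      refine hdiv.congr fun n => ?_
      rw [Real.rpow_neg n.val.cast_nonneg, div_eq_mul_inv]
      ring
    refine tendstoZeroInProb_of_forall_le hKL hlim fun n ω hω => ?_
    rw [ENNReal.ofReal_mul (by positivity)]
    exact mul_le_mul_right hω.2 _

theorem theorem1 {I J Ω : Type*} [Fintype I] [Fintype J] [MeasurableSpace Ω]
    (P : Measure Ω) [IsProbabilityMeasure P]
    (F : ManyServer.Fluid I J) (sys : ℕ+ → ManyServer.System I J)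
    (hact : ∀ n i j, 0 < (sys n).mu i j ↔ 0 < F.mu i j)
    (U : I → ℕ → Ω → ℝ) (hU : ManyServer.IsRenewalInput U P)
    (S : ℕ+ → I → J → ℝ≥0 → Ω → ℕ)
    (hS : ∀ n, ManyServer.IsServiceInput (S n) (sys n).mu
      (ManyServer.arrivals U (sys n).lam) P)
    (ξ : I → J → ℝ) (hcrit : F.IsCritical ξ) (htree : (F.basicGraph ξ).IsTree)
    (hsecond : ManyServer.SecondOrder F ξ sys) (hsub : F.ThroughputSuboptimal ξ) :
    ∃ (Ψ : ℕ+ → I → J → ℝ≥0 → Ω → ℕ) (X Y : ℕ+ → I → ℝ≥0 → Ω → ℕ)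
      (Z : ℕ+ → J → ℝ≥0 → Ω → ℕ),
      (∀ n, ManyServer.IsSCP (sys n) P (ManyServer.arrivals U (sys n).lam) (S n)
        (Ψ n) (X n) (Y n) (Z n)) ∧
      ∀ T : ℝ≥0, 0 < T →
        ManyServer.TendstoZeroInProb P (fun n => ManyServer.queueTime (Y n) T) ∧
        ∀ ϱ : ℝ, 1 / 2 < ϱ →
          ManyServer.TendstoZeroInProb P
            (fun n ω => ENNReal.ofReal ((n : ℝ) ^ (-ϱ)) *
              ManyServer.supDeviation (X n) (sys n).init T ω) := by
  obtain ⟨Ψ, X, Y, Z, hSCP, h⟩ := theorem1_general P F sys U hU.isRenewalSequence S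
    (fun n => (hS n).poisson) ξ hcrit htree.connected hsecond hsub
  exact ⟨Ψ, X, Y, Z, hSCP, fun T _ => h T⟩
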